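/- Let $n\ge 3$, $m=\frac{n-2}{n+2}$, and for $\rho\in\{1,-1,0\}$ and $\beta\in\mathbb R$ put $\gamma=\frac{2\beta+\rho}{1-m}$. Consider positive, smooth, radially symmetric solutions $u:\mathbb R^n\to(0,\infty)$ of $$\frac{n-1}{m}\,\Delta u^m+\beta\,x\cdot\nabla u+\gamma u=0\quad\text{on }\mathbb R^n. \tag{E}$$ Call a family $(u_\lambda)_{\lambda>0}$ of such solutions *complete* if every $a>0$ is the value $u_\lambda(0)$ for exactly one $\lambda>0$, and every positive smooth radial solution $v$ of (E) with $v(0)=u_\lambda(0)$ equals $u_\lambda$. (Thus the family consists of all such solutions, each determined by its value at the origin.) For positive functions, $f\asymp g$ as $|x|\to\infty$ means $c\,g\le f\le C\,g$ for $|x|$ large, with some constants $c,C>0$. **Existence of nontrivial solutions.** (E) has a nonconstant positive smooth radial solution if and only if either $\beta\ge 0$ and $\gamma>0$, or $\rho=-1$, $\beta>0$ and $\gamma<0$. **(i) Shrinkers, $\rho=1$.** For every $\beta>0$ there is a complete family $(u_\lambda)_{\lambda>0}$ of solutions with $u_\lambda(0)=\lambda$ and $u_\lambda(x)\asymp|x|^{-\frac{2}{1-m}}$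 as $|x|\to\infty$ (cigars). If $\beta>0$ and $\gamma=\beta n$, then $$u_\lambda(x)=\Big(\frac{(n-2)(n-1)}{\lambda^2+|x|^2}\Big)^{\frac1{1-m}},\qquad\lambda>0,$$ is a complete family (Barenblatt solutions). If $\beta=0$, so that $\gamma=\frac1{1-m}$, then $$u_\lambda(x)=\Big(\frac{\sqrt{4n(n-1)}\,\lambda}{\lambda^2+|x|^2}\Big)^{\frac2{1-m}},\qquad\lambda>0,$$ is a complete family (spheres), and $u_\lambda(x)\asymp|x|^{-\frac4{1-m}}$ as $|x|\to\infty$. **(ii) Expanders, $\rho=-1$.** For every $\beta>0$ (so that $\gamma=\frac{2\beta-1}{1-m}>-\frac1{1-m}$) there is a complete family $(u_\lambda)_{\lambda>0}$ of solutions with $u_\lambda(0)=\lambda$. **(iii) Steady solitons, $\rho=0$.** For every $\beta>0$ (so that $\gamma=\frac{2\beta}{1-m}>0$) there is a complete family $(u_\lambda)_{\lambda>0}$ of solutions with $u_\lambda(0)=\lambda$ and $u_\lambda(x)\asymp\big(\frac{\log|x|}{|x|^2}\big)^{\frac1{1-m}}$ as $|x|\to\infty$ (logarithmic cigars). If $\beta=0$,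 so that $\gamma=0$, the positive smooth radial solutions are exactly the positive constants. -/

import Mathlib

open scoped ContDiff Laplacian Gradient

/-- The exponent `m = (n - 2) / (n + 2)`. -/
noncomputable def yamabeM (n : ℕ) : ℝ := ((n : ℝ) - 2) / ((n : ℝ) + 2)

/-- The coefficient `γ = (2 β + ρ) / (1 - m)`. -/
noncomputable def yamabeGamma (n : ℕ) (β ρ : ℝ) : ℝ := (2 * β + ρ) / (1 - yamabeM n)

/-- `u` is a positive, radially symmetric, smooth function on the whole of `ℝⁿ` which solves
`(n - 1) / m * Δ (u ^ m) + β * (x · ∇ u) + γ * u = 0`. -/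
structure IsRadialSolution (n : ℕ) (β γ : ℝ) (u : EuclideanSpace ℝ (Fin n) → ℝ) : Prop where
  smooth : ContDiff ℝ ∞ u
  pos : ∀ x, 0 < u x
  radial : ∀ x y, ‖x‖ = ‖y‖ → u x = u y
  equation : ∀ x, ((n : ℝ) - 1) / yamabeM n * (Δ (fun y => u y ^ yamabeM n)) x
    + β * inner ℝ x (∇ u x) + γ * u x = 0

/-- `u l`, `l > 0`, is a one-parameter family consisting of exactly all the positive radial smooth
solutions: each member is a solution, each positive number is the value at the origin of exactly
one member, and a solution with the same value at the origin as `u l` is `u l` itself. -/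
structure IsSolutionFamily (n : ℕ) (β γ : ℝ) (u : ℝ → EuclideanSpace ℝ (Fin n) → ℝ) : Prop where
  solution : ∀ l, 0 < l → IsRadialSolution n β γ (u l)
  parameter : ∀ a, 0 < a → ∃! l, 0 < l ∧ u l 0 = a
  unique : ∀ l, 0 < l → ∀ v, IsRadialSolution n β γ v → v 0 = u l 0 → v = u l

/-- The Barenblatt functions `(C / (l² + |x|²)) ^ (1 / (1 - m))`, `C = (n - 2) (n - 1)`. -/
noncomputable def barenblatt (n : ℕ) (l : ℝ) (x : EuclideanSpace ℝ (Fin n)) : ℝ :=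
  (((n : ℝ) - 2) * ((n : ℝ) - 1) / (l ^ 2 + ‖x‖ ^ 2)) ^ (1 / (1 - yamabeM n))

/-- The functions `(C l / (l² + |x|²)) ^ (2 / (1 - m))`, `C = √(4 n (n - 1))`, whose metrics are
those of round spheres. -/
noncomputable def sphereSolution (n : ℕ) (l : ℝ) (x : EuclideanSpace ℝ (Fin n)) : ℝ :=
  (Real.sqrt (4 * (n : ℝ) * ((n : ℝ) - 1)) * l / (l ^ 2 + ‖x‖ ^ 2)) ^ (2 / (1 - yamabeM n))

/-! Write `u = W(|x|²) ^ p` with `p = 1 / m = (n + 2) / (n - 2)` and `t = |x|²`. The diffusion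
becomes linear, and (E) turns into the singular ODE `4tW'' + 2nW' + c(2βp t W^(p-1) W' + γW^p) = 0`,
`c = m / (n - 1)`. One integration against the weight `t^(n/2)` removes the singularity: `W' =
-(c/2)(βg + (γ - nβ)Ag)` with `g = W^p` and `Ag` a weighted average of `g` along the ray
(`profileRhs`). This is a Volterra equation with the single datum `W(0)`. It gives uniqueness by a
Gronwall argument (`IsRadialSolution.unique`), smoothness at the origin by bootstrapping, and
solvability once the power is truncated.

Global positivity rests on a Pohozaev energy `e` (`radialEnergy`). Since `p + 1 = 2n / (n - 2)` is
the critical exponent, `2te' + ne` is `-β` times a nonnegative square term, and `e(0)` has the sign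
of `-β`. For `β > 0` the energy stays negative, whereas at a zero of `W` it would be `2tW'² ≥ 0`; so
`W` never vanishes. Blow-up is excluded because `W` decreases when `γ > 0` and `2βp tW' + γW ≤ 0`
when `γ < 0`. The truncation is then inactive and every value at the origin is attained
(`exists_global_profile`). When `γ = 0`, the constants exhaust the solutions by uniqueness.

Nonexistence has two cases. If `β ≤ 0` and `γ < 0`, then `W` is a subsolution-type function and lies
above an explicit barrier blowing up in finite time (Keller–Osserman). If `β < 0 < γ`, then `E =
t^(n/2) e` is positive and increasing while `W` decays at the scale-invariant rate, so `E` is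
bounded; a virial identity then forces a bounded combination to decrease like `-log t`, which is
absurd (`IsProfileOn.not_global_of_neg_of_pos`).

The decay rates are statements about the scale-invariant quantity `V = tW^(p-1)`. For shrinkers,
completing the square in the energy bounds `V` from above and below. For steady solitons, the
logarithmic derivative of `V` times `V` is trapped between two positive constants, so `V` grows like
`log t`. The Barenblatt and sphere families are powers of rational functions of `t`, checked
directly. -/

/-! ### Weighted averages along rays -/

/-- The weighted average `∫₀¹ σ ^ j g(σ² t) dσ` of a function along a ray. -/
noncomputable def radialAvg (j : ℕ) (g : ℝ → ℝ) (t : ℝ) : ℝ :=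
  ∫ σ in (0 : ℝ)..1, σ ^ j * g (σ ^ 2 * t)

lemma radialAvg_continuous (j : ℕ) {g : ℝ → ℝ} (hg : Continuous g) :
    Continuous (radialAvg j g) := by
  unfold radialAvg
  apply intervalIntegral.continuous_parametric_intervalIntegral_of_continuous'
  fun_prop

lemma radialAvg_congr (j : ℕ) {g₁ g₂ : ℝ → ℝ} {t : ℝ}
    (h : ∀ σ ∈ Set.Icc (0 : ℝ) 1, g₁ (σ ^ 2 * t) = g₂ (σ ^ 2 * t)) :
    radialAvg j g₁ t = radialAvg j g₂ t := by
  unfold radialAvg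
  apply intervalIntegral.integral_congr
  intro σ hσ
  rw [Set.uIcc_of_le zero_le_one] at hσ
  simp only [h σ hσ]

lemma radialAvg_zero (j : ℕ) (g : ℝ → ℝ) : radialAvg j g 0 = g 0 / (j + 1) := by
  unfold radialAvg
  simp [integral_pow]
  ring

lemma abs_radialAvg_le (j : ℕ) {g : ℝ → ℝ} {t B : ℝ}
    (h : ∀ σ ∈ Set.Icc (0 : ℝ) 1, |g (σ ^ 2 * t)| ≤ B) : |radialAvg j g t| ≤ B := by
  unfold radialAvg
  have := intervalIntegral.norm_integral_le_of_norm_le_const (a := (0 : ℝ)) (b := 1) (C := B)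
    (f := fun σ => σ ^ j * g (σ ^ 2 * t)) (by
      intro σ hσ
      rw [Set.uIoc_of_le zero_le_one] at hσ
      have h1 := h σ ⟨hσ.1.le, hσ.2⟩
      rw [norm_mul, Real.norm_eq_abs, Real.norm_eq_abs, abs_of_nonneg (pow_nonneg hσ.1.le j)]
      have h2 : σ ^ j ≤ 1 := pow_le_one₀ hσ.1.le hσ.2
      nlinarith [abs_nonneg (g (σ ^ 2 * t)), pow_nonneg hσ.1.le j])
  simpa using this

lemma radialAvg_sub (j : ℕ) {g₁ g₂ : ℝ → ℝ} (h₁ : Continuous g₁) (h₂ : Continuous g₂) (t : ℝ) :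
    radialAvg j g₁ t - radialAvg j g₂ t = radialAvg j (fun s => g₁ s - g₂ s) t := by
  unfold radialAvg
  rw [← intervalIntegral.integral_sub]
  · congr 1; ext σ; ring
  · exact Continuous.intervalIntegrable (by fun_prop) _ _
  · exact Continuous.intervalIntegrable (by fun_prop) _ _

/-- The substitution `x = √t σ` moves `t` from the integrand to the upper limit, so continuity of
`g` suffices away from the origin. -/
lemma radialAvg_hasDerivAt_of_pos (j : ℕ) {g : ℝ → ℝ} (hg : Continuous g) {t : ℝ} (ht : 0 < t) :
    HasDerivAt (radialAvg j g) ((g t - (j + 1) * radialAvg j g t) / (2 * t)) t := by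
  have key : ∀ s : ℝ, 0 < s → radialAvg j g s =
      (∫ x in (0 : ℝ)..√s, x ^ j * g (x ^ 2)) / √s ^ (j + 1) := by
    intro s hs
    have hs' : 0 < √s := Real.sqrt_pos.mpr hs
    have := intervalIntegral.integral_comp_mul_left (a := 0) (b := 1)
      (fun x => x ^ j * g (x ^ 2)) hs'.ne'
    simp only [mul_zero, mul_one, smul_eq_mul] at this
    have h2 : ∀ σ : ℝ, (√s * σ) ^ j * g ((√s * σ) ^ 2) = √s ^ j * (σ ^ j * g (σ ^ 2 * s)) := by
      intro σ
      rw [mul_pow, mul_pow, Real.sq_sqrt hs.le, mul_comm s]; ring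
    simp only [h2, intervalIntegral.integral_const_mul] at this
    unfold radialAvg
    field_simp
    field_simp at this
    rw [pow_succ]
    linarith
  have hs' : 0 < √t := Real.sqrt_pos.mpr ht
  have hcont : Continuous (fun x : ℝ => x ^ j * g (x ^ 2)) := by fun_prop
  have h1 : HasDerivAt (fun s => ∫ x in (0 : ℝ)..√s, x ^ j * g (x ^ 2))
      ((√t ^ j * g (√t ^ 2)) * (1 / (2 * √t))) t :=
    (hcont.integral_hasStrictDerivAt 0 √t).hasDerivAt.comp t (Real.hasDerivAt_sqrt ht.ne')
  have h2 : HasDerivAt (fun s => √s ^ (j + 1)) (((j + 1 : ℕ) : ℝ) * √t ^ j * (1 / (2 * √t))) t := by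
    simpa using (Real.hasDerivAt_sqrt ht.ne').fun_pow (j + 1)
  have h3 := h1.div h2 (by positivity)
  have h4 : HasDerivAt (radialAvg j g) _ t := h3.congr_of_eventuallyEq (by
    filter_upwards [lt_mem_nhds ht] with s hs using key s hs)
  convert h4 using 1
  rw [key t ht]
  have e : √t ^ 2 = t := Real.sq_sqrt ht.le
  rw [e]
  push_cast
  field_simp
  generalize (∫ x in (0 : ℝ)..√t, x ^ j * g (x ^ 2)) = I
  linear_combination ((g t * √t ^ (j + 1) - (j + 1) * I) * √t ^ j) * e

/-! ### First-order differential inequalities -/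

/-- If `2 t F' + N F ≤ 0` then `t ^ (N / 2) F` is nonincreasing. -/
lemma antitoneOn_rpow_mul {N T : ℝ} {F F' : ℝ → ℝ}
    (hF : ∀ t ∈ Set.Ioo 0 T, HasDerivAt F (F' t) t)
    (hle : ∀ t ∈ Set.Ioo 0 T, 2 * t * F' t + N * F t ≤ 0) :
    AntitoneOn (fun t => t ^ (N / 2) * F t) (Set.Ioo 0 T) := by
  have hd : ∀ t ∈ Set.Ioo 0 T, HasDerivAt (fun t => t ^ (N / 2) * F t)
      (N / 2 * t ^ (N / 2 - 1) * F t + t ^ (N / 2) * F' t) t := fun t ht =>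
    ((Real.hasDerivAt_rpow_const (Or.inl ht.1.ne')).mul (hF t ht))
  apply antitoneOn_of_hasDerivWithinAt_nonpos (convex_Ioo 0 T)
    (f' := fun t => N / 2 * t ^ (N / 2 - 1) * F t + t ^ (N / 2) * F' t)
  · exact fun t ht => (hd t ht).continuousAt.continuousWithinAt
  · intro t ht
    rw [interior_Ioo] at ht
    exact (hd t ht).hasDerivWithinAt
  · intro t ht
    rw [interior_Ioo] at ht
    have h0 : 0 < t := ht.1
    have : t ^ (N / 2) = t ^ (N / 2 - 1) * t := by
      rw [← Real.rpow_add_one h0.ne']; congr 1; ring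
    rw [this]
    have h1 := hle t ht
    have h2 : 0 < t ^ (N / 2 - 1) := Real.rpow_pos_of_pos h0 _
    nlinarith

/-- If `2 t F' + N F ≤ 0` and `t ^ (N / 2) F → 0` at the origin then `F ≤ 0`. -/
lemma nonpos_of_two_mul_deriv_add_le {N T : ℝ} {F F' : ℝ → ℝ}
    (hF : ∀ t ∈ Set.Ioo 0 T, HasDerivAt F (F' t) t)
    (hle : ∀ t ∈ Set.Ioo 0 T, 2 * t * F' t + N * F t ≤ 0)
    (h0 : Filter.Tendsto (fun t => t ^ (N / 2) * F t) (nhdsWithin 0 (Set.Ioi 0)) (nhds 0))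
    {t : ℝ} (ht : t ∈ Set.Ioo 0 T) : F t ≤ 0 := by
  have hanti := antitoneOn_rpow_mul hF hle
  have h1 : t ^ (N / 2) * F t ≤ 0 := by
    apply ge_of_tendsto h0
    filter_upwards [Ioo_mem_nhdsGT ht.1] with s hs
    exact hanti ⟨hs.1, hs.2.trans ht.2⟩ ht hs.2.le
  have h2 : 0 < t ^ (N / 2) := Real.rpow_pos_of_pos ht.1 _
  by_contra h
  push Not at h
  nlinarith

lemma tendsto_rpow_mul_zero {N : ℝ} (hN : 0 < N) {F : ℝ → ℝ} (hF : ContinuousAt F 0) :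
    Filter.Tendsto (fun t => t ^ (N / 2) * F t) (nhdsWithin 0 (Set.Ioi 0)) (nhds 0) := by
  have h1 : ContinuousAt (fun t : ℝ => t ^ (N / 2) * F t) 0 :=
    (Real.continuousAt_rpow_const _ _ (Or.inr (by positivity))).mul hF
  have h2 := h1.tendsto.mono_left (nhdsWithin_le_nhds (s := Set.Ioi 0))
  rwa [Real.zero_rpow (by positivity), zero_mul] at h2

/-- If `2 t F' + N F ≤ 0` and `F 0 < 0` then `F` stays negative. -/
lemma neg_of_two_mul_deriv_add_le {N T : ℝ} {F F' : ℝ → ℝ}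
    (hF : ∀ t ∈ Set.Ioo 0 T, HasDerivAt F (F' t) t)
    (hle : ∀ t ∈ Set.Ioo 0 T, 2 * t * F' t + N * F t ≤ 0)
    (hc : ContinuousAt F 0) (h0 : F 0 < 0) {t : ℝ} (ht : t ∈ Set.Ioo 0 T) :
    F t < 0 := by
  have hanti := antitoneOn_rpow_mul hF hle
  have hev : ∀ᶠ s in nhdsWithin (0 : ℝ) (Set.Ioi 0), F s < 0 :=
    (hc.eventually (gt_mem_nhds h0)).filter_mono nhdsWithin_le_nhds
  obtain ⟨s, hs, hs'⟩ := (hev.and (Ioo_mem_nhdsGT ht.1)).exists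
  have h1 := hanti ⟨hs'.1, hs'.2.trans ht.2⟩ ht hs'.2.le
  simp only at h1
  have h2 : 0 < t ^ (N / 2) := Real.rpow_pos_of_pos ht.1 _
  have h3 : 0 < s ^ (N / 2) := Real.rpow_pos_of_pos hs'.1 _
  by_contra h
  push Not at h
  nlinarith [mul_nonneg h2.le h, mul_pos_of_neg_of_neg hs (neg_neg_of_pos h3)]

/-- A function which is negative at `a` and has a negative derivative at each of its zeros is
nonpositive to the right of `a`. -/
lemma nonpos_of_deriv_neg_of_eq_zero {a T : ℝ} {F F' : ℝ → ℝ} (hc : ContinuousAt F a)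
    (h0 : F a < 0) (hF : ∀ t ∈ Set.Ioo a T, HasDerivAt F (F' t) t)
    (hz : ∀ t ∈ Set.Ioo a T, F t = 0 → F' t < 0) {t : ℝ} (ht : t ∈ Set.Ioo a T) : F t ≤ 0 := by
  have hev : ∀ᶠ s in nhdsWithin a (Set.Ioi a), F s < 0 :=
    (hc.eventually (gt_mem_nhds h0)).filter_mono nhdsWithin_le_nhds
  -- No derivative is assumed at `a` itself, so the barrier argument starts at a nearby `s` where
  -- `F` is still negative.
  obtain ⟨s, hs, hs'⟩ := (hev.and (Ioo_mem_nhdsGT ht.1)).exists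
  have hsub : ∀ x ∈ Set.Icc s t, x ∈ Set.Ioo a T := fun x hx =>
    ⟨hs'.1.trans_le hx.1, hx.2.trans_lt ht.2⟩
  refine image_le_of_deriv_right_lt_deriv_boundary (f := F) (f' := F') (a := s) (b := t)
    (B := fun _ => 0) (B' := fun _ => 0)
    (fun x hx => (hF x (hsub x hx)).continuousAt.continuousWithinAt)
    (fun x hx => (hF x (hsub x ⟨hx.1, hx.2.le⟩)).hasDerivWithinAt) hs.le
    (fun x => hasDerivAt_const x 0) (fun x hx hx0 => hz x (hsub x ⟨hx.1, hx.2.le⟩) hx0)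
    ⟨hs'.2.le, le_rfl⟩

/-! ### Reduction of the equation to radial profiles -/

lemma hasFDerivAt_comp_norm_sq {E : Type*} [NormedAddCommGroup E] [InnerProductSpace ℝ E]
    {W : ℝ → ℝ} {w : ℝ} {x : E} (h : HasDerivAt W w (‖x‖ ^ 2)) :
    HasFDerivAt (fun y : E => W (‖y‖ ^ 2)) ((2 * w) • innerSL ℝ x) x := by
  have h1 := h.comp_hasFDerivAt x (hasStrictFDerivAt_norm_sq x).hasFDerivAt
  refine h1.congr_fderiv ?_
  ext v
  simp
  ring

/-- The gradient is `2 W₁(|y|²) y`; the trace of its derivative has a factor `n` from the identity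
and `|x|²` from the radial direction. The hypotheses are local because the profile of a given
solution is a priori smooth only for `t > 0`. -/
lemma laplacian_comp_norm_sq {n : ℕ} {W W₁ : ℝ → ℝ} {w₂ : ℝ} {x : EuclideanSpace ℝ (Fin n)}
    (h₁ : ∀ᶠ s in nhds (‖x‖ ^ 2), HasDerivAt W (W₁ s) s)
    (h₂ : HasDerivAt W₁ w₂ (‖x‖ ^ 2)) :
    (Δ (fun y : EuclideanSpace ℝ (Fin n) => W (‖y‖ ^ 2))) x
      = 4 * ‖x‖ ^ 2 * w₂ + 2 * n * W₁ (‖x‖ ^ 2) := by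
  set f := fun y : EuclideanSpace ℝ (Fin n) => W (‖y‖ ^ 2) with hf
  have hcont : ContinuousAt (fun y : EuclideanSpace ℝ (Fin n) => ‖y‖ ^ 2) x := by fun_prop
  have hfd : fderiv ℝ f =ᶠ[nhds x]
      fun y => (2 * W₁ (‖y‖ ^ 2)) • innerSL ℝ y := by
    filter_upwards [hcont.eventually h₁] with y hy
    exact (hasFDerivAt_comp_norm_sq hy).fderiv
  have hs : HasFDerivAt (fun y : EuclideanSpace ℝ (Fin n) => 2 * W₁ (‖y‖ ^ 2))
      ((2 : ℝ) • ((2 * w₂) • innerSL ℝ x)) x := (hasFDerivAt_comp_norm_sq h₂).const_mul 2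
  have hl : HasFDerivAt (fun y : EuclideanSpace ℝ (Fin n) => innerSL ℝ y) (innerSL ℝ) x :=
    (innerSL ℝ (E := EuclideanSpace ℝ (Fin n))).hasFDerivAt
  have h2 := (hs.smul hl).congr_of_eventuallyEq hfd
  rw [InnerProductSpace.laplacian_eq_iteratedFDeriv_orthonormalBasis f
    (EuclideanSpace.basisFun (Fin n) ℝ)]
  simp only [iteratedFDeriv_two_apply]
  rw [h2.fderiv]
  simp only [add_apply, smul_apply,
    ContinuousLinearMap.smulRight_apply, Matrix.cons_val_zero, Matrix.cons_val_one,
    innerSL_apply_apply, smul_eq_mul, Finset.sum_add_distrib]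
  have e1 : ∀ i, inner ℝ (EuclideanSpace.basisFun (Fin n) ℝ i) (EuclideanSpace.basisFun (Fin n) ℝ i)
      = (1 : ℝ) := fun i => by simp
  have e2 : ∑ i, inner ℝ x (EuclideanSpace.basisFun (Fin n) ℝ i)
      * inner ℝ x (EuclideanSpace.basisFun (Fin n) ℝ i) = ‖x‖ ^ 2 := by
    rw [EuclideanSpace.norm_sq_eq]
    simp [sq, EuclideanSpace.inner_single_right]
  refine (congrArg₂ (· + ·) (Finset.sum_congr rfl fun i _ => congrArg _ (e1 i)) rfl).trans ?_
  rw [← e2, Finset.mul_sum, Finset.sum_mul]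
  simp only [Finset.sum_const, Finset.card_univ, Fintype.card_fin, nsmul_eq_mul, mul_one]
  rw [add_comm]
  congr 1
  · apply Finset.sum_congr rfl; intro i _; ring
  · ring

/-- The exponent `p = 1 / m = (n + 2) / (n - 2)`. -/
noncomputable def yamabeP (n : ℕ) : ℝ := ((n : ℝ) + 2) / ((n : ℝ) - 2)

/-- The coefficient `c = m / (n - 1)`. -/
noncomputable def yamabeC (n : ℕ) : ℝ := yamabeM n / ((n : ℝ) - 1)

lemma three_le_cast {n : ℕ} (hn : 3 ≤ n) : (3 : ℝ) ≤ n := by exact_mod_cast hn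

lemma yamabeM_pos {n : ℕ} (hn : 3 ≤ n) : 0 < yamabeM n := by
  have := three_le_cast hn
  unfold yamabeM
  apply div_pos <;> linarith

lemma yamabeM_mul_yamabeP {n : ℕ} (hn : 3 ≤ n) : yamabeM n * yamabeP n = 1 := by
  have := three_le_cast hn
  have h1 : (n : ℝ) - 2 ≠ 0 := by linarith
  unfold yamabeM yamabeP
  field_simp

lemma one_lt_yamabeP {n : ℕ} (hn : 3 ≤ n) : 1 < yamabeP n := by
  have := three_le_cast hn
  unfold yamabeP
  rw [lt_div_iff₀ (by linarith)]
  linarith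

lemma yamabeP_mul {n : ℕ} (hn : 3 ≤ n) : yamabeP n * (n - 2) = n + 2 := by
  have := three_le_cast hn
  have h1 : (n : ℝ) - 2 ≠ 0 := by linarith
  unfold yamabeP
  field_simp

lemma yamabeC_pos {n : ℕ} (hn : 3 ≤ n) : 0 < yamabeC n := by
  have := three_le_cast hn
  exact div_pos (yamabeM_pos hn) (by linarith)

lemma one_sub_yamabeM {n : ℕ} (hn : 3 ≤ n) : 1 - yamabeM n = 4 / (n + 2) := by
  have := three_le_cast hn
  unfold yamabeM
  field_simp
  ring

lemma yamabeGamma_eq {n : ℕ} (hn : 3 ≤ n) (β ρ : ℝ) :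
    yamabeGamma n β ρ = (2 * β + ρ) * (n + 2) / 4 := by
  have := three_le_cast hn
  unfold yamabeGamma
  rw [one_sub_yamabeM hn]
  field_simp

lemma inv_one_sub_yamabeM_mul {n : ℕ} (hn : 3 ≤ n) :
    (yamabeP n - 1) * (1 / (1 - yamabeM n)) = yamabeP n := by
  have := three_le_cast hn
  have h1 : (n : ℝ) - 2 ≠ 0 := by linarith
  rw [one_sub_yamabeM hn]
  unfold yamabeP
  field_simp
  ring

lemma rpow_yamabeP_rpow_yamabeM {n : ℕ} (hn : 3 ≤ n) {a : ℝ} (ha : 0 < a) :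
    (a ^ yamabeP n) ^ yamabeM n = a := by
  rw [← Real.rpow_mul ha.le, mul_comm, yamabeM_mul_yamabeP hn, Real.rpow_one]

lemma rpow_yamabeM_rpow_yamabeP {n : ℕ} (hn : 3 ≤ n) {a : ℝ} (ha : 0 < a) :
    (a ^ yamabeM n) ^ yamabeP n = a := by
  rw [← Real.rpow_mul ha.le, yamabeM_mul_yamabeP hn, Real.rpow_one]

/-- The left-hand side of the equation for `u = W(|x|²) ^ p`, in terms of `W`. -/
lemma radial_equation {n : ℕ} (hn : 3 ≤ n) {β γ : ℝ} {W W₁ : ℝ → ℝ} {w₂ : ℝ}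
    {x : EuclideanSpace ℝ (Fin n)} (hpos : ∀ t, 0 ≤ t → 0 < W t)
    (h₁ : ∀ᶠ s in nhds (‖x‖ ^ 2), HasDerivAt W (W₁ s) s)
    (h₂ : HasDerivAt W₁ w₂ (‖x‖ ^ 2)) :
    ((n : ℝ) - 1) / yamabeM n *
        (Δ (fun y : EuclideanSpace ℝ (Fin n) => (W (‖y‖ ^ 2) ^ yamabeP n) ^ yamabeM n)) x
      + β * inner ℝ x (∇ (fun y : EuclideanSpace ℝ (Fin n) => W (‖y‖ ^ 2) ^ yamabeP n) x)
      + γ * W (‖x‖ ^ 2) ^ yamabeP n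
    = ((n : ℝ) - 1) / yamabeM n * (4 * ‖x‖ ^ 2 * w₂ + 2 * n * W₁ (‖x‖ ^ 2)
      + yamabeC n * (2 * β * yamabeP n * ‖x‖ ^ 2 * W (‖x‖ ^ 2) ^ (yamabeP n - 1) * W₁ (‖x‖ ^ 2)
        + γ * W (‖x‖ ^ 2) ^ yamabeP n)) := by
  have h3 := three_le_cast hn
  have e1 : (fun y : EuclideanSpace ℝ (Fin n) => (W (‖y‖ ^ 2) ^ yamabeP n) ^ yamabeM n)
      = fun y => W (‖y‖ ^ 2) := by
    ext y
    exact rpow_yamabeP_rpow_yamabeM hn (hpos _ (by positivity))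
  rw [e1, laplacian_comp_norm_sq h₁ h₂]
  have hW := hpos (‖x‖ ^ 2) (by positivity)
  have hd : HasDerivAt (fun s => W s ^ yamabeP n)
      (W₁ (‖x‖ ^ 2) * yamabeP n * W (‖x‖ ^ 2) ^ (yamabeP n - 1)) (‖x‖ ^ 2) :=
    h₁.self_of_nhds.rpow_const (Or.inl hW.ne')
  have hg := (hasFDerivAt_comp_norm_sq hd).fderiv
  have e2 : inner ℝ x (∇ (fun y : EuclideanSpace ℝ (Fin n) => W (‖y‖ ^ 2) ^ yamabeP n) x)
      = 2 * (W₁ (‖x‖ ^ 2) * yamabeP n * W (‖x‖ ^ 2) ^ (yamabeP n - 1)) * ‖x‖ ^ 2 := by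
    rw [real_inner_comm]
    unfold gradient
    rw [InnerProductSpace.toDual_symm_apply, hg]
    simp
  rw [e2]
  have hm := yamabeM_pos hn
  have h1 : (n : ℝ) - 1 ≠ 0 := by linarith
  unfold yamabeC
  field_simp
  ring

/-! ### Global solvability and Gronwall for Volterra equations -/

/-- Negative `t` is covered by reflection: smoothness of `W(|x|²)` at `x = 0` will require `W` on
both sides of `t = 0`. -/
lemma abs_integral_le_sub {h k K : ℝ → ℝ} (hh : Continuous h) (hk : Continuous k)
    (hK : ∀ t, HasDerivAt K (k t) t) (hle : ∀ s, |h s| ≤ k |s|) (t : ℝ) :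
    |∫ s in (0 : ℝ)..t, h s| ≤ K |t| - K 0 := by
  have main : ∀ (f : ℝ → ℝ), Continuous f → (∀ s, |f s| ≤ k |s|) → ∀ t : ℝ, 0 ≤ t →
      |∫ s in (0 : ℝ)..t, f s| ≤ K t - K 0 := by
    intro f hf hfk t ht
    rw [← intervalIntegral.integral_eq_sub_of_hasDerivAt (fun x _ => hK x)
      (hk.intervalIntegrable _ _)]
    refine (intervalIntegral.abs_integral_le_integral_abs ht).trans ?_
    apply intervalIntegral.integral_mono_on ht (hf.abs.intervalIntegrable _ _)
      (hk.intervalIntegrable _ _)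
    intro x hx
    simpa [abs_of_nonneg hx.1] using hfk x
  rcases le_total 0 t with ht | ht
  · rw [abs_of_nonneg ht]; exact main h hh hle t ht
  · rw [abs_of_nonpos ht]
    have h1 := main (fun s => h (-s)) (by fun_prop) (fun s => by simpa using hle (-s)) (-t)
      (by linarith)
    rw [intervalIntegral.integral_comp_neg] at h1
    simp only [neg_neg, neg_zero] at h1
    rwa [intervalIntegral.integral_symm, abs_neg]

/-- Global solvability of `W(t) = w₀ + ∫₀ᵗ G(W)` for a bounded Lipschitz operator `G` such that
`G(W)(s)` depends only on the values of `W` between `0` and `s`. -/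
lemma exists_eq_add_integral (G : (ℝ → ℝ) → ℝ → ℝ) {Λ ℓ : ℝ → ℝ}
    (hΛ : ∀ t, HasDerivAt Λ (ℓ t) t) (hℓ : Continuous ℓ) (hℓ0 : ∀ t, 0 ≤ ℓ t) (hΛ0 : Λ 0 = 0)
    (hGc : ∀ W, Continuous W → Continuous (G W))
    (hGb : ∀ W, Continuous W → ∀ s, |G W s| ≤ ℓ |s|)
    (hGL : ∀ W₁ W₂, Continuous W₁ → Continuous W₂ → ∀ s B,
      (∀ σ ∈ Set.Icc (0 : ℝ) 1, |W₁ (σ ^ 2 * s) - W₂ (σ ^ 2 * s)| ≤ B) →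
        |G W₁ s - G W₂ s| ≤ ℓ |s| * B) (w₀ : ℝ) :
    ∃ W : ℝ → ℝ, Continuous W ∧ ∀ t, W t = w₀ + ∫ s in (0 : ℝ)..t, G W s := by
  have hΛc : Continuous Λ := continuous_iff_continuousAt.mpr fun t => (hΛ t).continuousAt
  have hΛm : Monotone Λ := monotone_of_hasDerivAt_nonneg hΛ hℓ0
  have hΛp : ∀ t, 0 ≤ Λ |t| := fun t => hΛ0 ▸ hΛm (abs_nonneg t)
  -- A Bielecki weight: solutions are sought as `wt * V` with `V` bounded. As `∫ ℓ exp (2Λ) ≤ exp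
  -- (2Λ) / 2`, the integral operator contracts by `1 / 2` on the whole line at once.
  set wt : ℝ → ℝ := fun t => Real.exp (2 * Λ |t|)
  have hωc : Continuous wt := by fun_prop
  have hω0 : ∀ t, 0 < wt t := fun t => Real.exp_pos _
  have hω1 : ∀ t, 1 + 2 * Λ |t| ≤ wt t := fun t => by
    have := Real.add_one_le_exp (2 * Λ |t|); simp only [wt]; linarith
  let lift : BoundedContinuousFunction ℝ ℝ → ℝ → ℝ := fun V t => wt t * V t
  have hlift : ∀ V, Continuous (lift V) := fun V => hωc.mul V.continuous
  have hint : ∀ W, Continuous W → Continuous (fun t => ∫ s in (0 : ℝ)..t, G W s) := fun W hW =>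
    intervalIntegral.continuous_primitive (fun a b => (hGc W hW).intervalIntegrable a b) 0
  have hbd : ∀ W, Continuous W → ∀ t, |∫ s in (0 : ℝ)..t, G W s| ≤ Λ |t| := fun W hW t => by
    simpa [hΛ0] using abs_integral_le_sub (hGc W hW) hℓ hΛ (hGb W hW) t
  let Φ : BoundedContinuousFunction ℝ ℝ → BoundedContinuousFunction ℝ ℝ := fun V =>
    BoundedContinuousFunction.ofNormedAddCommGroup
      (fun t => (w₀ + ∫ s in (0 : ℝ)..t, G (lift V) s) / wt t)
      (((continuous_const.add (hint _ (hlift V))).div hωc fun t => (hω0 t).ne')) (|w₀| + 1) (by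
        intro t
        rw [Real.norm_eq_abs, abs_div, abs_of_pos (hω0 t), div_le_iff₀ (hω0 t)]
        have h1 := hbd _ (hlift V) t
        have h2 := hω1 t
        have h3 := abs_add_le w₀ (∫ s in (0 : ℝ)..t, G (lift V) s)
        nlinarith [hΛp t, abs_nonneg w₀, mul_nonneg (abs_nonneg w₀) (hΛp t),
          mul_le_mul_of_nonneg_left h2 (abs_nonneg w₀)])
  have hΦ : ContractingWith (1 / 2) Φ := by
    refine ⟨by rw [← NNReal.coe_lt_coe]; norm_num, LipschitzWith.of_dist_le_mul fun V₁ V₂ => ?_⟩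
    rw [BoundedContinuousFunction.dist_le (by positivity)]
    intro t
    set d := dist V₁ V₂
    have hd : 0 ≤ d := dist_nonneg
    have hexp : ∀ s, HasDerivAt (fun s => 1 / 2 * Real.exp (2 * Λ s) * d)
        (ℓ s * (Real.exp (2 * Λ s) * d)) s := by
      intro s
      have := ((((hΛ s).const_mul 2).exp).const_mul (1 / 2)).mul_const d
      refine this.congr_deriv ?_
      ring
    have h1 := abs_integral_le_sub (h := fun s => G (lift V₁) s - G (lift V₂) s)
      ((hGc _ (hlift V₁)).sub (hGc _ (hlift V₂))) (by fun_prop) hexp (by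
        intro s
        refine (hGL _ _ (hlift V₁) (hlift V₂) s (Real.exp (2 * Λ |s|) * d) ?_)
        intro σ hσ
        have h2 : lift V₁ (σ ^ 2 * s) - lift V₂ (σ ^ 2 * s)
          = wt (σ ^ 2 * s) * (V₁ (σ ^ 2 * s) - V₂ (σ ^ 2 * s)) := by simp only [lift]; ring
        rw [h2, abs_mul, abs_of_pos (hω0 _)]
        refine mul_le_mul (Real.exp_le_exp.mpr ?_) ?_ (abs_nonneg _) (Real.exp_pos _).le
        · have : |σ ^ 2 * s| ≤ |s| := by
            rw [abs_mul, abs_of_nonneg (sq_nonneg σ)]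
            have : σ ^ 2 ≤ 1 := pow_le_one₀ hσ.1 hσ.2
            nlinarith [abs_nonneg s]
          linarith [hΛm this]
        · exact BoundedContinuousFunction.dist_coe_le_dist (f := V₁) (g := V₂) _) t
    rw [intervalIntegral.integral_sub ((hGc _ (hlift V₁)).intervalIntegrable _ _)
      ((hGc _ (hlift V₂)).intervalIntegrable _ _)] at h1
    simp only [hΛ0, mul_zero, Real.exp_zero] at h1
    have h3 : dist (Φ V₁ t) (Φ V₂ t) = |(∫ s in (0 : ℝ)..t, G (lift V₁) s)
        - ∫ s in (0 : ℝ)..t, G (lift V₂) s| / wt t := by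
      simp only [Φ, BoundedContinuousFunction.coe_ofNormedAddCommGroup, Real.dist_eq]
      rw [← sub_div, abs_div, abs_of_pos (hω0 t)]
      congr 2; ring
    rw [h3, div_le_iff₀ (hω0 t)]
    refine h1.trans ?_
    simp only [wt]
    push_cast
    nlinarith
  let V := hΦ.fixedPoint Φ
  have hV : Φ V = V := hΦ.fixedPoint_isFixedPt
  refine ⟨lift V, hlift V, fun t => ?_⟩
  have h1 : (w₀ + ∫ s in (0 : ℝ)..t, G (lift V) s) / wt t = V t := by
    conv_rhs => rw [← hV]
    rfl
  rw [div_eq_iff (hω0 t).ne'] at h1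
  rw [h1, mul_comm]

/-- A Gronwall type lemma for a nonlocal differential inequality. -/
lemma eq_zero_of_abs_deriv_le {D D' : ℝ → ℝ} {T L : ℝ} (hL : 0 < L) (hT : 0 ≤ T)
    (hc : ContinuousOn D (Set.Icc 0 T)) (h0 : D 0 = 0)
    (hd : ∀ t ∈ Set.Ioo 0 T, HasDerivAt D (D' t) t)
    (hle : ∀ t ∈ Set.Ioo 0 T, ∀ B, (∀ τ ∈ Set.Icc 0 t, |D τ| ≤ B) → |D' t| ≤ L * B) :
    ∀ t ∈ Set.Icc 0 T, D t = 0 := by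
  -- If `m` is the maximum of `exp (-2Lt) |D t|`, then `|D'| ≤ L m exp (2Lt)`, and integrating up to
  -- the maximum point gives `m ≤ m / 2`.
  obtain ⟨t₀, ht₀, hmax⟩ := isCompact_Icc.exists_isMaxOn (Set.nonempty_Icc.mpr hT)
    (f := fun t => Real.exp (-(2 * L * t)) * |D t|) (by fun_prop)
  set m := Real.exp (-(2 * L * t₀)) * |D t₀| with hm
  have hm0 : 0 ≤ m := by positivity
  have hDle : ∀ t ∈ Set.Icc 0 T, |D t| ≤ m * Real.exp (2 * L * t) := by
    intro t ht
    have h1 : Real.exp (-(2 * L * t)) * |D t| ≤ m := hmax ht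
    rw [Real.exp_neg, inv_mul_le_iff₀ (Real.exp_pos _)] at h1
    linarith
  have hD' : ∀ t ∈ Set.Ioo 0 T, |D' t| ≤ L * (m * Real.exp (2 * L * t)) := by
    intro t ht
    apply hle t ht
    intro τ hτ
    refine (hDle τ ⟨hτ.1, hτ.2.trans ht.2.le⟩).trans ?_
    apply mul_le_mul_of_nonneg_left _ hm0
    apply Real.exp_le_exp.mpr
    nlinarith [hτ.2]
  have hE : ∀ t, HasDerivAt (fun t => m / 2 * Real.exp (2 * L * t))
      (L * (m * Real.exp (2 * L * t))) t := by
    intro t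
    have := (((hasDerivAt_id t).const_mul (2 * L)).exp).const_mul (m / 2)
    refine this.congr_deriv ?_
    simp only [id_eq]
    ring
  have key : ∀ F F' : ℝ → ℝ, ContinuousOn F (Set.Icc 0 T) → F 0 = 0 →
      (∀ t ∈ Set.Ioo 0 T, HasDerivAt F (F' t) t) →
      (∀ t ∈ Set.Ioo 0 T, F' t ≤ L * (m * Real.exp (2 * L * t))) →
      F t₀ ≤ m / 2 * Real.exp (2 * L * t₀) := by
    intro F F' hFc hF0 hFd hFle
    have hanti : AntitoneOn (fun t => F t - m / 2 * Real.exp (2 * L * t)) (Set.Icc 0 T) := by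
      apply antitoneOn_of_hasDerivWithinAt_nonpos (convex_Icc 0 T)
        (f' := fun t => F' t - L * (m * Real.exp (2 * L * t)))
      · exact hFc.sub (by fun_prop)
      · intro t ht
        rw [interior_Icc] at ht
        exact ((hFd t ht).sub (hE t)).hasDerivWithinAt
      · intro t ht
        rw [interior_Icc] at ht
        linarith [hFle t ht]
    have := hanti (Set.left_mem_Icc.mpr hT) ht₀ ht₀.1
    simp only [hF0, mul_zero, Real.exp_zero] at this
    linarith
  have h1 := key D D' hc h0 hd fun t ht => (le_abs_self _).trans (hD' t ht)
  have h2 := key (fun t => -D t) (fun t => -D' t) hc.neg (by simp [h0])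
    (fun t ht => (hd t ht).neg) fun t ht => (neg_le_abs _).trans (hD' t ht)
  have h3 : |D t₀| ≤ m / 2 * Real.exp (2 * L * t₀) := abs_le.mpr ⟨by linarith, h1⟩
  have h4 : m ≤ m / 2 := by
    have h5 : m ≤ Real.exp (-(2 * L * t₀)) * (m / 2 * Real.exp (2 * L * t₀)) :=
      mul_le_mul_of_nonneg_left h3 (Real.exp_pos _).le
    rw [Real.exp_neg] at h5
    field_simp at h5
    linarith
  have h6 : m = 0 := by linarith
  intro t ht
  have := hDle t ht
  rw [h6, zero_mul] at this
  exact abs_nonpos_iff.mp this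

/-! ### The profile equation in first-order and second-order form -/

/-- The right-hand side of the first order integro-differential equation `W' = profileRhs (W ^ p)`
satisfied by the radial profile `W(|x|²) = u(x) ^ m` of a solution. -/
noncomputable def profileRhs (n : ℕ) (β γ : ℝ) (g : ℝ → ℝ) (t : ℝ) : ℝ :=
  -(yamabeC n / 2) * (β * g t + (γ - n * β) * radialAvg (n - 1) g t)

lemma profileRhs_continuous (n : ℕ) (β γ : ℝ) {g : ℝ → ℝ} (hg : Continuous g) :
    Continuous (profileRhs n β γ g) := by
  have := radialAvg_continuous (n - 1) hg
  unfold profileRhs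
  fun_prop

lemma cast_pred_add_one {n : ℕ} (hn : 3 ≤ n) : ((n - 1 : ℕ) : ℝ) + 1 = n := by
  rw [Nat.cast_sub (by omega)]
  simp

lemma profileRhs_zero {n : ℕ} (hn : 3 ≤ n) (β γ : ℝ) (g : ℝ → ℝ) :
    profileRhs n β γ g 0 = -(yamabeC n * γ / (2 * n)) * g 0 := by
  have := three_le_cast hn
  unfold profileRhs
  rw [radialAvg_zero, cast_pred_add_one hn]
  field_simp
  ring

/-- This undoes the integration: with `R` the right-hand side, `4tR' + 2nR = -c(2βt g' + γg)`, which
for `g = W^p`, `W' = R` is the second-order ODE. -/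
lemma profileRhs_hasDerivAt {n : ℕ} (hn : 3 ≤ n) (β γ : ℝ) {g : ℝ → ℝ} (hg : Continuous g)
    {t g' : ℝ} (ht : 0 < t) (hd : HasDerivAt g g' t) :
    HasDerivAt (profileRhs n β γ g)
      (-(2 * n * profileRhs n β γ g t + yamabeC n * (2 * β * t * g' + γ * g t)) / (4 * t)) t := by
  have h1 := radialAvg_hasDerivAt_of_pos (n - 1) hg ht
  rw [cast_pred_add_one hn] at h1
  have h2 := ((hd.const_mul β).add (h1.const_mul (γ - n * β))).const_mul (-(yamabeC n / 2))
  refine h2.congr_deriv ?_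
  unfold profileRhs
  field_simp
  ring

lemma abs_profileRhs_le {n : ℕ} (hn : 3 ≤ n) (β γ : ℝ) {g : ℝ → ℝ} {t B : ℝ}
    (h : ∀ σ ∈ Set.Icc (0 : ℝ) 1, |g (σ ^ 2 * t)| ≤ B) :
    |profileRhs n β γ g t| ≤ yamabeC n / 2 * (|β| + |γ - n * β|) * B := by
  have h1 := abs_radialAvg_le (n - 1) h
  have h2 : |g t| ≤ B := by simpa using h 1 (by simp)
  have hc := yamabeC_pos hn
  unfold profileRhs
  rw [abs_mul, abs_neg, abs_of_pos (by positivity : 0 < yamabeC n / 2), mul_assoc]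
  apply mul_le_mul_of_nonneg_left _ (by positivity)
  refine (abs_add_le _ _).trans ?_
  rw [abs_mul, abs_mul, add_mul]
  gcongr

lemma profileRhs_sub (n : ℕ) (β γ : ℝ) {g₁ g₂ : ℝ → ℝ} (h₁ : Continuous g₁) (h₂ : Continuous g₂)
    (t : ℝ) : profileRhs n β γ g₁ t - profileRhs n β γ g₂ t
      = profileRhs n β γ (fun s => g₁ s - g₂ s) t := by
  unfold profileRhs
  rw [← radialAvg_sub _ h₁ h₂]
  ring

/-- `W` is positive and solves the second order equation for radial profiles on `(0, T)`, with
derivative `W₁`. -/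
structure IsProfileOn (n : ℕ) (β γ : ℝ) (W W₁ : ℝ → ℝ) (T : ℝ) : Prop where
  cont : Continuous W
  cont_deriv : Continuous W₁
  pos : ∀ t ∈ Set.Ico 0 T, 0 < W t
  deriv : ∀ t ∈ Set.Ioo 0 T, HasDerivAt W (W₁ t) t
  second_deriv : ∀ t ∈ Set.Ioo 0 T, HasDerivAt W₁
    (-(2 * n * W₁ t + yamabeC n * W t ^ (yamabeP n - 1) *
      (2 * β * yamabeP n * t * W₁ t + γ * W t)) / (4 * t)) t
  -- The ODE degenerates at `t = 0` to `2nW₁ + cγW^p = 0`, which fixes the slope there.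
  init : W₁ 0 = -(yamabeC n * γ / (2 * n)) * W 0 ^ yamabeP n

lemma rpow_eq_rpow_sub_one_mul {a : ℝ} (ha : 0 < a) (p : ℝ) : a ^ p = a ^ (p - 1) * a := by
  rw [← Real.rpow_add_one ha.ne']; congr 1; ring

lemma rpow_add_one_eq_rpow_sub_one_mul {a : ℝ} (ha : 0 < a) (p : ℝ) :
    a ^ (p + 1) = a ^ (p - 1) * a ^ 2 := by
  rw [Real.rpow_add_one ha.ne', rpow_eq_rpow_sub_one_mul ha]; ring

/-- Keeping `g` apart from `W ^ p` lets a solution of the truncated equation count as a profile for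
as long as the truncation is inactive. -/
lemma IsProfileOn.of_profileRhs {n : ℕ} (hn : 3 ≤ n) {β γ : ℝ} {W g : ℝ → ℝ} {T : ℝ} (hT : 0 < T)
    (hW : Continuous W) (hg : Continuous g) (hpos : ∀ t ∈ Set.Ico 0 T, 0 < W t)
    (hgW : ∀ t ∈ Set.Ico 0 T, g t = W t ^ yamabeP n)
    (hd : ∀ t ∈ Set.Ioo 0 T, HasDerivAt W (profileRhs n β γ g t) t) :
    IsProfileOn n β γ W (profileRhs n β γ g) T where
  cont := hW
  cont_deriv := profileRhs_continuous n β γ hg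
  pos := hpos
  deriv := hd
  second_deriv := by
    intro t ht
    have ht' : t ∈ Set.Ico 0 T := ⟨ht.1.le, ht.2⟩
    have h1 := (hd t ht).rpow_const (p := yamabeP n) (Or.inl (hpos t ht').ne')
    have h2 : HasDerivAt g _ t := h1.congr_of_eventuallyEq (by
      filter_upwards [Ioo_mem_nhds ht.1 ht.2] with s hs using hgW s ⟨hs.1.le, hs.2⟩)
    refine (profileRhs_hasDerivAt hn β γ hg ht.1 h2).congr_deriv ?_
    rw [hgW t ht', rpow_eq_rpow_sub_one_mul (hpos t ht') (yamabeP n)]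
    ring
  init := by rw [profileRhs_zero hn, hgW 0 ⟨le_rfl, hT⟩]

/-! ### Pohozaev energy and monotonicity of profiles -/

/-- The Pohozaev energy `|x| ^ (-n) E` of a radial profile. -/
noncomputable def radialEnergy (n : ℕ) (ρ : ℝ) (W W₁ : ℝ → ℝ) (t : ℝ) : ℝ :=
  2 * t * W₁ t ^ 2 + (n - 2) * (W t * W₁ t)
    + yamabeC n * ρ * (n + 2) * (n - 2) / (8 * n) * W t ^ (yamabeP n + 1)

namespace IsProfileOn

variable {n : ℕ} {β γ ρ T : ℝ} {W W₁ : ℝ → ℝ}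

lemma radialEnergy_continuous (hn : 3 ≤ n) (h : IsProfileOn n β γ W W₁ T) :
    Continuous (radialEnergy n ρ W W₁) := by
  have h1 := h.cont
  have h2 := h.cont_deriv
  have h3 : Continuous (fun t => W t ^ (yamabeP n + 1)) :=
    h1.rpow_const fun t => Or.inr (by linarith [one_lt_yamabeP hn])
  unfold radialEnergy
  fun_prop

/-- The `ρ`-part of `γ` in the initial slope cancels the last term of the energy, so only `β`
decides the sign. -/
lemma radialEnergy_zero (hn : 3 ≤ n) (h : IsProfileOn n β γ W W₁ T) (hT : 0 < T)
    (hγ : γ = (2 * β + ρ) * (n + 2) / 4) :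
    radialEnergy n ρ W W₁ 0
      = -(β * (yamabeC n * (n + 2) * (n - 2) / (4 * n) * W 0 ^ (yamabeP n + 1))) := by
  have h3 := three_le_cast hn
  unfold radialEnergy
  rw [h.init, Real.rpow_add_one (h.pos 0 ⟨le_rfl, hT⟩).ne', hγ]
  field_simp
  ring

/-- Pohozaev identity. At the critical exponent the dilation-invariant part of the ODE conserves
`t^(n/2) e`; the coefficient of `W^(p+1)` is tuned so that the `ρ`-terms cancel and the `β`-terms
form a perfect square. -/
lemma exists_hasDerivAt_radialEnergy (hn : 3 ≤ n) (h : IsProfileOn n β γ W W₁ T)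
    (hγ : γ = (2 * β + ρ) * (n + 2) / 4) {t : ℝ} (ht : t ∈ Set.Ioo 0 T) :
    ∃ e', HasDerivAt (radialEnergy n ρ W W₁) e' t ∧
      2 * t * e' + n * radialEnergy n ρ W W₁ t
        = -(β * (yamabeC n * yamabeP n * W t ^ (yamabeP n - 1)
          * (2 * t * W₁ t + (n - 2) / 2 * W t) ^ 2)) := by
  have h3 := three_le_cast hn
  have hn2 : (n : ℝ) - 2 ≠ 0 := by linarith
  have hW := h.pos t ⟨ht.1.le, ht.2⟩
  have d0 := h.deriv t ht
  have d1 := h.second_deriv t ht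
  have dp := d0.rpow_const (p := yamabeP n + 1) (Or.inl hW.ne')
  have hd := ((((hasDerivAt_id t).const_mul 2).mul (d1.fun_pow 2)).add
    ((d0.mul d1).const_mul ((n : ℝ) - 2))).add
      (dp.const_mul (yamabeC n * ρ * (n + 2) * (n - 2) / (8 * n)))
  refine ⟨_, hd, ?_⟩
  unfold radialEnergy
  rw [rpow_add_one_eq_rpow_sub_one_mul hW, add_sub_cancel_right,
    rpow_eq_rpow_sub_one_mul hW (yamabeP n), hγ]
  generalize W t ^ (yamabeP n - 1) = S
  have ht0 : t ≠ 0 := ht.1.ne'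
  simp only [id_eq]
  unfold yamabeP
  field_simp
  ring

lemma antitoneOn_radialEnergy (hn : 3 ≤ n) (h : IsProfileOn n β γ W W₁ T) (hβ : 0 < β)
    (hγ : γ = (2 * β + ρ) * (n + 2) / 4) :
    AntitoneOn (fun t => t ^ ((n : ℝ) / 2) * radialEnergy n ρ W W₁ t) (Set.Ioo 0 T) := by
  choose! e' he1 he2 using fun t (ht : t ∈ Set.Ioo 0 T) =>
    h.exists_hasDerivAt_radialEnergy hn (ρ := ρ) hγ ht
  refine antitoneOn_rpow_mul he1 fun t ht => ?_
  rw [he2 t ht]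
  have hc := yamabeC_pos hn
  have hp := one_lt_yamabeP hn
  have hW := h.pos t ⟨ht.1.le, ht.2⟩
  have : 0 ≤ yamabeC n * yamabeP n * W t ^ (yamabeP n - 1) := by positivity
  nlinarith [mul_nonneg hβ.le (mul_nonneg this (sq_nonneg (2 * t * W₁ t + (n - 2) / 2 * W t)))]

/-- The energy starts negative at the origin and `t^(n/2) e` does not increase. This is what keeps
`W` away from zero, where the energy would be a square. -/
lemma radialEnergy_neg (hn : 3 ≤ n) (h : IsProfileOn n β γ W W₁ T) (hβ : 0 < β)
    (hγ : γ = (2 * β + ρ) * (n + 2) / 4) {t : ℝ} (ht : t ∈ Set.Ioo 0 T) :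
    radialEnergy n ρ W W₁ t < 0 := by
  have hT : 0 < T := ht.1.trans ht.2
  choose! e' he1 he2 using fun t (ht : t ∈ Set.Ioo 0 T) =>
    h.exists_hasDerivAt_radialEnergy hn (ρ := ρ) hγ ht
  have hc := yamabeC_pos hn
  have hp := one_lt_yamabeP hn
  refine neg_of_two_mul_deriv_add_le (N := n) he1 (fun t ht => ?_)
    (h.radialEnergy_continuous hn).continuousAt ?_ ht
  · rw [he2 t ht]
    have hW := h.pos t ⟨ht.1.le, ht.2⟩
    have : 0 ≤ yamabeC n * yamabeP n * W t ^ (yamabeP n - 1) := by positivity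
    nlinarith [mul_nonneg hβ.le (mul_nonneg this (sq_nonneg (2 * t * W₁ t + (n - 2) / 2 * W t)))]
  · rw [h.radialEnergy_zero hn hT hγ]
    have h3 := three_le_cast hn
    have hW := h.pos 0 ⟨le_rfl, hT⟩
    have : 0 < (n : ℝ) - 2 := by linarith
    rw [neg_lt_zero]
    positivity

/-- The energy is negative up to the end point. -/
lemma radialEnergy_end_neg (hn : 3 ≤ n) (h : IsProfileOn n β γ W W₁ T) (hT : 0 < T) (hβ : 0 < β)
    (hγ : γ = (2 * β + ρ) * (n + 2) / 4) : radialEnergy n ρ W W₁ T < 0 := by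
  have hmid : T / 2 ∈ Set.Ioo 0 T := ⟨by linarith, by linarith⟩
  have h1 := h.radialEnergy_neg hn hβ hγ hmid
  have h2 := h.antitoneOn_radialEnergy hn hβ hγ
  have hcont : ContinuousAt (fun t => t ^ ((n : ℝ) / 2) * radialEnergy n ρ W W₁ t) T :=
    (Real.continuousAt_rpow_const _ _ (Or.inl hT.ne')).mul
      (h.radialEnergy_continuous hn).continuousAt
  have h3 : T ^ ((n : ℝ) / 2) * radialEnergy n ρ W W₁ T
      ≤ (T / 2) ^ ((n : ℝ) / 2) * radialEnergy n ρ W W₁ (T / 2) := by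
    refine le_of_tendsto (hcont.tendsto.mono_left (nhdsWithin_le_nhds (s := Set.Iio T))) ?_
    filter_upwards [Ioo_mem_nhdsLT hmid.2] with s hs
    exact h2 hmid ⟨hmid.1.trans hs.1, hs.2⟩ hs.1.le
  have h4 : 0 < T ^ ((n : ℝ) / 2) := Real.rpow_pos_of_pos hT _
  have h5 : 0 < (T / 2) ^ ((n : ℝ) / 2) := Real.rpow_pos_of_pos hmid.1 _
  by_contra h6
  push Not at h6
  nlinarith [mul_nonneg h4.le h6, mul_pos h5 (neg_pos.mpr h1)]

/-- At a zero of `W₁` the ODE reads `4tW₁' = -cγW^p`, so `W₁` can cross zero only downwards, and it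
starts negative. The case `γ < 0` is the mirror image. -/
lemma deriv_nonpos (hn : 3 ≤ n) (h : IsProfileOn n β γ W W₁ T) (hγ : 0 < γ) {t : ℝ}
    (ht : t ∈ Set.Ioo 0 T) : W₁ t ≤ 0 := by
  have h3 := three_le_cast hn
  have hc := yamabeC_pos hn
  have hW0 := h.pos 0 ⟨le_rfl, ht.1.trans ht.2⟩
  refine nonpos_of_deriv_neg_of_eq_zero h.cont_deriv.continuousAt ?_ h.second_deriv
    (fun s hs hs0 => ?_) ht
  · rw [h.init, neg_mul, neg_lt_zero]
    positivity
  · rw [hs0]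
    have hW := h.pos s ⟨hs.1.le, hs.2⟩
    have h0 : 0 < s := hs.1
    rw [neg_div, neg_lt_zero]
    apply div_pos _ (by positivity)
    simp only [mul_zero, zero_add]
    positivity

lemma deriv_nonneg (hn : 3 ≤ n) (h : IsProfileOn n β γ W W₁ T) (hγ : γ < 0) {t : ℝ}
    (ht : t ∈ Set.Ioo 0 T) : 0 ≤ W₁ t := by
  have h3 := three_le_cast hn
  have hc := yamabeC_pos hn
  have hW0 := h.pos 0 ⟨le_rfl, ht.1.trans ht.2⟩
  have hγ' : 0 < -γ := by linarith
  rw [← neg_nonpos]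
  refine nonpos_of_deriv_neg_of_eq_zero (F := fun t => -W₁ t) h.cont_deriv.neg.continuousAt ?_
    (fun s hs => (h.second_deriv s hs).neg) (fun s hs hs0 => ?_) ht
  · rw [h.init, neg_mul, neg_neg]
    have : 0 < yamabeC n * (-γ) / (2 * n) * W 0 ^ yamabeP n := by positivity
    have e : yamabeC n * (-γ) / (2 * n) * W 0 ^ yamabeP n
      = -(yamabeC n * γ / (2 * n) * W 0 ^ yamabeP n) := by ring
    linarith
  · rw [neg_eq_zero] at hs0
    rw [hs0]
    have hW := h.pos s ⟨hs.1.le, hs.2⟩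
    have h0 : 0 < s := hs.1
    rw [neg_div, neg_neg]
    apply div_neg_of_neg_of_pos _ (by positivity)
    simp only [mul_zero, zero_add]
    have : 0 < yamabeC n * W s ^ (yamabeP n - 1) * (-γ * W s) := by positivity
    linarith

/-- The growth bound for expanding solutions. -/
lemma two_mul_deriv_add_nonpos (hn : 3 ≤ n) (h : IsProfileOn n β γ W W₁ T) (hβ : 0 < β)
    (hγ : γ < 0) {t : ℝ} (ht : t ∈ Set.Ioo 0 T) :
    2 * β * yamabeP n * t * W₁ t + γ * W t ≤ 0 := by
  have h3 := three_le_cast hn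
  have hc := yamabeC_pos hn
  have hp := one_lt_yamabeP hn
  have hW0 := h.pos 0 ⟨le_rfl, ht.1.trans ht.2⟩
  have h1 := h.cont
  have h2 := h.cont_deriv
  refine nonpos_of_deriv_neg_of_eq_zero
    (F := fun t => 2 * β * yamabeP n * t * W₁ t + γ * W t)
    (Continuous.continuousAt (by fun_prop)) ?_
    (fun s hs => (((hasDerivAt_id s).const_mul (2 * β * yamabeP n)).mul
      (h.second_deriv s hs)).add ((h.deriv s hs).const_mul γ)) (fun s hs hs0 => ?_) ht
  · simp only [mul_zero, zero_mul, zero_add]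
    nlinarith
  · have hW := h.pos s ⟨hs.1.le, hs.2⟩
    have h0 : 0 < s := hs.1
    simp only [hs0, id_eq, mul_zero, add_zero, mul_one]
    have hW₁ : 0 < W₁ s := by
      have h5 : 0 < 2 * β * yamabeP n * s * W₁ s := by nlinarith
      exact (mul_pos_iff_of_pos_left (by positivity)).mp h5
    -- Where `2βp tW₁ + γW` vanishes, so does the reaction–drift term of the ODE, leaving `2tW₁' =
    -- -nW₁`; the derivative is then a negative multiple of `W₁`.
    have e : 2 * β * yamabeP n * W₁ s + 2 * β * yamabeP n * s * (-(2 * n * W₁ s) / (4 * s))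
        + γ * W₁ s = (γ - β * yamabeP n * (n - 2)) * W₁ s := by
      field_simp
      ring
    rw [e]
    have : 0 < β * yamabeP n * (n - 2) := by
      have : 0 < (n : ℝ) - 2 := by linarith
      positivity
    nlinarith

end IsProfileOn

/-! ### Global profiles by truncation -/

/-- The power `w ↦ w ^ p`, made globally Lipschitz by truncating `w` to `[0, M]`. -/
noncomputable def truncPow (p M w : ℝ) : ℝ := max 0 (min w M) ^ p

lemma truncPow_eq {p M w : ℝ} (h0 : 0 ≤ w) (hM : w ≤ M) : truncPow p M w = w ^ p := by
  unfold truncPow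
  rw [min_eq_left hM, max_eq_right h0]

lemma abs_truncPow_le {p M w : ℝ} (hp : 0 ≤ p) (hM : 0 ≤ M) : |truncPow p M w| ≤ M ^ p := by
  unfold truncPow
  rw [abs_of_nonneg (by positivity)]
  exact Real.rpow_le_rpow (le_max_left _ _) (max_le hM (min_le_right _ _)) hp

lemma abs_rpow_sub_rpow_le {p M a b : ℝ} (hp : 1 ≤ p) (ha : a ∈ Set.Icc 0 M)
    (hb : b ∈ Set.Icc 0 M) : |a ^ p - b ^ p| ≤ p * M ^ (p - 1) * |a - b| := by
  refine Convex.norm_image_sub_le_of_norm_hasDerivWithin_le (f := fun x : ℝ => x ^ p)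
    (f' := fun x => p * x ^ (p - 1)) (s := Set.Icc 0 M)
    (fun x _ => (Real.hasDerivAt_rpow_const (Or.inr hp)).hasDerivWithinAt) (fun x hx => ?_)
    (convex_Icc 0 M) hb ha
  have : 0 ≤ x ^ (p - 1) := Real.rpow_nonneg hx.1 _
  rw [Real.norm_eq_abs, abs_of_nonneg (by positivity)]
  have h1 : x ^ (p - 1) ≤ M ^ (p - 1) := Real.rpow_le_rpow hx.1 hx.2 (by linarith)
  gcongr

lemma abs_truncPow_sub_le {p M a b : ℝ} (hp : 1 ≤ p) (hM : 0 ≤ M) :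
    |truncPow p M a - truncPow p M b| ≤ p * M ^ (p - 1) * |a - b| := by
  have hmem : ∀ w, max 0 (min w M) ∈ Set.Icc 0 M := fun w =>
    ⟨le_max_left _ _, max_le hM (min_le_right _ _)⟩
  refine (abs_rpow_sub_rpow_le hp (hmem a) (hmem b)).trans ?_
  have h1 : 0 ≤ p * M ^ (p - 1) := by
    have := Real.rpow_nonneg hM (p - 1); positivity
  refine mul_le_mul_of_nonneg_left ?_ h1
  calc |max 0 (min a M) - max 0 (min b M)| ≤ |min a M - min b M| := by
        have := abs_max_sub_max_le_max 0 (min a M) 0 (min b M); simpa using this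
    _ ≤ |a - b| := by
        have := abs_min_sub_min_le_max a M b M; simpa using this

lemma sq_mul_abs_le {σ : ℝ} (hσ : σ ∈ Set.Icc (0 : ℝ) 1) (s : ℝ) : |σ ^ 2 * s| ≤ |s| := by
  rw [abs_mul, abs_of_nonneg (sq_nonneg σ)]
  have : σ ^ 2 ≤ 1 := pow_le_one₀ hσ.1 hσ.2
  nlinarith [abs_nonneg s]

/-- Global solvability of the truncated profile equation. -/
lemma exists_truncated_profile {n : ℕ} (hn : 3 ≤ n) (β γ : ℝ) {M : ℝ → ℝ} (hM : Continuous M)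
    (hMpos : ∀ t, 0 < M t) (hMmono : Monotone M) (w₀ : ℝ) :
    ∃ W g : ℝ → ℝ, Continuous W ∧ Continuous g ∧ W 0 = w₀ ∧
      (∀ t, g t = truncPow (yamabeP n) (M |t|) (W t)) ∧
      ∀ t, HasDerivAt W (profileRhs n β γ g t) t := by
  have hp := one_lt_yamabeP hn
  have hc := yamabeC_pos hn
  set p := yamabeP n with hpdef
  set K := yamabeC n / 2 * (|β| + |γ - n * β|) with hK
  have hK0 : 0 ≤ K := by positivity
  -- The two summands serve as size bound `M^p` and Lipschitz constant `p M^(p-1)`. Monotonicity of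
  -- `M` is what controls the nonlocal average, which sees earlier times.
  set ℓ : ℝ → ℝ := fun s => K * (M s ^ p + p * M s ^ (p - 1)) with hℓ
  have hMp : ∀ q : ℝ, Continuous (fun s => M s ^ q) := fun q =>
    hM.rpow_const fun s => Or.inl (hMpos s).ne'
  have hℓc : Continuous ℓ := by
    have h1 := hMp p
    have h2 := hMp (p - 1)
    fun_prop
  have hℓ0 : ∀ t, 0 ≤ ℓ t := fun t => by
    have h1 := Real.rpow_pos_of_pos (hMpos t) p
    have h2 := Real.rpow_pos_of_pos (hMpos t) (p - 1)
    positivity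
  have hMle : ∀ σ ∈ Set.Icc (0 : ℝ) 1, ∀ s, M |σ ^ 2 * s| ≤ M |s| := fun σ hσ s =>
    hMmono (sq_mul_abs_le hσ s)
  let g : (ℝ → ℝ) → ℝ → ℝ := fun W t => truncPow p (M |t|) (W t)
  have hgc : ∀ W, Continuous W → Continuous (g W) := fun W hW => by
    simp only [g, truncPow]
    refine Continuous.rpow_const (by fun_prop) fun s => Or.inr (by linarith)
  obtain ⟨W, hW, hWeq⟩ := exists_eq_add_integral (fun W => profileRhs n β γ (g W))
    (Λ := fun t => ∫ s in (0 : ℝ)..t, ℓ s) (ℓ := ℓ)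
    (fun t => (hℓc.integral_hasStrictDerivAt 0 t).hasDerivAt) hℓc hℓ0 (by simp)
    (fun W hW => profileRhs_continuous n β γ (hgc W hW))
    (fun W _ s => by
      refine (abs_profileRhs_le hn β γ (B := M |s| ^ p) fun σ hσ => ?_).trans ?_
      · refine (abs_truncPow_le (by linarith) (hMpos _).le).trans ?_
        exact Real.rpow_le_rpow (hMpos _).le (hMle σ hσ s) (by linarith)
      · have h2 := Real.rpow_pos_of_pos (hMpos |s|) (p - 1)
        exact mul_le_mul_of_nonneg_left (by nlinarith) hK0)
    (fun W₁ W₂ h₁ h₂ s B hB => by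
      have hB0 : 0 ≤ B := (abs_nonneg _).trans (hB 1 (by simp))
      have h3 := Real.rpow_pos_of_pos (hMpos |s|) p
      have h4 := Real.rpow_pos_of_pos (hMpos |s|) (p - 1)
      rw [profileRhs_sub n β γ (hgc _ h₁) (hgc _ h₂)]
      refine (abs_profileRhs_le hn β γ (B := p * M |s| ^ (p - 1) * B) fun σ hσ => ?_).trans ?_
      · refine (abs_truncPow_sub_le hp.le (hMpos _).le).trans ?_
        have h5 : M |σ ^ 2 * s| ^ (p - 1) ≤ M |s| ^ (p - 1) :=
          Real.rpow_le_rpow (hMpos _).le (hMle σ hσ s) (by linarith)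
        have h6 := hB σ hσ
        gcongr
      · rw [← hK]
        simp only [hℓ]
        have : 0 ≤ K * M |s| ^ p * B := by positivity
        nlinarith)
    w₀
  refine ⟨W, g W, hW, hgc W hW, by rw [hWeq]; simp, fun t => rfl, fun t => ?_⟩
  have h1 := ((profileRhs_continuous n β γ (hgc W hW)).integral_hasStrictDerivAt 0 t).hasDerivAt
  exact (h1.const_add w₀).congr_of_eventuallyEq (Filter.Eventually.of_forall hWeq)

/-- A linear bound `W' ≤ kW` yields at most exponential growth. For `γ < 0` it comes from `2βp tW' +
γW ≤ 0`, whose rate is singular at `t = 0`; hence the positive starting time `t₁`. -/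
lemma IsProfileOn.deriv_le_mul {n : ℕ} (hn : 3 ≤ n) {β γ T : ℝ} {W W₁ : ℝ → ℝ}
    (h : IsProfileOn n β γ W W₁ T) (hβ : 0 < β) (hγ : γ ≠ 0) {t₁ t : ℝ} (ht₁ : 0 < t₁)
    (ht : t ∈ Set.Ioo t₁ T) :
    W₁ t ≤ max 0 (-γ) / (β * yamabeP n) / (2 * t₁) * W t := by
  have ht0 : t ∈ Set.Ioo 0 T := ⟨ht₁.trans ht.1, ht.2⟩
  have hW := h.pos t ⟨ht0.1.le, ht0.2⟩
  have hp := one_lt_yamabeP hn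
  rcases lt_or_gt_of_ne hγ with hneg | hpos
  · have h1 := h.two_mul_deriv_add_nonpos hn hβ hneg ht0
    have h2 := h.deriv_nonneg hn hneg ht0
    have h3 : β * yamabeP n * t₁ * W₁ t ≤ β * yamabeP n * t * W₁ t := by
      have := ht.1.le
      gcongr
    rw [max_eq_right (by linarith), div_div, div_mul_eq_mul_div, le_div_iff₀ (by positivity)]
    linarith
  · exact (h.deriv_nonpos hn hpos ht0).trans (by positivity)

/-- Solutions of the truncated equation stay strictly inside of the truncation. -/
lemma exists_global_profile {n : ℕ} (hn : 3 ≤ n) {β γ ρ : ℝ} (hβ : 0 < β)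
    (hγ : γ = (2 * β + ρ) * (n + 2) / 4) (hγ0 : γ ≠ 0) {w₀ : ℝ} (hw₀ : 0 < w₀) :
    ∃ W g : ℝ → ℝ, Continuous W ∧ Continuous g ∧ W 0 = w₀ ∧
      (∀ t, HasDerivAt W (profileRhs n β γ g t) t) ∧
      ∃ δ > 0, ∀ t, -δ < t → 0 < W t ∧ g t = W t ^ yamabeP n := by
  have hp := one_lt_yamabeP hn
  have hc := yamabeC_pos hn
  have h3n := three_le_cast hn
  set p := yamabeP n with hpdef
  set K := yamabeC n / 2 * (|β| + |γ - n * β|) with hK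
  have hK0 : 0 ≤ K := by positivity
  set q := max 0 (-γ) / (β * p) with hq
  have hq0 : 0 ≤ q := by positivity
  -- The circular dependence of `M`, `k` and `t₁` is broken by `k t₁ = q / 2`: the value `M(t₁) =
  -- M₁` is known before `t₁` is chosen. Then `t₁` is so small that `|W'| ≤ K M₁^p` keeps `W < 2w₀`
  -- on `[0, t₁]`, and beyond `t₁` the growth bound with rate `k` takes over.
  set M₁ := 2 * w₀ * Real.exp (q / 2) with hM₁
  have hM₁0 : 0 < M₁ := by positivity
  have hKM : 0 ≤ K * M₁ ^ p := by positivity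
  set t₁ := w₀ / (K * M₁ ^ p + 1) with ht₁
  have ht₁0 : 0 < t₁ := by positivity
  have ht₁K : K * M₁ ^ p * t₁ < w₀ := by
    rw [ht₁, mul_div_assoc', div_lt_iff₀ (by positivity)]
    nlinarith
  set k := q / (2 * t₁) with hk
  have hk0 : 0 ≤ k := by positivity
  have hkt : k * t₁ = q / 2 := by rw [hk]; field_simp
  set M : ℝ → ℝ := fun t => 2 * w₀ * Real.exp (k * t) with hM
  have hMc : Continuous M := by fun_prop
  have hMpos : ∀ t, 0 < M t := fun t => by positivity
  have hMmono : Monotone M := fun a b hab => by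
    simp only [hM]
    gcongr
  have hM0 : ∀ t, 0 ≤ t → 2 * w₀ ≤ M t := fun t ht => by
    have := Real.one_le_exp (by positivity : 0 ≤ k * t)
    simp only [hM]
    nlinarith
  have hM_t₁ : M t₁ = M₁ := by simp only [hM, hM₁, hkt]
  obtain ⟨W, g, hW, hg, hW0, hgW, hWd⟩ := exists_truncated_profile hn β γ hMc hMpos hMmono w₀
  set W₁ := profileRhs n β γ g with hW₁
  have hWsmall : ∀ t ∈ Set.Icc 0 t₁, W t < 2 * w₀ := by
    intro t ht
    have hbd : ∀ x ∈ Set.Icc 0 t, ‖W₁ x‖ ≤ K * M₁ ^ p := by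
      intro x hx
      refine abs_profileRhs_le hn β γ fun σ hσ => ?_
      rw [hgW]
      refine (abs_truncPow_le (by linarith) (hMpos _).le).trans ?_
      refine Real.rpow_le_rpow (hMpos _).le ?_ (by linarith)
      rw [← hM_t₁]
      apply hMmono
      refine (sq_mul_abs_le hσ x).trans ?_
      rw [abs_of_nonneg hx.1]
      exact hx.2.trans ht.2
    have := Convex.norm_image_sub_le_of_norm_hasDerivWithin_le (f := W) (f' := W₁)
      (fun x _ => (hWd x).hasDerivWithinAt) hbd (convex_Icc 0 t)
      (Set.left_mem_Icc.mpr ht.1) (Set.right_mem_Icc.mpr ht.1)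
    rw [hW0, sub_zero, Real.norm_eq_abs, Real.norm_eq_abs, abs_of_nonneg ht.1] at this
    have h1 := le_abs_self (W t - w₀)
    have h2 : K * M₁ ^ p * t ≤ K * M₁ ^ p * t₁ := mul_le_mul_of_nonneg_left ht.2 hKM
    linarith
  have main : ∀ t, 0 ≤ t → 0 < W t ∧ W t < M t := by
    by_contra hcon
    push Not at hcon
    -- The infimum `T` of `S` is the first time at which positivity or the upper bound fails; before
    -- it `W` is a genuine profile.
    set S := Set.Ici (0 : ℝ) ∩ ({t | W t ≤ 0} ∪ {t | M t ≤ W t}) with hS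
    have hSne : S.Nonempty := by
      obtain ⟨t, ht, ht'⟩ := hcon
      refine ⟨t, ht, ?_⟩
      by_cases h : 0 < W t
      · exact Or.inr (ht' h)
      · exact Or.inl (not_lt.mp h)
    have hSc : IsClosed S :=
      isClosed_Ici.inter ((isClosed_le hW continuous_const).union (isClosed_le hMc hW))
    have hSb : BddBelow S := ⟨0, fun t ht => ht.1⟩
    have hTS := hSc.csInf_mem hSne hSb
    set T := sInf S with hT
    have hlt : ∀ t ∈ Set.Ico 0 T, 0 < W t ∧ W t < M t := by
      intro t ht
      have h1 : t ∉ S := fun h => (csInf_le hSb h).not_gt ht.2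
      by_contra h2
      apply h1
      refine ⟨ht.1, ?_⟩
      by_cases h : 0 < W t
      · exact Or.inr (not_lt.mp fun h' => h2 ⟨h, h'⟩)
      · exact Or.inl (not_lt.mp h)
    have hT0 : 0 < T := by
      rcases eq_or_lt_of_le (show (0 : ℝ) ≤ T from hTS.1) with h | h
      · exfalso
        rw [← h] at hTS
        rcases hTS.2 with h' | h'
        · have : W 0 ≤ 0 := h'
          linarith
        · have : M 0 ≤ W 0 := h'
          linarith [hM0 0 le_rfl]
      · exact h
    have hprof : IsProfileOn n β γ W W₁ T := by
      refine IsProfileOn.of_profileRhs hn hT0 hW hg (fun t ht => (hlt t ht).1) (fun t ht => ?_)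
        fun t _ => hWd t
      rw [hgW, abs_of_nonneg ht.1]
      exact truncPow_eq (hlt t ht).1.le (hlt t ht).2.le
    have hWT : 0 < W T := by
      have h1 : 0 ≤ W T := by
        refine ge_of_tendsto (hW.continuousAt.tendsto.mono_left
          (nhdsWithin_le_nhds (s := Set.Iio T))) ?_
        filter_upwards [Ioo_mem_nhdsLT hT0] with s hs using (hlt s ⟨hs.1.le, hs.2⟩).1.le
      rcases eq_or_lt_of_le h1 with h2 | h2
      -- If `W T = 0`, the energy at `T` equals `2T W₁(T)² ≥ 0`, against its strict negativity up to
      -- the end point.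
      · exfalso
        have h4 := hprof.radialEnergy_end_neg hn hT0 hβ hγ
        unfold radialEnergy at h4
        rw [← h2, Real.zero_rpow (by linarith)] at h4
        nlinarith [mul_nonneg hT0.le (sq_nonneg (W₁ T))]
      · exact h2
    have hWM : W T < M T := by
      rcases le_or_gt T t₁ with h | h
      · exact (hWsmall T ⟨hT0.le, h⟩).trans_le (hM0 T hT0.le)
      · have hgrow : ∀ t ∈ Set.Ioo t₁ T, W₁ t ≤ k * W t := by
          intro t ht
          exact hprof.deriv_le_mul hn hβ hγ0 ht₁0 ht
        have hanti : AntitoneOn (fun t => W t * Real.exp (-(k * t))) (Set.Icc t₁ T) := by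
          have hd : ∀ t, HasDerivAt (fun t => W t * Real.exp (-(k * t)))
              (W₁ t * Real.exp (-(k * t)) + W t * (Real.exp (-(k * t)) * (-(k * 1)))) t :=
            fun t => (hWd t).mul (((hasDerivAt_id t).const_mul k).neg.exp)
          apply antitoneOn_of_hasDerivWithinAt_nonpos (convex_Icc t₁ T)
            (fun t _ => (hd t).continuousAt.continuousWithinAt)
            (fun t _ => (hd t).hasDerivWithinAt)
          intro t ht
          rw [interior_Icc] at ht
          have h1 := hgrow t ht
          have h2 := Real.exp_pos (-(k * t))
          nlinarith
        have h1 := hanti (Set.left_mem_Icc.mpr h.le) (Set.right_mem_Icc.mpr h.le) h.le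
        have h2 := hWsmall t₁ ⟨ht₁0.le, le_rfl⟩
        simp only [Real.exp_neg] at h1
        rw [← div_eq_mul_inv, ← div_eq_mul_inv, div_le_iff₀ (Real.exp_pos _)] at h1
        have h4 : W t₁ / Real.exp (k * t₁) ≤ W t₁ :=
          div_le_self (hlt t₁ ⟨ht₁0.le, h⟩).1.le (Real.one_le_exp (by positivity))
        refine h1.trans_lt ?_
        simp only [hM]
        have := Real.exp_pos (k * T)
        nlinarith
    rcases hTS.2 with h | h
    · exact (not_lt.mpr h) hWT
    · exact (not_lt.mpr h) hWM
  -- The truncation is inactive also for slightly negative `t`, so that regularity can be obtained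
  -- on an open interval around `0`.
  have hnear : ∀ᶠ t in nhds (0 : ℝ), 0 < W t ∧ W t < M |t| := by
    have h1 := main 0 le_rfl
    refine (hW.continuousAt.eventually (lt_mem_nhds h1.1)).and ?_
    have hc2 : Continuous (fun t => M |t| - W t) := by fun_prop
    have h2 : 0 < M |0| - W 0 := by simpa using h1.2
    filter_upwards [hc2.continuousAt.eventually (lt_mem_nhds h2)] with t ht
    linarith
  obtain ⟨δ, hδ, hball⟩ := Metric.eventually_nhds_iff.mp hnear
  refine ⟨W, g, hW, hg, hW0, hWd, δ, hδ, fun t ht => ?_⟩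
  have h1 : 0 < W t ∧ W t < M |t| := by
    rcases le_or_gt 0 t with h | h
    · rw [abs_of_nonneg h]; exact main t h
    · apply hball
      rw [Real.dist_eq, sub_zero, abs_of_neg h]
      linarith
  exact ⟨h1.1, by rw [hgW]; exact truncPow_eq h1.1.le h1.2.le⟩

/-! ### Regularity of profiles, including at the origin -/

lemma sq_mul_mem_Icc {a b : ℝ} (ha : a ≤ 0) (hb : 0 ≤ b) {t σ : ℝ} (ht : t ∈ Set.Icc a b)
    (hσ : σ ∈ Set.Icc (0 : ℝ) 1) : σ ^ 2 * t ∈ Set.Icc a b := by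
  have h1 : σ ^ 2 ≤ 1 := pow_le_one₀ hσ.1 hσ.2
  have h2 := sq_nonneg σ
  constructor
  · nlinarith [ht.1]
  · nlinarith [ht.2]

lemma exists_Icc_subset_Ioo {a b t : ℝ} (ha : a < 0) (hb : 0 < b) (ht : t ∈ Set.Ioo a b) :
    ∃ a' b', a < a' ∧ a' < 0 ∧ 0 < b' ∧ b' < b ∧ t ∈ Set.Ioo a' b' := by
  obtain ⟨a', h1, h2⟩ := exists_between (lt_min ht.1 ha)
  obtain ⟨b', h3, h4⟩ := exists_between (max_lt ht.2 hb)
  exact ⟨a', b', h1, h2.trans_le (min_le_right _ _), (le_max_right _ _).trans_lt h3, h4,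
    h2.trans_le (min_le_left _ _), (le_max_left _ _).trans_lt h3⟩

/-- The average at `t` sees `g` only between `0` and `t`, so `g` may be replaced by a continuous
extension from a compact interval containing both. -/
lemma radialAvg_continuousOn (j : ℕ) {g : ℝ → ℝ} {a b : ℝ} (ha : a < 0) (hb : 0 < b)
    (hg : ContinuousOn g (Set.Ioo a b)) : ContinuousOn (radialAvg j g) (Set.Ioo a b) := by
  intro t ht
  obtain ⟨a', b', h1, h2, h3, h4, ht'⟩ := exists_Icc_subset_Ioo ha hb ht
  have hab : a' ≤ b' := by linarith
  have hsub : Set.Icc a' b' ⊆ Set.Ioo a b := fun x hx => ⟨h1.trans_le hx.1, hx.2.trans_lt h4⟩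
  have hc : Continuous (Set.IccExtend hab ((Set.Icc a' b').domRestrict g)) :=
    (hg.mono hsub).domRestrict.Icc_extend'
  have h5 := (radialAvg_continuous j hc).continuousAt (x := t)
  refine (h5.congr ?_).continuousWithinAt
  filter_upwards [Ioo_mem_nhds ht'.1 ht'.2] with s hs
  apply radialAvg_congr
  intro σ hσ
  rw [Set.IccExtend_of_mem hab _ (sq_mul_mem_Icc h2.le h3.le ⟨hs.1.le, hs.2.le⟩ hσ)]
  rfl

/-- Each derivative brings out a factor `σ²`. The weight `j` thus has to stay general in the
induction on the order of smoothness. -/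
lemma radialAvg_hasDerivAt (j : ℕ) {g g' : ℝ → ℝ} {a b : ℝ} (ha : a < 0) (hb : 0 < b)
    (hg : ∀ t ∈ Set.Ioo a b, HasDerivAt g (g' t) t) (hg' : ContinuousOn g' (Set.Ioo a b))
    {t : ℝ} (ht : t ∈ Set.Ioo a b) :
    HasDerivAt (radialAvg j g) (radialAvg (j + 2) g' t) t := by
  obtain ⟨a', b', h1, h2, h3, h4, ht'⟩ := exists_Icc_subset_Ioo ha hb ht
  have hsub : Set.Icc a' b' ⊆ Set.Ioo a b := fun x hx => ⟨h1.trans_le hx.1, hx.2.trans_lt h4⟩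
  have hgc : ContinuousOn g (Set.Icc a' b') := fun x hx =>
    (hg x (hsub hx)).continuousAt.continuousWithinAt
  have hg'c := hg'.mono hsub
  obtain ⟨C, hC⟩ := isCompact_Icc.exists_bound_of_continuousOn hg'c
  have hmaps : ∀ s ∈ Set.Ioo a' b', Set.MapsTo (fun σ : ℝ => σ ^ 2 * s) (Set.Icc 0 1)
      (Set.Icc a' b') := fun s hs σ hσ => sq_mul_mem_Icc h2.le h3.le ⟨hs.1.le, hs.2.le⟩ hσ
  have hcont : ∀ (k : ℕ) (f : ℝ → ℝ), ContinuousOn f (Set.Icc a' b') → ∀ s ∈ Set.Ioo a' b',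
      ContinuousOn (fun σ : ℝ => σ ^ k * f (σ ^ 2 * s)) (Set.Icc 0 1) := fun k f hf s hs =>
    ContinuousOn.mul (by fun_prop) (hf.comp (by fun_prop) (hmaps s hs))
  have huI : Set.uIoc (0 : ℝ) 1 ⊆ Set.Icc 0 1 := by
    rw [Set.uIoc_of_le zero_le_one]; exact Set.Ioc_subset_Icc_self
  unfold radialAvg
  refine (intervalIntegral.hasDerivAt_integral_of_dominated_loc_of_deriv_le
    (F := fun s σ => σ ^ j * g (σ ^ 2 * s)) (F' := fun s σ => σ ^ (j + 2) * g' (σ ^ 2 * s))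
    (bound := fun _ => C) (s := Set.Ioo a' b') (Ioo_mem_nhds ht'.1 ht'.2) ?_ ?_ ?_ ?_ ?_ ?_).2
  · filter_upwards [Ioo_mem_nhds ht'.1 ht'.2] with s hs
    exact ((hcont j g hgc s hs).mono huI).aestronglyMeasurable measurableSet_uIoc
  · apply ContinuousOn.intervalIntegrable
    rw [Set.uIcc_of_le zero_le_one]
    exact hcont j g hgc t ht'
  · exact ((hcont (j + 2) g' hg'c t ht').mono huI).aestronglyMeasurable measurableSet_uIoc
  · refine Filter.Eventually.of_forall fun σ hσ s hs => ?_
    have hσ' := huI hσ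
    have h5 := hC _ (hmaps s hs hσ')
    rw [norm_mul, Real.norm_eq_abs, abs_of_nonneg (pow_nonneg hσ'.1 _)]
    have h6 : σ ^ (j + 2) ≤ 1 := pow_le_one₀ hσ'.1 hσ'.2
    nlinarith [norm_nonneg (g' (σ ^ 2 * s)), pow_nonneg hσ'.1 (j + 2)]
  · exact intervalIntegrable_const
  · refine Filter.Eventually.of_forall fun σ hσ s hs => ?_
    have h5 := hg _ (hsub (hmaps s hs (huI hσ)))
    have h6 := (h5.comp s ((hasDerivAt_id s).const_mul (σ ^ 2))).const_mul (σ ^ j)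
    refine h6.congr_deriv ?_
    simp only [mul_one]
    ring

lemma contDiffOn_succ_of_hasDerivAt {f f' : ℝ → ℝ} {s : Set ℝ} (hs : IsOpen s) {k : ℕ}
    (hf : ∀ t ∈ s, HasDerivAt f (f' t) t) (hf' : ContDiffOn ℝ k f' s) :
    ContDiffOn ℝ (k + 1 : ℕ) f s := by
  push_cast
  rw [contDiffOn_succ_iff_deriv_of_isOpen hs]
  refine ⟨fun t ht => (hf t ht).differentiableAt.differentiableWithinAt, by simp, ?_⟩
  exact hf'.congr fun t ht => (hf t ht).deriv

lemma radialAvg_contDiffOn {a b : ℝ} (ha : a < 0) (hb : 0 < b) (k : ℕ) :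
    ∀ (j : ℕ) {g : ℝ → ℝ}, ContDiffOn ℝ k g (Set.Ioo a b) →
      ContDiffOn ℝ k (radialAvg j g) (Set.Ioo a b) := by
  induction k with
  | zero =>
    intro j g hg
    simp only [Nat.cast_zero, contDiffOn_zero] at hg ⊢
    exact radialAvg_continuousOn j ha hb hg
  | succ k ih =>
    intro j g hg
    push_cast at hg
    rw [contDiffOn_succ_iff_deriv_of_isOpen isOpen_Ioo] at hg
    refine contDiffOn_succ_of_hasDerivAt isOpen_Ioo (fun t ht => ?_) (ih (j + 2) hg.2.2)
    exact radialAvg_hasDerivAt j ha hb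
      (fun s hs => (hg.1.differentiableAt (isOpen_Ioo.mem_nhds hs)).hasDerivAt)
      hg.2.2.continuousOn ht

/-- Bootstrapping in the integro-differential equation. -/
lemma profile_contDiffOn {n : ℕ} {β γ : ℝ} {W g : ℝ → ℝ} {a b : ℝ} (ha : a < 0) (hb : 0 < b)
    (hpos : ∀ t ∈ Set.Ioo a b, 0 < W t) (hg : ∀ t ∈ Set.Ioo a b, g t = W t ^ yamabeP n)
    (hd : ∀ t ∈ Set.Ioo a b, HasDerivAt W (profileRhs n β γ g t) t) :
    ContDiffOn ℝ ∞ W (Set.Ioo a b) ∧ ContDiffOn ℝ ∞ (profileRhs n β γ g) (Set.Ioo a b) := by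
  have hrhs : ∀ k : ℕ, ContDiffOn ℝ k W (Set.Ioo a b) →
      ContDiffOn ℝ k (profileRhs n β γ g) (Set.Ioo a b) := by
    intro k hk
    have h1 : ContDiffOn ℝ k g (Set.Ioo a b) :=
      (hk.rpow_const_of_ne fun t ht => (hpos t ht).ne').congr hg
    have h2 := radialAvg_contDiffOn ha hb k (n - 1) h1
    unfold profileRhs
    fun_prop
  have hW : ∀ k : ℕ, ContDiffOn ℝ k W (Set.Ioo a b) := by
    intro k
    induction k with
    | zero =>
      simp only [Nat.cast_zero, contDiffOn_zero]
      exact fun t ht => (hd t ht).continuousAt.continuousWithinAt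
    | succ k ih => exact contDiffOn_succ_of_hasDerivAt isOpen_Ioo hd (hrhs k ih)
  exact ⟨contDiffOn_infty.mpr hW, contDiffOn_infty.mpr fun k => hrhs k (hW k)⟩

/-! ### Profiles versus solutions, and uniqueness -/

/-- The function on `ℝⁿ` with radial profile `W`. -/
noncomputable def ofProfile (n : ℕ) (W : ℝ → ℝ) (x : EuclideanSpace ℝ (Fin n)) : ℝ :=
  W (‖x‖ ^ 2) ^ yamabeP n

lemma isRadialSolution_ofProfile {n : ℕ} (hn : 3 ≤ n) {β γ : ℝ} {W W₁ : ℝ → ℝ}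
    (hpos : ∀ t, 0 ≤ t → 0 < W t) (hsmooth : ∀ t, 0 ≤ t → ContDiffAt ℝ ∞ W t)
    (hd : ∀ t, 0 ≤ t → ∀ᶠ s in nhds t, HasDerivAt W (W₁ s) s)
    (hd₂ : ∀ t, 0 ≤ t → ∃ w₂, HasDerivAt W₁ w₂ t ∧ 4 * t * w₂ + 2 * n * W₁ t
      + yamabeC n * (2 * β * yamabeP n * t * W t ^ (yamabeP n - 1) * W₁ t
        + γ * W t ^ yamabeP n) = 0) :
    IsRadialSolution n β γ (ofProfile n W) where
  smooth := by
    rw [contDiff_iff_contDiffAt]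
    intro x
    have h0 : 0 ≤ ‖x‖ ^ 2 := by positivity
    exact ((hsmooth _ h0).comp x (contDiff_norm_sq ℝ).contDiffAt).rpow_const_of_ne (hpos _ h0).ne'
  pos x := Real.rpow_pos_of_pos (hpos _ (by positivity)) _
  radial x y h := by unfold ofProfile; rw [h]
  equation x := by
    obtain ⟨w₂, h1, h2⟩ := hd₂ (‖x‖ ^ 2) (by positivity)
    have h3 := radial_equation hn (β := β) (γ := γ) hpos (hd (‖x‖ ^ 2) (by positivity)) h1
    unfold ofProfile
    rw [h3, h2, mul_zero]

lemma ofProfile_zero {n : ℕ} {W : ℝ → ℝ} : ofProfile n W 0 = W 0 ^ yamabeP n := by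
  simp [ofProfile]

/-- Existence of solutions with any given value at the origin, together with their profiles. -/
lemma exists_isRadialSolution {n : ℕ} (hn : 3 ≤ n) {β γ ρ : ℝ} (hβ : 0 < β)
    (hγ : γ = (2 * β + ρ) * (n + 2) / 4) (hγ0 : γ ≠ 0) {l : ℝ} (hl : 0 < l) :
    ∃ W W₁ : ℝ → ℝ, (∀ T, 0 < T → IsProfileOn n β γ W W₁ T) ∧
      IsRadialSolution n β γ (ofProfile n W) ∧ ofProfile n W 0 = l := by
  obtain ⟨W, g, hW, hg, hW0, hd, δ, hδ, hδW⟩ := exists_global_profile hn hβ hγ hγ0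
    (Real.rpow_pos_of_pos hl (yamabeM n))
  have hprof : ∀ T, 0 < T → IsProfileOn n β γ W (profileRhs n β γ g) T := fun T hT =>
    IsProfileOn.of_profileRhs hn hT hW hg (fun t ht => (hδW t (by linarith [ht.1])).1)
      (fun t ht => (hδW t (by linarith [ht.1])).2) fun t _ => hd t
  have hreg : ∀ t, 0 ≤ t →
      ContDiffAt ℝ ∞ W t ∧ ContDiffAt ℝ ∞ (profileRhs n β γ g) t := by
    intro t ht
    have h1 := profile_contDiffOn (n := n) (β := β) (γ := γ) (W := W) (g := g) (a := -δ)
      (b := t + 1) (by linarith) (by linarith) (fun s hs => (hδW s hs.1).1)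
      (fun s hs => (hδW s hs.1).2) fun s _ => hd s
    have h2 : Set.Ioo (-δ) (t + 1) ∈ nhds t := Ioo_mem_nhds (by linarith) (by linarith)
    exact ⟨h1.1.contDiffAt h2, h1.2.contDiffAt h2⟩
  refine ⟨W, profileRhs n β γ g, hprof, isRadialSolution_ofProfile hn
    (fun t ht => (hδW t (by linarith)).1) (fun t ht => (hreg t ht).1)
    (fun t _ => Filter.Eventually.of_forall hd) (fun t ht => ?_), ?_⟩
  · rcases eq_or_lt_of_le ht with h | h
    -- At `t = 0` the second derivative carries the factor `0`; its existence comes from the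
    -- bootstrapped regularity, and the remaining equation is the initial slope.
    · subst h
      refine ⟨_, ((hreg 0 le_rfl).2.differentiableAt (by simp)).hasDerivAt, ?_⟩
      rw [(hprof 1 one_pos).init]
      have := three_le_cast hn
      field_simp
      ring
    · refine ⟨_, (hprof (t + 1) (by linarith)).second_deriv t ⟨h, by linarith⟩, ?_⟩
      rw [rpow_eq_rpow_sub_one_mul (hδW t (by linarith)).1 (yamabeP n)]
      field_simp
      ring
  · rw [ofProfile_zero, hW0, rpow_yamabeM_rpow_yamabeP hn hl]

/-- Every radial solution has a profile satisfying the integro-differential equation. -/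
lemma IsRadialSolution.exists_profile {n : ℕ} (hn : 3 ≤ n) {β γ : ℝ}
    {u : EuclideanSpace ℝ (Fin n) → ℝ} (hu : IsRadialSolution n β γ u) :
    ∃ W : ℝ → ℝ, Continuous W ∧ (∀ t, 0 < W t) ∧ Continuous (fun t => W t ^ yamabeP n) ∧
      (∀ t, 0 < t → HasDerivAt W (profileRhs n β γ (fun t => W t ^ yamabeP n) t) t) ∧
      u = ofProfile n W := by
  have h3 := three_le_cast hn
  obtain ⟨e, he⟩ : ∃ e : EuclideanSpace ℝ (Fin n), ‖e‖ = 1 :=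
    ⟨EuclideanSpace.single ⟨0, by omega⟩ 1, by simp⟩
  set φ : ℝ → ℝ := fun r => u (r • e) ^ yamabeM n with hφ
  have hφs : ContDiff ℝ ∞ φ := by
    have h1 : ContDiff ℝ ∞ (fun r : ℝ => u (r • e)) := hu.smooth.comp (by fun_prop)
    exact h1.rpow_const_of_ne fun r => (hu.pos _).ne'
  -- For `t < 0` the convention `√t = 0` makes `W` constant, hence continuous and positive on all of
  -- `ℝ`.
  set W : ℝ → ℝ := fun t => φ √t with hW
  have hWc : Continuous W := hφs.continuous.comp Real.continuous_sqrt
  have hWpos : ∀ t, 0 < W t := fun t => Real.rpow_pos_of_pos (hu.pos _) _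
  have hgc : Continuous (fun t => W t ^ yamabeP n) :=
    hWc.rpow_const fun t => Or.inl (hWpos t).ne'
  have huW : u = ofProfile n W := by
    ext x
    unfold ofProfile
    simp only [hW, hφ]
    rw [rpow_yamabeM_rpow_yamabeP hn (hu.pos _)]
    apply hu.radial
    rw [Real.sqrt_sq (norm_nonneg x), norm_smul, he, mul_one, norm_norm]
  have hWs : ∀ t, 0 < t → ContDiffAt ℝ ∞ W t := fun t ht =>
    hφs.contDiffAt.comp t (Real.contDiffAt_sqrt ht.ne')
  have hW₁ : ∀ t, 0 < t → HasDerivAt W (deriv W t) t := fun t ht =>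
    ((hWs t ht).differentiableAt (by simp)).hasDerivAt
  have hW₂ : ∀ t, 0 < t → HasDerivAt (deriv W) (deriv (deriv W) t) t := by
    intro t ht
    have h1 : ContDiffOn ℝ ∞ W (Set.Ioi 0) := fun s hs => (hWs s hs).contDiffWithinAt
    rw [contDiffOn_infty_iff_deriv_of_isOpen isOpen_Ioi] at h1
    exact ((h1.2.contDiffAt (Ioi_mem_nhds ht)).differentiableAt (by simp)).hasDerivAt
  have hode : ∀ t, 0 < t → 4 * t * deriv (deriv W) t + 2 * n * deriv W t
      + yamabeC n * (2 * β * yamabeP n * t * W t ^ (yamabeP n - 1) * deriv W t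
        + γ * W t ^ yamabeP n) = 0 := by
    intro t ht
    have h1 : ‖√t • e‖ ^ 2 = t := by
      rw [norm_smul, he, mul_one, Real.norm_eq_abs, sq_abs, Real.sq_sqrt ht.le]
    have h2 := radial_equation hn (β := β) (γ := γ) (W := W) (W₁ := deriv W)
      (w₂ := deriv (deriv W) t) (x := √t • e) (fun s _ => hWpos s)
      (by rw [h1]; filter_upwards [lt_mem_nhds ht] with s hs using hW₁ s hs)
      (by rw [h1]; exact hW₂ t ht)
    have h4 := hu.equation (√t • e)
    rw [huW] at h4
    have h5 := h2.symm.trans h4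
    rw [h1] at h5
    have h6 : ((n : ℝ) - 1) / yamabeM n ≠ 0 :=
      (div_pos (by linarith) (yamabeM_pos hn)).ne'
    exact (mul_eq_zero.mp h5).resolve_left h6
  set g : ℝ → ℝ := fun t => W t ^ yamabeP n with hg
  -- The defect `F = W' - profileRhs` satisfies `2tF' + nF = 0`, so `t^(n/2) F` is constant; its
  -- limit at `0` shows that it vanishes.
  have hF : ∀ t, 0 < t → HasDerivAt (fun s => deriv W s - profileRhs n β γ g s)
      (-(n / (2 * t)) * (deriv W t - profileRhs n β γ g t)) t := by
    intro t ht
    have h1 := (hW₁ t ht).rpow_const (p := yamabeP n) (Or.inl (hWpos t).ne')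
    have h2 := (hW₂ t ht).sub (profileRhs_hasDerivAt hn β γ hgc ht h1)
    refine h2.congr_deriv ?_
    have h5 := hode t ht
    simp only [hg]
    field_simp
    linear_combination 2 * h5
  -- A priori `W' = φ'(√t) / (2√t)` might be singular; the weight absorbs `1 / √t` and still has the
  -- positive power `t^((n-1)/2)` left.
  have hlim : Filter.Tendsto (fun t => t ^ ((n : ℝ) / 2) * (deriv W t - profileRhs n β γ g t))
      (nhdsWithin 0 (Set.Ioi 0)) (nhds 0) := by
    have h1 := tendsto_rpow_mul_zero (N := n - 1) (by linarith) (F := fun t => deriv φ √t / 2)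
      (by
        have : Continuous (deriv φ) := hφs.continuous_deriv (by simp)
        exact Continuous.continuousAt (by fun_prop))
    have h2 := tendsto_rpow_mul_zero (N := n) (by linarith)
      (profileRhs_continuous n β γ hgc).continuousAt
    have h4 := h1.sub h2
    rw [sub_zero] at h4
    refine h4.congr' ?_
    filter_upwards [self_mem_nhdsWithin] with t ht
    have ht : 0 < t := ht
    have h5 : deriv W t = deriv φ √t * (1 / (2 * √t)) :=
      (((hφs.differentiable (by simp)).differentiableAt.hasDerivAt).comp t
        (Real.hasDerivAt_sqrt ht.ne')).deriv
    have h6 : t ^ ((n : ℝ) / 2) = t ^ (((n : ℝ) - 1) / 2) * √t := by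
      rw [Real.sqrt_eq_rpow, ← Real.rpow_add ht]; congr 1; ring
    have h7 : √t ≠ 0 := (Real.sqrt_pos.mpr ht).ne'
    rw [mul_sub, h5]
    congr 1
    rw [h6]
    field_simp
  refine ⟨W, hWc, hWpos, hgc, fun t ht => ?_, huW⟩
  have hmem : t ∈ Set.Ioo 0 (t + 1) := ⟨ht, by linarith⟩
  have h1 := nonpos_of_two_mul_deriv_add_le (N := n) (T := t + 1) (fun s hs => hF s hs.1)
    (fun s hs => le_of_eq (by have := hs.1.ne'; field_simp; ring)) hlim hmem
  have h2 := nonpos_of_two_mul_deriv_add_le (N := n) (T := t + 1)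
    (F := fun t => -(deriv W t - profileRhs n β γ g t)) (fun s hs => (hF s hs.1).neg)
    (fun s hs => le_of_eq (by have := hs.1.ne'; field_simp; ring))
    (by simpa only [mul_neg, neg_zero] using hlim.neg) hmem
  have h4 : deriv W t = profileRhs n β γ g t := by linarith
  exact h4 ▸ hW₁ t ht

lemma IsRadialSolution.exists_isProfileOn {n : ℕ} (hn : 3 ≤ n) {β γ : ℝ}
    {u : EuclideanSpace ℝ (Fin n) → ℝ} (hu : IsRadialSolution n β γ u) :
    ∃ W W₁ : ℝ → ℝ, (∀ T, 0 < T → IsProfileOn n β γ W W₁ T) ∧ u = ofProfile n W := by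
  obtain ⟨W, hW, hpos, hg, hd, rfl⟩ := hu.exists_profile hn
  exact ⟨W, _, fun T hT => IsProfileOn.of_profileRhs hn hT hW hg (fun t _ => hpos t)
    (fun t _ => rfl) fun t ht => hd t ht.1, rfl⟩

/-- A radial solution is determined by its value at the origin. -/
lemma IsRadialSolution.unique {n : ℕ} (hn : 3 ≤ n) {β γ : ℝ}
    {u v : EuclideanSpace ℝ (Fin n) → ℝ} (hu : IsRadialSolution n β γ u)
    (hv : IsRadialSolution n β γ v) (h0 : u 0 = v 0) : u = v := by
  obtain ⟨W, hW, hWpos, hWg, hWd, rfl⟩ := hu.exists_profile hn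
  obtain ⟨V, hV, hVpos, hVg, hVd, rfl⟩ := hv.exists_profile hn
  have hp := one_lt_yamabeP hn
  have hc := yamabeC_pos hn
  have hWV0 : W 0 = V 0 := by
    rw [ofProfile_zero, ofProfile_zero] at h0
    exact (Real.rpow_left_inj (hWpos 0).le (hVpos 0).le (by linarith)).mp h0
  have key : ∀ T, 0 ≤ T → W T = V T := by
    intro T hT
    obtain ⟨M, hM⟩ := (isCompact_Icc (a := (0 : ℝ)) (b := T)).exists_bound_of_continuousOn
      (f := fun t => W t + V t) (hW.add hV).continuousOn
    have hMW : ∀ t ∈ Set.Icc 0 T, W t ∈ Set.Icc 0 M ∧ V t ∈ Set.Icc 0 M := by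
      intro t ht
      have h1 := (le_abs_self _).trans (hM t ht)
      have h2 := hWpos t
      have h3 := hVpos t
      exact ⟨⟨h2.le, by linarith⟩, ⟨h3.le, by linarith⟩⟩
    have hM0 : 0 < M := (hWpos 0).trans_le (hMW 0 ⟨le_rfl, hT⟩).1.2
    have h := eq_zero_of_abs_deriv_le (D := fun t => W t - V t) (T := T)
      -- The summand `1` keeps `L` positive when `β = γ = 0`.
      (L := yamabeC n / 2 * (|β| + |γ - n * β|) * (yamabeP n * M ^ (yamabeP n - 1)) + 1)
      (by positivity) hT (hW.sub hV).continuousOn (by simp [hWV0])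
      (fun t ht => (hWd t ht.1).sub (hVd t ht.1)) (fun t ht B hB => by
        rw [profileRhs_sub n β γ hWg hVg]
        have hB0 : 0 ≤ B := (abs_nonneg _).trans (hB 0 ⟨le_rfl, ht.1.le⟩)
        refine (abs_profileRhs_le hn β γ (B := yamabeP n * M ^ (yamabeP n - 1) * B)
          fun σ hσ => ?_).trans ?_
        · have hmem := sq_mul_mem_Icc le_rfl ht.1.le ⟨ht.1.le, le_rfl⟩ hσ
          have h1 := hMW _ ⟨hmem.1, hmem.2.trans ht.2.le⟩
          refine (abs_rpow_sub_rpow_le hp.le h1.1 h1.2).trans ?_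
          exact mul_le_mul_of_nonneg_left (hB _ hmem) (by positivity)
        · nlinarith) T ⟨hT, le_rfl⟩
    linarith
  ext x
  unfold ofProfile
  rw [key _ (by positivity)]

/-- A family of solutions with bijective values at the origin is a solution family. -/
lemma isSolutionFamily_of_isRadialSolution {n : ℕ} (hn : 3 ≤ n) {β γ : ℝ}
    {u : ℝ → EuclideanSpace ℝ (Fin n) → ℝ} (hu : ∀ l, 0 < l → IsRadialSolution n β γ (u l))
    (h0 : ∀ a, 0 < a → ∃! l, 0 < l ∧ u l 0 = a) : IsSolutionFamily n β γ u where
  solution := hu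
  parameter := h0
  unique l hl _ hv hvl := hv.unique hn (hu l hl) hvl

/-- The constant functions solve the equation when `γ = 0`. -/
lemma isRadialSolution_const (n : ℕ) {β c : ℝ} (hc : 0 < c) :
    IsRadialSolution n β 0 (fun _ => c) where
  smooth := contDiff_const
  pos _ := hc
  radial _ _ _ := rfl
  equation x := by simp [InnerProductSpace.laplacian_const]

/-- Constants already attain every positive value at the origin, so uniqueness leaves no other
solution, whatever `β` is. -/
lemma IsRadialSolution.eq_const {n : ℕ} (hn : 3 ≤ n) {β : ℝ}
    {u : EuclideanSpace ℝ (Fin n) → ℝ} (hu : IsRadialSolution n β 0 u) : u = fun _ => u 0 :=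
  hu.unique hn (isRadialSolution_const n (hu.pos 0)) rfl

/-! ### Nonexistence for `β ≤ 0`, `γ < 0` -/

namespace IsProfileOn

variable {n : ℕ} {β γ ρ T : ℝ} {W W₁ : ℝ → ℝ}

lemma comparison_function_hasDerivAt {A Q a t : ℝ} (ht : t < Q) :
    HasDerivAt (fun t => A * (Q - t) ^ (-a)) (A * a * (Q - t) ^ (-a - 1)) t := by
  have h1 := (((hasDerivAt_id t).const_sub Q).rpow_const (p := -a)
    (Or.inl (sub_pos.mpr ht).ne')).const_mul A
  refine h1.congr_deriv ?_
  simp only [id_eq]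
  ring

/-- Comparison with a solution blowing up at `t = Q`. -/
lemma lt_of_comparison (hn : 3 ≤ n) (h : IsProfileOn n β γ W W₁ T) (hβ : β ≤ 0) (hγ : γ < 0)
    {Q A : ℝ} (hQT : Q ≤ T) (hA : 0 < A) (hA0 : A * Q ^ (-(((n : ℝ) - 2) / 2)) < W 0)
    (hAQ : ((n : ℝ) - 2) * n * Q ≤ yamabeC n * (-γ) * A ^ (yamabeP n - 1))
    {t : ℝ} (ht : t ∈ Set.Ico 0 Q) : A * (Q - t) ^ (-(((n : ℝ) - 2) / 2)) < W t := by
  have h3 := three_le_cast hn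
  have hc := yamabeC_pos hn
  have hp := one_lt_yamabeP hn
  set a := ((n : ℝ) - 2) / 2 with ha
  have ha0 : 0 < a := by rw [ha]; linarith
  have haP : -a * (yamabeP n - 1) = -2 := by
    have := yamabeP_mul hn
    rw [ha]; linarith
  set V : ℝ → ℝ := fun t => A * (Q - t) ^ (-a) with hV
  have hVc : ContinuousOn V (Set.Icc 0 t) := fun s hs =>
    (comparison_function_hasDerivAt (hs.2.trans_lt ht.2)).continuousAt.continuousWithinAt
  by_contra hcon
  push Not at hcon
  set D := Set.Icc 0 t ∩ {s | W s - V s ≤ 0} with hD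
  have hDc : IsClosed D := by
    have := (h.cont.continuousOn.sub hVc).preimage_isClosed_of_isClosed isClosed_Icc
      (isClosed_Iic (a := (0 : ℝ)))
    exact this
  have hDne : D.Nonempty := ⟨t, ⟨ht.1, le_rfl⟩, by simp only [Set.mem_ofPred_eq, hV]; linarith⟩
  have hDb : BddBelow D := ⟨0, fun s hs => hs.1.1⟩
  have hsD := hDc.csInf_mem hDne hDb
  set s₀ := sInf D with hs₀
  have hs₀t : s₀ ≤ t := hsD.1.2
  have hlt : ∀ s ∈ Set.Ico 0 s₀, V s < W s := by
    intro s hs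
    have h1 : s ∉ D := fun h' => (csInf_le hDb h').not_gt hs.2
    by_contra h2
    exact h1 ⟨⟨hs.1, (hs.2.trans_le hs₀t).le⟩, by simp only [Set.mem_ofPred_eq]; linarith⟩
  have hV0 : V 0 < W 0 := by simpa [hV] using hA0
  have hs₀0 : 0 < s₀ := by
    rcases eq_or_lt_of_le hsD.1.1 with h' | h'
    · have h2 : W s₀ - V s₀ ≤ 0 := hsD.2
      rw [← h'] at h2
      linarith
    · exact h'
  have hQs : ∀ s ∈ Set.Icc 0 s₀, s < Q := fun s hs => hs.2.trans_lt (hs₀t.trans_lt ht.2)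
  set V₁ : ℝ → ℝ := fun t => A * a * (Q - t) ^ (-a - 1) with hV₁
  have hVd : ∀ s ∈ Set.Icc 0 s₀, HasDerivAt V (V₁ s) s := fun s hs =>
    comparison_function_hasDerivAt (hQs s hs)
  have hV₁d : ∀ s ∈ Set.Icc 0 s₀,
      HasDerivAt V₁ (A * a * (a + 1) * (Q - s) ^ (-a - 2)) s := by
    intro s hs
    have h1 := comparison_function_hasDerivAt (A := A * a) (a := a + 1) (hQs s hs)
    simp only [hV₁]
    convert h1 using 3
    · ring_nf
    · ring
  have hmem : ∀ s ∈ Set.Ioo 0 s₀, s ∈ Set.Ioo 0 T := fun s hs =>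
    ⟨hs.1, (hQs s ⟨hs.1.le, hs.2.le⟩).trans_le hQT⟩
  -- Up to the first contact `s₀` the barrier lies below `W`, and the drift only helps since `β ≤ 0`
  -- and `W₁ ≥ 0`. So `V' ≤ W'`, the gap `W - V` cannot shrink, and contact is impossible.
  have hle : ∀ s ∈ Set.Ioo 0 s₀, V₁ s - W₁ s ≤ 0 := by
    intro s hs
    refine nonpos_of_two_mul_deriv_add_le (N := n) (T := s₀) (F := fun s => V₁ s - W₁ s)
      (fun s hs => (hV₁d s ⟨hs.1.le, hs.2.le⟩).sub (h.second_deriv s (hmem s hs))) ?_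
      (tendsto_rpow_mul_zero (by linarith)
        ((hV₁d 0 ⟨le_rfl, hs₀0.le⟩).continuousAt.sub h.cont_deriv.continuousAt)) hs
    intro s hs
    have hs' : s ∈ Set.Icc 0 s₀ := ⟨hs.1.le, hs.2.le⟩
    have hs0 : 0 < s := hs.1
    have hQs0 : 0 < Q - s := sub_pos.mpr (hQs s hs')
    have hW := h.pos s ⟨hs.1.le, (hmem s hs).2⟩
    have hW₁ := h.deriv_nonneg hn hγ (hmem s hs)
    have e1 : (Q - s) ^ (-a - 1) = (Q - s) ^ (-a - 2) * (Q - s) := by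
      rw [← Real.rpow_add_one hQs0.ne']; congr 1; ring
    have hX : 0 < (Q - s) ^ (-a - 2) := Real.rpow_pos_of_pos hQs0 _
    -- Since `2(a + 1) = n`, the combination `2s(a + 1) + n(Q - s)` is the constant `nQ`.
    have e2 : 2 * s * (A * a * (a + 1) * (Q - s) ^ (-a - 2)) + n * V₁ s
        = A / 2 * (Q - s) ^ (-a - 2) * (((n : ℝ) - 2) * n * Q) := by
      simp only [hV₁]
      rw [e1, ha]; ring
    have hVs : 0 < V s := mul_pos hA (Real.rpow_pos_of_pos hQs0 _)
    have e3 : V s ^ yamabeP n = A ^ (yamabeP n - 1) * A * (Q - s) ^ (-a - 2) := by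
      rw [rpow_eq_rpow_sub_one_mul hVs]
      simp only [hV]
      rw [Real.mul_rpow hA.le (Real.rpow_nonneg hQs0.le _), ← Real.rpow_mul hQs0.le, haP]
      rw [show -a - 2 = -2 + -a by ring, Real.rpow_add hQs0]
      ring
    have e4 : V s ^ yamabeP n ≤ W s ^ yamabeP n :=
      Real.rpow_le_rpow hVs.le (hlt s ⟨hs.1.le, hs.2⟩).le (by linarith)
    have e5 : 2 * s * (-(2 * n * W₁ s + yamabeC n * W s ^ (yamabeP n - 1) *
        (2 * β * yamabeP n * s * W₁ s + γ * W s)) / (4 * s)) + n * W₁ s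
        = yamabeC n / 2 * (-γ * W s ^ yamabeP n
          + 2 * (-β) * yamabeP n * s * W₁ s * W s ^ (yamabeP n - 1)) := by
      rw [rpow_eq_rpow_sub_one_mul hW (yamabeP n)]
      field_simp
      ring
    have e6 : 0 ≤ 2 * (-β) * yamabeP n * s * W₁ s * W s ^ (yamabeP n - 1) := by
      have : 0 ≤ -β := by linarith
      positivity
    have e7 : A / 2 * (Q - s) ^ (-a - 2) * (((n : ℝ) - 2) * n * Q)
        ≤ A / 2 * (Q - s) ^ (-a - 2) * (yamabeC n * (-γ) * A ^ (yamabeP n - 1)) :=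
      mul_le_mul_of_nonneg_left hAQ (by positivity)
    have e8 : A / 2 * (Q - s) ^ (-a - 2) * (yamabeC n * (-γ) * A ^ (yamabeP n - 1))
        = yamabeC n / 2 * (-γ * V s ^ yamabeP n) := by rw [e3]; ring
    have e9 : -γ * V s ^ yamabeP n ≤ -γ * W s ^ yamabeP n :=
      mul_le_mul_of_nonneg_left e4 (by linarith)
    have e10 : yamabeC n / 2 * (-γ * V s ^ yamabeP n) ≤ yamabeC n / 2 * (-γ * W s ^ yamabeP n
          + 2 * (-β) * yamabeP n * s * W₁ s * W s ^ (yamabeP n - 1)) :=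
      mul_le_mul_of_nonneg_left (by linarith) (by positivity)
    linarith
  have hmono : MonotoneOn (fun s => W s - V s) (Set.Icc 0 s₀) := by
    apply monotoneOn_of_hasDerivWithinAt_nonneg (convex_Icc 0 s₀) (f' := fun s => W₁ s - V₁ s)
    · exact h.cont.continuousOn.sub fun s hs => (hVd s hs).continuousAt.continuousWithinAt
    · intro s hs
      rw [interior_Icc] at hs
      exact ((h.deriv s (hmem s hs)).sub (hVd s ⟨hs.1.le, hs.2.le⟩)).hasDerivWithinAt
    · intro s hs
      rw [interior_Icc] at hs
      linarith [hle s hs]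
  have h1 := hmono ⟨le_rfl, hs₀0.le⟩ ⟨hs₀0.le, le_rfl⟩ hs₀0.le
  have h2 : W s₀ - V s₀ ≤ 0 := hsD.2
  simp only at h1
  linarith

/-- Keller-Osserman: there is no global profile if `β ≤ 0` and `γ < 0`. -/
lemma not_global_of_neg (hn : 3 ≤ n) (h : ∀ T, 0 < T → IsProfileOn n β γ W W₁ T) (hβ : β ≤ 0)
    (hγ : γ < 0) : False := by
  have h3 := three_le_cast hn
  have hc := yamabeC_pos hn
  have hp := one_lt_yamabeP hn
  set a := ((n : ℝ) - 2) / 2 with ha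
  have ha0 : 0 < a := by rw [ha]; linarith
  have haP : a * (yamabeP n - 1) = 2 := by
    have := yamabeP_mul hn
    rw [ha]; linarith
  have hW0 := (h 1 one_pos).pos 0 ⟨le_rfl, one_pos⟩
  set w := W 0 / 2 with hw
  have hw0 : 0 < w := by positivity
  have hX : 0 < yamabeC n * (-γ) * w ^ (yamabeP n - 1) := by
    have : 0 < -γ := by linarith
    positivity
  -- With `A = w Q^a` the barrier starts at `w = W(0) / 2`, and its subsolution condition becomes an
  -- equality exactly for this `Q`.
  set Q := ((n : ℝ) - 2) * n / (yamabeC n * (-γ) * w ^ (yamabeP n - 1)) with hQ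
  have hQ0 : 0 < Q := div_pos (by nlinarith) hX
  have hQa : 0 < Q ^ a := Real.rpow_pos_of_pos hQ0 _
  have hcomp : ∀ t ∈ Set.Ico 0 Q, w * Q ^ a * (Q - t) ^ (-a) < W t := by
    intro t ht
    refine (h Q hQ0).lt_of_comparison hn hβ hγ le_rfl (mul_pos hw0 hQa) ?_ ?_ ht
    · rw [← ha, mul_assoc, ← Real.rpow_add hQ0, add_neg_cancel, Real.rpow_zero]
      linarith
    · rw [Real.mul_rpow hw0.le hQa.le, ← Real.rpow_mul hQ0.le, haP, Real.rpow_two]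
      have : ((n : ℝ) - 2) * n = Q * (yamabeC n * (-γ) * w ^ (yamabeP n - 1)) := by
        rw [hQ, div_mul_cancel₀ _ hX.ne']
      rw [this]
      apply le_of_eq
      ring
  obtain ⟨M, hM⟩ := (isCompact_Icc (a := (0 : ℝ)) (b := Q)).exists_bound_of_continuousOn
    (h 1 one_pos).cont.continuousOn
  have hM0 := (le_abs_self _).trans (hM 0 ⟨le_rfl, hQ0.le⟩)
  have hMw : 1 < M / w := by rw [lt_div_iff₀ hw0]; linarith
  -- Chosen so that the barrier at `Q(1 - s)`, namely `w s^(-a)`, equals the upper bound `M` of `W`.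
  set s := (M / w) ^ (-(1 / a)) with hs
  have hs0 : 0 < s := Real.rpow_pos_of_pos (by linarith) _
  have hs1 : s < 1 := Real.rpow_lt_one_of_one_lt_of_neg hMw (by
    rw [neg_lt_zero]; positivity)
  have hmem : Q * (1 - s) ∈ Set.Ico 0 Q := ⟨by nlinarith, by nlinarith⟩
  have h1 := hcomp _ hmem
  have h2 := (le_abs_self _).trans (hM _ ⟨hmem.1, hmem.2.le⟩)
  have e : w * Q ^ a * (Q - Q * (1 - s)) ^ (-a) = M := by
    rw [show Q - Q * (1 - s) = Q * s by ring, Real.mul_rpow hQ0.le hs0.le, hs,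
      ← Real.rpow_mul (by linarith), show -(1 / a) * -a = 1 by field_simp, Real.rpow_one,
      Real.rpow_neg hQ0.le]
    field_simp
  linarith

end IsProfileOn

/-! ### Nonexistence for `β < 0 < γ` -/

namespace IsProfileOn

variable {n : ℕ} {β γ ρ T : ℝ} {W W₁ : ℝ → ℝ}

/-- This is the ODE tested with `W`. Its only positive contribution for `ρ > 0` and negative `-e` is
the square appearing in the Pohozaev identity, so a multiple of `E` can absorb it. -/
lemma virial_identity (hn : 3 ≤ n) (h : IsProfileOn n β γ W W₁ T)
    (hγ : γ = (2 * β + ρ) * (n + 2) / 4) {t : ℝ} (ht : t ∈ Set.Ioo 0 T) :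
    ∃ B', HasDerivAt (fun t => W t * (2 * t * W₁ t + (n - 2) / 2 * W t)
        + yamabeC n * β * yamabeP n / (yamabeP n + 1) * (t * W t ^ (yamabeP n + 1))) B' t ∧
      2 * t * B' + (n - 2) * (W t * (2 * t * W₁ t + (n - 2) / 2 * W t)
        + yamabeC n * β * yamabeP n / (yamabeP n + 1) * (t * W t ^ (yamabeP n + 1)))
        = 2 * (2 * t * W₁ t + (n - 2) / 2 * W t) ^ 2 - 2 * (t * radialEnergy n ρ W W₁ t)
          - yamabeC n * ρ * (n + 2) / (2 * n) * (t * W t ^ (yamabeP n + 1)) := by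
  have h3 := three_le_cast hn
  have hn2 : (n : ℝ) - 2 ≠ 0 := by linarith
  have hp := one_lt_yamabeP hn
  have hW := h.pos t ⟨ht.1.le, ht.2⟩
  have d0 := h.deriv t ht
  have d1 := h.second_deriv t ht
  have dp := d0.rpow_const (p := yamabeP n + 1) (Or.inl hW.ne')
  have hd := (d0.mul ((((hasDerivAt_id t).const_mul 2).mul d1).add
    (d0.const_mul (((n : ℝ) - 2) / 2)))).add
      (((hasDerivAt_id t).mul dp).const_mul (yamabeC n * β * yamabeP n / (yamabeP n + 1)))
  refine ⟨_, hd, ?_⟩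
  unfold radialEnergy
  simp only [Pi.add_apply, Pi.mul_apply]
  rw [rpow_add_one_eq_rpow_sub_one_mul hW, add_sub_cancel_right,
    rpow_eq_rpow_sub_one_mul hW (yamabeP n), hγ]
  generalize W t ^ (yamabeP n - 1) = S
  have ht0 : t ≠ 0 := ht.1.ne'
  have hp1 : yamabeP n + 1 ≠ 0 := by linarith
  have hP : yamabeP n = (n + 2) / (n - 2) := rfl
  have hP1 : yamabeP n + 1 = 2 * n / (n - 2) := by rw [hP]; field_simp; ring
  simp only [id_eq]
  rw [hP1, hP]
  field_simp
  ring

/-- For `γ > 0` and `β ≤ 0` the profile decays at the critical rate. -/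
lemma deriv_le_neg_rpow (hn : 3 ≤ n) (h : IsProfileOn n β γ W W₁ T) (hβ : β ≤ 0) (hγ : 0 < γ)
    {t : ℝ} (ht : t ∈ Set.Ioo 0 T) :
    W₁ t + yamabeC n * γ / (2 * n) * W t ^ yamabeP n ≤ 0 := by
  have h3 := three_le_cast hn
  have hc := yamabeC_pos hn
  have hp := one_lt_yamabeP hn
  have hcont : Continuous (fun t => W t ^ yamabeP n) :=
    h.cont.rpow_const fun t => Or.inr (by linarith)
  have hcont₁ := h.cont_deriv
  refine nonpos_of_two_mul_deriv_add_le (N := n) (T := T)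
    (F := fun t => W₁ t + yamabeC n * γ / (2 * n) * W t ^ yamabeP n)
    (fun s hs => (h.second_deriv s hs).add (((h.deriv s hs).rpow_const (p := yamabeP n)
      (Or.inl (h.pos s ⟨hs.1.le, hs.2⟩).ne')).const_mul _)) (fun s hs => ?_)
    (tendsto_rpow_mul_zero (by linarith) (Continuous.continuousAt (by fun_prop))) ht
  have hW := h.pos s ⟨hs.1.le, hs.2⟩
  have hW₁ := h.deriv_nonpos hn hγ hs
  have hs0 : 0 < s := hs.1
  have hS : 0 < W s ^ (yamabeP n - 1) := Real.rpow_pos_of_pos hW _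
  rw [rpow_eq_rpow_sub_one_mul hW (yamabeP n)]
  generalize W s ^ (yamabeP n - 1) = S at hS
  -- The coefficient `cγ / (2n)` is the one for which the `γW^p` terms cancel; what remains is a
  -- nonnegative factor times `W₁ ≤ 0`.
  have e : 2 * s * (-(2 * n * W₁ s + yamabeC n * S *
      (2 * β * yamabeP n * s * W₁ s + γ * W s)) / (4 * s)
        + yamabeC n * γ / (2 * n) * (W₁ s * yamabeP n * S))
      + n * (W₁ s + yamabeC n * γ / (2 * n) * (S * W s))
      = -((yamabeC n * yamabeP n * s * S * (-β) + yamabeC n * γ / n * yamabeP n * s * S)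
        * (-W₁ s)) := by
    field_simp
    ring
  rw [e, neg_nonpos]
  have h5 : 0 ≤ -β := by linarith
  have h6 : 0 ≤ -W₁ s := by linarith
  positivity

/-- Dividing `W' ≤ -(cγ/2n)W^p` by `W^p` and integrating gives `W^(1-p) ≥ kt`. -/
lemma mul_rpow_le (hn : 3 ≤ n) (h : ∀ T, 0 < T → IsProfileOn n β γ W W₁ T) (hβ : β ≤ 0)
    (hγ : 0 < γ) {t : ℝ} (ht : 0 < t) :
    t * W t ^ (yamabeP n - 1) ≤ ((yamabeP n - 1) * (yamabeC n * γ / (2 * n)))⁻¹ := by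
  have h3 := three_le_cast hn
  have hc := yamabeC_pos hn
  have hp := one_lt_yamabeP hn
  set k := (yamabeP n - 1) * (yamabeC n * γ / (2 * n)) with hk
  have hk0 : 0 < k := by
    have : 0 < yamabeP n - 1 := by linarith
    positivity
  have hpos : ∀ s, 0 ≤ s → 0 < W s := fun s hs =>
    (h (s + 1) (by linarith)).pos s ⟨hs, by linarith⟩
  have hmono : MonotoneOn (fun s => W s ^ (1 - yamabeP n) - k * s) (Set.Icc 0 t) := by
    have hd : ∀ s ∈ Set.Ioo 0 t, HasDerivAt (fun s => W s ^ (1 - yamabeP n) - k * s)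
        (W₁ s * (1 - yamabeP n) * W s ^ (1 - yamabeP n - 1) - k * 1) s := fun s hs =>
      (((h t ht).deriv s hs).rpow_const (Or.inl (hpos s hs.1.le).ne')).sub
        ((hasDerivAt_id s).const_mul k)
    apply monotoneOn_of_hasDerivWithinAt_nonneg (convex_Icc 0 t)
    · refine ContinuousOn.sub ?_ (by fun_prop)
      exact (h t ht).cont.continuousOn.rpow_const fun s hs => Or.inl (hpos s hs.1).ne'
    · intro s hs
      rw [interior_Icc] at hs
      exact (hd s hs).hasDerivWithinAt
    · intro s hs
      rw [interior_Icc] at hs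
      have h1 := (h t ht).deriv_le_neg_rpow hn hβ hγ hs
      have hW := hpos s hs.1.le
      have e : W s ^ (1 - yamabeP n - 1) = (W s ^ yamabeP n)⁻¹ := by
        rw [← Real.rpow_neg hW.le]; congr 1; ring
      have hWp : 0 < W s ^ yamabeP n := Real.rpow_pos_of_pos hW _
      rw [e, sub_nonneg, ← div_eq_mul_inv, le_div_iff₀ hWp, hk]
      nlinarith
  have h1 := hmono ⟨le_rfl, ht.le⟩ ⟨ht.le, le_rfl⟩ ht.le
  simp only [mul_zero, sub_zero] at h1
  have h2 : 0 < W 0 ^ (1 - yamabeP n) := Real.rpow_pos_of_pos (hpos 0 le_rfl) _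
  have e : W t ^ (yamabeP n - 1) = (W t ^ (1 - yamabeP n))⁻¹ := by
    rw [← Real.rpow_neg (hpos t ht.le).le]; congr 1; ring
  rw [e, ← div_eq_mul_inv, ← one_div, div_le_div_iff₀ (by nlinarith) hk0]
  linarith

/-- Radial superharmonic functions decay at most like the fundamental solution. -/
lemma two_mul_deriv_add_nonneg (hn : 3 ≤ n) (h : ∀ T, 0 < T → IsProfileOn n β γ W W₁ T)
    (hβ : β ≤ 0) (hγ : 0 < γ) {t : ℝ} (ht : 0 < t) : 0 ≤ 2 * t * W₁ t + (n - 2) * W t := by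
  have h3 := three_le_cast hn
  have hc := yamabeC_pos hn
  have hp := one_lt_yamabeP hn
  have hpos : ∀ s, 0 ≤ s → 0 < W s := fun s hs =>
    (h (s + 1) (by linarith)).pos s ⟨hs, by linarith⟩
  have hd : ∀ s, 0 < s → HasDerivAt W (W₁ s) s := fun s hs =>
    (h (s + 1) (by linarith)).deriv s ⟨hs, by linarith⟩
  have hd₂ := fun s (hs : 0 < s) =>
    (h (s + 1) (by linarith)).second_deriv s ⟨hs, by linarith⟩
  have hnp : ∀ s, 0 < s → W₁ s ≤ 0 := fun s hs =>
    (h (s + 1) (by linarith)).deriv_nonpos hn hγ ⟨hs, by linarith⟩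
  have hanti : AntitoneOn (fun s => 2 * s * W₁ s + (n - 2) * W s) (Set.Ioi 0) := by
    have hdX := fun s (hs : 0 < s) => (((hasDerivAt_id s).const_mul 2).mul (hd₂ s hs)).add
      ((hd s hs).const_mul ((n : ℝ) - 2))
    apply antitoneOn_of_hasDerivWithinAt_nonpos (convex_Ioi 0)
    · exact fun s hs => (hdX s hs).continuousAt.continuousWithinAt
    · intro s hs
      rw [interior_Ioi] at hs
      exact (hdX s hs).hasDerivWithinAt
    · intro s hs
      rw [interior_Ioi] at hs
      have hs : 0 < s := hs
      have hW := hpos s hs.le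
      have hW₁ := hnp s hs
      have e : 2 * 1 * W₁ s + 2 * id s * (-(2 * n * W₁ s + yamabeC n * W s ^ (yamabeP n - 1) *
          (2 * β * yamabeP n * s * W₁ s + γ * W s)) / (4 * s)) + (n - 2) * W₁ s
          = -(yamabeC n / 2 * W s ^ (yamabeP n - 1) *
            (2 * yamabeP n * s * (-β) * (-W₁ s) + γ * W s)) := by
        simp only [id_eq]
        field_simp
        ring
      rw [e, neg_nonpos]
      have h5 : 0 ≤ -β := by linarith
      have h6 : 0 ≤ -W₁ s := by linarith
      positivity
  by_contra hneg
  push Not at hneg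
  -- If the nonincreasing quantity is ever negative, then `2sW₁ ≤ -ε` from there on, so `W` falls at
  -- least like `-(ε/2) log s`; at `s = t exp (2W(t)/ε)` it would be nonpositive.
  set ε := -(2 * t * W₁ t + (n - 2) * W t) with hε
  have hε0 : 0 < ε := by linarith
  have hbound : ∀ s, t ≤ s → 2 * s * W₁ s ≤ -ε := by
    intro s hs
    have hs0 : 0 < s := ht.trans_le hs
    have h1 := hanti (Set.mem_Ioi.mpr ht) (Set.mem_Ioi.mpr hs0) hs
    simp only at h1
    have h2 : 0 < ((n : ℝ) - 2) * W s := mul_pos (by linarith) (hpos s hs0.le)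
    linarith
  have hlog : AntitoneOn (fun s => W s + ε / 2 * Real.log s) (Set.Ici t) := by
    have hdL := fun s (hs : 0 < s) =>
      (hd s hs).add ((Real.hasDerivAt_log hs.ne').const_mul (ε / 2))
    apply antitoneOn_of_hasDerivWithinAt_nonpos (convex_Ici t)
    · exact fun s hs => (hdL s (ht.trans_le hs)).continuousAt.continuousWithinAt
    · intro s hs
      rw [interior_Ici] at hs
      exact (hdL s (ht.trans hs)).hasDerivWithinAt
    · intro s hs
      rw [interior_Ici] at hs
      have hs0 : 0 < s := ht.trans hs
      have h1 := hbound s (le_of_lt hs)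
      have h2 : W₁ s ≤ -ε / (2 * s) := by
        rw [le_div_iff₀ (by positivity)]; linarith
      have h3 : -ε / (2 * s) + ε / 2 * s⁻¹ = 0 := by field_simp; ring
      linarith
  have hs1 : t ≤ t * Real.exp (2 * W t / ε) := by
    have h1 : 0 ≤ 2 * W t / ε := by have := hpos t ht.le; positivity
    nlinarith [Real.one_le_exp h1]
  have h1 := hlog (Set.mem_Ici.mpr le_rfl) hs1 hs1
  simp only at h1
  rw [Real.log_mul ht.ne' (Real.exp_pos _).ne', Real.log_exp] at h1
  have h2 : ε / 2 * (2 * W t / ε) = W t := by field_simp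
  have h4 := hpos (t * Real.exp (2 * W t / ε)) (by positivity)
  nlinarith

set_option maxHeartbeats 1000000 in
/-- There is no global profile if `β < 0` and `γ > 0`. -/
lemma not_global_of_neg_of_pos (hn : 3 ≤ n) (h : ∀ T, 0 < T → IsProfileOn n β γ W W₁ T)
    (hβ : β < 0) (hγ : 0 < γ) (hγρ : γ = (2 * β + ρ) * (n + 2) / 4) : False := by
  have h3 := three_le_cast hn
  have hc := yamabeC_pos hn
  have hp := one_lt_yamabeP hn
  -- With `β < 0`, positivity of `γ` forces `ρ > 0`, so the potential term of the energy is
  -- positive.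
  have hρ : 0 < ρ := by nlinarith
  have hpos : ∀ s, 0 ≤ s → 0 < W s := fun s hs =>
    (h (s + 1) (by linarith)).pos s ⟨hs, by linarith⟩
  have hnp : ∀ s, 0 < s → W₁ s ≤ 0 := fun s hs =>
    (h (s + 1) (by linarith)).deriv_nonpos hn hγ ⟨hs, by linarith⟩
  set p := yamabeP n with hpdef
  set a := ((n : ℝ) - 2) / 2 with ha
  have ha0 : 0 < a := by rw [ha]; linarith
  have haP : (p - 1) * a = 2 := by
    have := yamabeP_mul hn
    rw [ha, hpdef]; linarith
  set k := yamabeC n * ρ * (n + 2) * (n - 2) / (8 * n) with hk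
  have hk0 : 0 < k := by
    have : 0 < (n : ℝ) - 2 := by linarith
    positivity
  set e := radialEnergy n ρ W W₁ with he
  set V : ℝ → ℝ := fun t => t * W t ^ (p - 1) with hV
  set Z : ℝ → ℝ := fun t => t ^ a * W t ^ 2 with hZ
  set E : ℝ → ℝ := fun t => t ^ ((n : ℝ) / 2) * e t with hE
  set V₂ := ((p - 1) * (yamabeC n * γ / (2 * n)))⁻¹ with hV₂
  have hVpos : ∀ t, 0 < t → 0 < V t := fun t ht =>
    mul_pos ht (Real.rpow_pos_of_pos (hpos t ht.le) _)
  have hVle : ∀ t, 0 < t → V t ≤ V₂ := fun t ht => mul_rpow_le hn h hβ.le hγ ht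
  have hV₂0 : 0 < V₂ := (hVpos 1 one_pos).trans_le (hVle 1 one_pos)
  have hZpos : ∀ t, 0 < t → 0 < Z t := fun t ht =>
    mul_pos (Real.rpow_pos_of_pos ht _) (pow_pos (hpos t ht.le) 2)
  have hZV : ∀ t, 0 < t → Z t = V t ^ a := by
    intro t ht
    have hW := hpos t ht.le
    simp only [hZ, hV]
    rw [Real.mul_rpow ht.le (Real.rpow_nonneg hW.le _), ← Real.rpow_mul hW.le, haP,
      Real.rpow_two]
  set Z₂ := V₂ ^ a with hZ₂
  have hZ₂0 : 0 < Z₂ := Real.rpow_pos_of_pos hV₂0 _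
  have hZle : ∀ t, 0 < t → Z t ≤ Z₂ := fun t ht => by
    rw [hZV t ht]
    exact Real.rpow_le_rpow (hVpos t ht).le (hVle t ht) ha0.le
  have hEeq : ∀ t, 0 < t → E t = t ^ a * (t * e t) := by
    intro t ht
    simp only [hE]
    rw [show (n : ℝ) / 2 = a + 1 by rw [ha]; ring, Real.rpow_add_one ht.ne']
    ring
  have hY : ∀ t, 0 < t → 0 ≤ 2 * t * W₁ t + (n - 2) * W t := fun t ht =>
    two_mul_deriv_add_nonneg hn h hβ.le hγ ht
  -- The part of the energy involving `W₁` is `W₁(2tW₁ + (n - 2)W) ≤ 0`; only the potential term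
  -- survives in the upper bound.
  have hEle : ∀ t, 0 < t → E t ≤ k * V t * Z t := by
    intro t ht
    rw [hEeq t ht]
    have hW := hpos t ht.le
    have h1 : t * e t ≤ k * V t * W t ^ 2 := by
      simp only [he, radialEnergy, hV, hk]
      rw [rpow_add_one_eq_rpow_sub_one_mul hW]
      have h2 : t * W₁ t * (2 * t * W₁ t + (n - 2) * W t) ≤ 0 :=
        mul_nonpos_of_nonpos_of_nonneg (mul_nonpos_of_nonneg_of_nonpos ht.le (hnp t ht)) (hY t ht)
      linarith
    have h2 := mul_le_mul_of_nonneg_left h1 (Real.rpow_pos_of_pos ht a).le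
    simp only [hZ]
    linarith
  have hEd : ∀ t, 0 < t → ∃ E', HasDerivAt E E' t ∧
      2 * t * E' = -β * yamabeC n * p * V t * (t ^ a * (2 * t * W₁ t + a * W t) ^ 2) := by
    intro t ht
    obtain ⟨e', he1, he2⟩ := (h (t + 1) (by linarith)).exists_hasDerivAt_radialEnergy hn
      (ρ := ρ) hγρ (t := t) ⟨ht, by linarith⟩
    refine ⟨_, (Real.hasDerivAt_rpow_const (p := (n : ℝ) / 2) (Or.inl ht.ne')).mul he1, ?_⟩
    have e1 : t ^ ((n : ℝ) / 2 - 1) = t ^ a := by congr 1; rw [ha]; ring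
    have e2 : t ^ ((n : ℝ) / 2) = t ^ a * t := by
      rw [← Real.rpow_add_one ht.ne']; congr 1; rw [ha]; ring
    rw [e1, e2]
    simp only [hV]
    linear_combination (t ^ a * t) * he2
  have hepos : 0 < e 1 := by
    have := neg_of_two_mul_deriv_add_le (N := n) (T := 2) (F := fun t => -e t) (t := 1)
      (F' := fun t => -(_root_.deriv e t)) (fun t ht => by
        obtain ⟨e', he1, -⟩ := (h 2 two_pos).exists_hasDerivAt_radialEnergy hn (ρ := ρ) hγρ ht
        exact (he1.differentiableAt.hasDerivAt).fun_neg)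
      (fun t ht => by
        obtain ⟨e', he1, he2⟩ := (h 2 two_pos).exists_hasDerivAt_radialEnergy hn (ρ := ρ) hγρ ht
        have hW := hpos t ht.1.le
        have h1 : 0 ≤ (-β) * (yamabeC n * yamabeP n * W t ^ (yamabeP n - 1)
          * (2 * t * W₁ t + (n - 2) / 2 * W t) ^ 2) := by
          have : 0 < -β := by linarith
          have : 0 < yamabeP n := by linarith
          positivity
        rw [he, he1.deriv]
        linarith)
      (((h 1 one_pos).radialEnergy_continuous hn).neg.continuousAt) (by
        rw [he, (h 1 one_pos).radialEnergy_zero hn one_pos hγρ, neg_neg]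
        have h0 := hpos 0 le_rfl
        have : 0 < (n : ℝ) - 2 := by linarith
        have : 0 < yamabeC n * (n + 2) * (n - 2) / (4 * n) * W 0 ^ (yamabeP n + 1) := by
          positivity
        nlinarith)
      ⟨one_pos, by norm_num⟩
    linarith
  have hEmono : MonotoneOn E (Set.Ioi 0) := by
    choose! E' hE1 hE2 using hEd
    apply monotoneOn_of_hasDerivWithinAt_nonneg (convex_Ioi 0) (f' := E')
    · exact fun s hs => (hE1 s hs).continuousAt.continuousWithinAt
    · intro s hs
      rw [interior_Ioi] at hs
      exact (hE1 s hs).hasDerivWithinAt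
    · intro s hs
      rw [interior_Ioi] at hs
      have hs : 0 < s := hs
      have h1 := hE2 s hs
      have h2 : 0 ≤ -β * yamabeC n * p * V s * (s ^ a * (2 * s * W₁ s + a * W s) ^ 2) := by
        have h4 := hVpos s hs
        have h5 : 0 < -β := by linarith
        have := Real.rpow_pos_of_pos hs a
        positivity
      rw [← h1] at h2
      exact (mul_nonneg_iff_of_pos_left (by positivity)).mp h2
  set E₁ := E 1 with hE₁
  have hE₁0 : 0 < E₁ := by simp only [hE₁, hE, Real.one_rpow, one_mul]; exact hepos
  have hEge : ∀ t, 1 ≤ t → E₁ ≤ E t := fun t ht =>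
    hEmono (Set.mem_Ioi.mpr one_pos) (Set.mem_Ioi.mpr (by linarith)) ht
  -- As `E` stays above `E₁ > 0` while `E ≤ kVZ` and `Z ≤ Z₂`, the quantity `V` cannot tend to zero.
  set V₁ := E₁ / (k * Z₂) with hV₁
  have hV₁0 : 0 < V₁ := by positivity
  have hVge : ∀ t, 1 ≤ t → V₁ ≤ V t := by
    intro t ht
    have ht0 : 0 < t := by linarith
    rw [hV₁, div_le_iff₀ (by positivity)]
    calc E₁ ≤ k * V t * Z t := (hEge t ht).trans (hEle t ht0)
      _ ≤ k * V t * Z₂ :=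
        mul_le_mul_of_nonneg_left (hZle t ht0) (mul_pos hk0 (hVpos t ht0)).le
      _ = V t * (k * Z₂) := by ring
  set b := yamabeC n * β * p / (p + 1) with hb
  set B : ℝ → ℝ := fun t => W t * (2 * t * W₁ t + a * W t) + b * (t * W t ^ (p + 1)) with hB
  set Q : ℝ → ℝ := fun t => t ^ a * B t with hQ
  have hQd : ∀ t, 0 < t → ∃ Q', HasDerivAt Q Q' t ∧
      2 * t * Q' ≤ 2 * (t ^ a * (2 * t * W₁ t + a * W t) ^ 2) - 2 * E t := by
    intro t ht
    obtain ⟨B', hB1, hB2⟩ := (h (t + 1) (by linarith)).virial_identity hn (ρ := ρ) hγρ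
      (t := t) ⟨ht, by linarith⟩
    simp only [← ha, ← hpdef, ← hb, ← he] at hB1 hB2
    refine ⟨_, (Real.hasDerivAt_rpow_const (p := a) (Or.inl ht.ne')).mul hB1, ?_⟩
    have e1 : t ^ a = t ^ (a - 1) * t := by
      rw [← Real.rpow_add_one ht.ne']; congr 1; ring
    have hta := Real.rpow_pos_of_pos ht a
    have h5 : 2 * t * (a * t ^ (a - 1) * B t + t ^ a * B')
        = t ^ a * (2 * t * B' + (n - 2) * B t) := by
      rw [e1, ha]; ring
    refine (h5.trans_le ?_)
    have hW := hpos t ht.le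
    have h6 : 2 * t * B' + (n - 2) * B t
        ≤ 2 * (2 * t * W₁ t + a * W t) ^ 2 - 2 * (t * e t) := by
      simp only [hB]
      rw [hB2]
      have : 0 ≤ yamabeC n * ρ * (n + 2) / (2 * n) * (t * W t ^ (p + 1)) := by
        positivity
      linarith
    rw [hEeq t ht]
    have h7 := mul_le_mul_of_nonneg_left h6 hta.le
    linarith
  -- With `V ≥ V₁`, the growth of `κE` dominates the square in the virial inequality. Hence `Q - κE`
  -- has derivative at most `-E₁ / t`, although it is bounded below.
  set κ := 2 / (-β * yamabeC n * p * V₁) with hκ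
  have hβ' : 0 < -β := by linarith
  have hκ0 : 0 < κ := by positivity
  have hanti : AntitoneOn (fun t => Q t - κ * E t + E₁ * Real.log t) (Set.Ici 1) := by
    choose! E' hE1 hE2 using hEd
    choose! Q' hQ1 hQ2 using hQd
    have hd := fun t (ht : 0 < t) => ((hQ1 t ht).sub ((hE1 t ht).const_mul κ)).add
      ((Real.hasDerivAt_log ht.ne').const_mul E₁)
    apply antitoneOn_of_hasDerivWithinAt_nonpos (convex_Ici 1)
    · exact fun t ht => (hd t (one_pos.trans_le ht)).continuousAt.continuousWithinAt
    · intro t ht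
      rw [interior_Ici] at ht
      exact (hd t (one_pos.trans ht)).hasDerivWithinAt
    · intro t ht
      rw [interior_Ici] at ht
      have ht1 : 1 ≤ t := le_of_lt ht
      have ht0 : 0 < t := by linarith
      have hta := Real.rpow_pos_of_pos ht0 a
      set X := t ^ a * (2 * t * W₁ t + a * W t) ^ 2 with hX
      have hX0 : 0 ≤ X := by positivity
      have h5 : 2 * X ≤ κ * (2 * t * E' t) := by
        rw [hE2 t ht0]
        have h6 : κ * (-β * yamabeC n * p * V₁) = 2 := by
          rw [hκ]; exact div_mul_cancel₀ _ (by positivity)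
        have h7 : κ * (-β * yamabeC n * p * V₁) * X ≤ κ * (-β * yamabeC n * p * V t) * X := by
          have := hVge t ht1
          gcongr
        rw [h6] at h7
        linarith
      have h6 := hQ2 t ht0
      have h7 := hEge t ht1
      have h8 : 2 * t * (Q' t - κ * E' t + E₁ * t⁻¹) ≤ 0 := by
        have : 2 * t * (E₁ * t⁻¹) = 2 * E₁ := by field_simp
        nlinarith
      by_contra h9
      push Not at h9
      nlinarith [mul_pos ht0 h9]
  have hlow : ∀ t, 0 < t → -(a * Z₂ - b * (V₂ * Z₂) + κ * (k * V₂ * Z₂)) ≤ Q t - κ * E t := by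
    intro t ht
    have hW := hpos t ht.le
    have hta := Real.rpow_pos_of_pos ht a
    have hVZ : V t * Z t ≤ V₂ * Z₂ :=
      mul_le_mul (hVle t ht) (hZle t ht) (hZpos t ht).le hV₂0.le
    have h5 : E t ≤ k * (V₂ * Z₂) := by
      refine (hEle t ht).trans ?_
      rw [mul_assoc]
      exact mul_le_mul_of_nonneg_left hVZ hk0.le
    have h6 : Q t = t ^ a * (W t * (2 * t * W₁ t + a * W t)) + b * (V t * Z t) := by
      simp only [hQ, hB, hV, hZ]
      rw [rpow_add_one_eq_rpow_sub_one_mul hW]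
      ring
    have h7 : -(a * Z t) ≤ t ^ a * (W t * (2 * t * W₁ t + a * W t)) := by
      have h8 := hY t ht
      have h9 : -(a * W t) ≤ 2 * t * W₁ t + a * W t := by rw [ha]; linarith
      have h10 : t ^ a * (W t * (-(a * W t))) ≤ t ^ a * (W t * (2 * t * W₁ t + a * W t)) :=
        mul_le_mul_of_nonneg_left (mul_le_mul_of_nonneg_left h9 hW.le) hta.le
      simp only [hZ]
      linarith
    have hb0 : b ≤ 0 := by
      rw [hb]
      apply div_nonpos_of_nonpos_of_nonneg _ (by linarith)
      have : 0 < yamabeC n * p := by positivity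
      nlinarith
    have h8 : b * (V₂ * Z₂) ≤ b * (V t * Z t) := mul_le_mul_of_nonpos_left hVZ hb0
    have h9 := mul_le_mul_of_nonneg_left (hZle t ht) ha0.le
    have h10 := mul_le_mul_of_nonneg_left h5 hκ0.le
    linarith
  set L := a * Z₂ - b * (V₂ * Z₂) + κ * (k * V₂ * Z₂) with hL
  set H₁ := Q 1 - κ * E 1 with hH₁
  have hH₁L := hlow 1 one_pos
  -- By this time the logarithmic loss exceeds the distance between the initial value and the lower
  -- bound by `1`.
  have ht1 : 1 ≤ Real.exp ((H₁ + L + 1) / E₁) := by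
    apply Real.one_le_exp
    apply div_nonneg _ hE₁0.le
    linarith
  have h5 := hanti (Set.mem_Ici.mpr le_rfl) (Set.mem_Ici.mpr ht1) ht1
  have h6 := hlow (Real.exp ((H₁ + L + 1) / E₁)) (Real.exp_pos _)
  simp only [Real.log_exp, Real.log_one, mul_zero, add_zero] at h5
  have h7 : E₁ * ((H₁ + L + 1) / E₁) = H₁ + L + 1 := by field_simp
  linarith

end IsProfileOn

/-! ### Decay rates of shrinkers and steady solitons -/

namespace IsProfileOn

variable {n : ℕ} {β γ ρ T : ℝ} {W W₁ : ℝ → ℝ}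

/-- Profiles of shrinking solutions decay like those of cigars. -/
lemma isTheta_one (hn : 3 ≤ n) (h : ∀ T, 0 < T → IsProfileOn n β γ W W₁ T) (hβ : 0 < β)
    (hρ : 0 < ρ) (hγ : γ = (2 * β + ρ) * (n + 2) / 4) :
    (fun t => t * W t ^ (yamabeP n - 1)) =Θ[Filter.atTop] fun _ => (1 : ℝ) := by
  have h3 := three_le_cast hn
  have hc := yamabeC_pos hn
  have hpos : ∀ s, 0 ≤ s → 0 < W s := fun s hs =>
    (h (s + 1) (by linarith)).pos s ⟨hs, by linarith⟩
  set p := yamabeP n with hpdef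
  set a := ((n : ℝ) - 2) / 2 with ha
  have ha0 : 0 < a := by rw [ha]; linarith
  have haP : (p - 1) * a = 2 := by
    have := yamabeP_mul hn
    rw [ha, hpdef]; linarith
  set k := yamabeC n * ρ * (n + 2) * (n - 2) / (8 * n) with hk
  have hk0 : 0 < k := by
    have : 0 < (n : ℝ) - 2 := by linarith
    positivity
  set V : ℝ → ℝ := fun t => t * W t ^ (p - 1) with hV
  have hVpos : ∀ t, 0 < t → 0 < V t := fun t ht =>
    mul_pos ht (Real.rpow_pos_of_pos (hpos t ht.le) _)
  set e := radialEnergy n ρ W W₁ with he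
  -- Completing the square in `2tW₁ + aW` leaves only `V` and `W²`.
  have hte : ∀ t, 0 < t → (k * V t - a ^ 2 / 2) * W t ^ 2 ≤ t * e t := by
    intro t ht
    simp only [he, radialEnergy, hV, hk]
    rw [rpow_add_one_eq_rpow_sub_one_mul (hpos t ht.le)]
    have h1 : t * W₁ t * (2 * t * W₁ t + 2 * a * W t) + a ^ 2 / 2 * W t ^ 2
        = (2 * t * W₁ t + a * W t) ^ 2 / 2 := by ring
    have h2 := sq_nonneg (2 * t * W₁ t + a * W t)
    have h4 : (n : ℝ) - 2 = 2 * a := by rw [ha]; ring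
    rw [h4]
    linarith
  have hupper : ∀ t, 0 < t → V t ≤ a ^ 2 / (2 * k) := by
    intro t ht
    have h1 := (h (t + 1) (by linarith)).radialEnergy_neg hn hβ hγ (t := t) ⟨ht, by linarith⟩
    have h2 := hte t ht
    have h4 : t * e t < 0 := mul_neg_of_pos_of_neg ht h1
    rw [le_div_iff₀ (by positivity)]
    have hW2 : 0 < W t ^ 2 := pow_pos (hpos t ht.le) 2
    by_contra h5
    push Not at h5
    have h6 : 0 < (k * V t - a ^ 2 / 2) * W t ^ 2 := mul_pos (by linarith) hW2
    linarith
  set E₁ := -e 1 with hE₁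
  have hE₁0 : 0 < E₁ := by
    have := (h 2 two_pos).radialEnergy_neg hn hβ hγ (t := 1) ⟨one_pos, by norm_num⟩
    rw [hE₁, he]; linarith
  -- The weighted energy stays below `-E₁`, while the completed square bounds it below by `-(a²/2)
  -- t^a W² = -(a²/2) V^a`; comparing the two keeps `V` away from zero.
  have hlower : ∀ t, 1 ≤ t → (2 * E₁ / a ^ 2) ^ (1 / a) ≤ V t := by
    intro t ht
    have ht0 : 0 < t := by linarith
    have hta := Real.rpow_pos_of_pos ht0 a
    have hW := hpos t ht0.le
    have h1 := (h (t + 1) (by linarith)).antitoneOn_radialEnergy hn (ρ := ρ) hβ hγ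
      (a := 1) (b := t) ⟨one_pos, by linarith⟩ ⟨ht0, by linarith⟩ ht
    simp only [Real.one_rpow, one_mul] at h1
    rw [show (n : ℝ) / 2 = a + 1 by rw [ha]; ring, Real.rpow_add_one ht0.ne', ← he] at h1
    have h2 := mul_le_mul_of_nonneg_left (hte t ht0) hta.le
    have h4 : 0 ≤ t ^ a * (k * V t * W t ^ 2) := by
      have := hVpos t ht0
      positivity
    have hVa : V t ^ a = t ^ a * W t ^ 2 := by
      simp only [hV]
      rw [Real.mul_rpow ht0.le (Real.rpow_nonneg hW.le _), ← Real.rpow_mul hW.le, haP,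
        Real.rpow_two]
    have h5 : 2 * E₁ / a ^ 2 ≤ V t ^ a := by
      rw [hVa, div_le_iff₀ (by positivity)]
      linarith
    have h6 := Real.rpow_le_rpow (by positivity) h5 (by positivity : 0 ≤ 1 / a)
    rwa [← Real.rpow_mul (hVpos t ht0).le, mul_one_div_cancel ha0.ne', Real.rpow_one] at h6
  set v := (2 * E₁ / a ^ 2) ^ (1 / a) with hv
  have hv0 : 0 < v := by positivity
  constructor
  · refine Asymptotics.IsBigO.of_bound (a ^ 2 / (2 * k)) ?_
    filter_upwards [Filter.eventually_ge_atTop 1] with t ht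
    have ht0 : 0 < t := by linarith
    rw [Real.norm_eq_abs, abs_of_pos (hVpos t ht0), norm_one, mul_one]
    exact hupper t ht0
  · refine Asymptotics.IsBigO.of_bound v⁻¹ ?_
    filter_upwards [Filter.eventually_ge_atTop 1] with t ht
    have ht0 : 0 < t := by linarith
    rw [Real.norm_eq_abs (_ * _), abs_of_pos (hVpos t ht0), norm_one, inv_mul_eq_div,
      le_div_iff₀ hv0, one_mul]
    exact hlower t ht

/-- The quantity driving the growth of `t W ^ (p - 1)` for steady solutions. -/
lemma steady_identities (hn : 3 ≤ n) (h : IsProfileOn n β γ W W₁ T)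
    (hγ : γ = 2 * β * (n + 2) / 4) {t : ℝ} (ht : t ∈ Set.Ioo 0 T) :
    HasDerivAt (fun t => t * W t ^ (yamabeP n - 1))
      ((yamabeP n - 1) / 2 * (t * W t ^ (yamabeP n - 2) * (2 * t * W₁ t + (n - 2) / 2 * W t)) / t) t
    ∧ ∃ x', HasDerivAt
        (fun t => t * W t ^ (yamabeP n - 2) * (2 * t * W₁ t + (n - 2) / 2 * W t)) x' t ∧
      2 * t * x' = t * W t ^ (yamabeP n - 1) * ((((n : ℝ) - 2) / 2) ^ 2
        + (yamabeP n - 2) * ((2 * t * W₁ t + (n - 2) / 2 * W t) / W t) ^ 2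
        - yamabeC n * β * yamabeP n *
          (t * W t ^ (yamabeP n - 2) * (2 * t * W₁ t + (n - 2) / 2 * W t))) := by
  have h3 := three_le_cast hn
  have hn2 : (n : ℝ) - 2 ≠ 0 := by linarith
  have hp := one_lt_yamabeP hn
  have hW := h.pos t ⟨ht.1.le, ht.2⟩
  have d0 := h.deriv t ht
  have d1 := h.second_deriv t ht
  have dp := d0.rpow_const (p := yamabeP n - 1) (Or.inl hW.ne')
  have dp2 := d0.rpow_const (p := yamabeP n - 2) (Or.inl hW.ne')
  have e1 : W t ^ (yamabeP n - 1) = W t ^ (yamabeP n - 2 - 1) * W t ^ 2 := by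
    rw [← Real.rpow_two, ← Real.rpow_add hW]; congr 1; ring
  have e2 : W t ^ (yamabeP n - 2) = W t ^ (yamabeP n - 2 - 1) * W t := by
    rw [← Real.rpow_add_one hW.ne']; congr 1; ring
  have e3 : W t ^ (yamabeP n - 1 - 1) = W t ^ (yamabeP n - 2 - 1) * W t := by
    rw [← Real.rpow_add_one hW.ne']; congr 1; ring
  have hP : yamabeP n = (n + 2) / (n - 2) := rfl
  have ht0 : t ≠ 0 := ht.1.ne'
  have hW0 := hW.ne'
  constructor
  · refine ((hasDerivAt_id t).mul dp).congr_deriv ?_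
    rw [e1, e2, e3]
    generalize W t ^ (yamabeP n - 2 - 1) = S
    simp only [id_eq]
    rw [hP]
    field_simp
    ring
  · refine ⟨_, ((hasDerivAt_id t).mul dp2).mul ((((hasDerivAt_id t).const_mul 2).mul d1).add
      (d0.const_mul (((n : ℝ) - 2) / 2))), ?_⟩
    simp only [Pi.mul_apply]
    rw [e1, e2]
    generalize W t ^ (yamabeP n - 2 - 1) = S
    simp only [id_eq]
    rw [hP, hγ]
    field_simp
    ring

/-- Profiles of steady solutions decay like those of logarithmic cigars. -/
lemma isTheta_log (hn : 3 ≤ n) (h : ∀ T, 0 < T → IsProfileOn n β γ W W₁ T) (hβ : 0 < β)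
    (hγ : γ = 2 * β * (n + 2) / 4) :
    (fun t => t * W t ^ (yamabeP n - 1)) =Θ[Filter.atTop] Real.log := by
  have h3 := three_le_cast hn
  have hc := yamabeC_pos hn
  have hp := one_lt_yamabeP hn
  have hpos : ∀ s, 0 ≤ s → 0 < W s := fun s hs =>
    (h (s + 1) (by linarith)).pos s ⟨hs, by linarith⟩
  set p := yamabeP n with hpdef
  set a := ((n : ℝ) - 2) / 2 with ha
  have ha0 : 0 < a := by rw [ha]; linarith
  set V : ℝ → ℝ := fun t => t * W t ^ (p - 1) with hV
  have hVpos : ∀ t, 0 < t → 0 < V t := fun t ht =>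
    mul_pos ht (Real.rpow_pos_of_pos (hpos t ht.le) _)
  set x : ℝ → ℝ := fun t => t * W t ^ (p - 2) * (2 * t * W₁ t + a * W t) with hx
  set b := yamabeC n * β * p with hb
  have hb0 : 0 < b := by positivity
  -- For `ρ = 0`, `(2tW₁ + aW)² = 2te + a²W²` and the energy is negative.
  have hq : ∀ t, 0 < t → ((2 * t * W₁ t + a * W t) / W t) ^ 2 ≤ a ^ 2 := by
    intro t ht
    have hW := hpos t ht.le
    have h1 := (h (t + 1) (by linarith)).radialEnergy_neg hn (ρ := 0) hβ (by rw [hγ]; ring)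
      (t := t) ⟨ht, by linarith⟩
    unfold radialEnergy at h1
    have h4 : (n : ℝ) - 2 = 2 * a := by rw [ha]; ring
    simp only [mul_zero, zero_mul, zero_div, add_zero, h4] at h1
    rw [div_pow, div_le_iff₀ (by positivity)]
    nlinarith [mul_neg_of_pos_of_neg ht h1]
  have hid := fun t (ht : 0 < t) => (h (t + 1) (by linarith)).steady_identities hn hγ
    (t := t) ⟨ht, by linarith⟩
  simp only [← hpdef, ← ha, ← hb] at hid
  have hVd : ∀ t, 0 < t → HasDerivAt V ((p - 1) / 2 * x t / t) t := fun t ht => (hid t ht).1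
  choose! x' hxd hx' using fun t (ht : 0 < t) => (hid t ht).2
  -- The sign of `p - 2` depends on `n`; the minimum covers both cases.
  set m₀ := min 1 (p - 1) * a ^ 2 with hm₀
  have hm₀0 : 0 < m₀ := mul_pos (lt_min one_pos (by linarith)) (by positivity)
  have hA : ∀ t, 0 < t → m₀ ≤ a ^ 2 + (p - 2) * ((2 * t * W₁ t + a * W t) / W t) ^ 2 ∧
      a ^ 2 + (p - 2) * ((2 * t * W₁ t + a * W t) / W t) ^ 2 ≤ p * a ^ 2 := by
    intro t ht
    have h1 := hq t ht
    have h2 := sq_nonneg ((2 * t * W₁ t + a * W t) / W t)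
    generalize ((2 * t * W₁ t + a * W t) / W t) ^ 2 = y at h1 h2
    have h4 : m₀ ≤ 1 * a ^ 2 := mul_le_mul_of_nonneg_right (min_le_left _ _) (sq_nonneg a)
    have h5 : m₀ ≤ (p - 1) * a ^ 2 := mul_le_mul_of_nonneg_right (min_le_right _ _) (sq_nonneg a)
    constructor
    · rcases le_total 2 p with h6 | h6 <;> nlinarith
    · rcases le_total 2 p with h6 | h6 <;> nlinarith [sq_nonneg a]
  -- Near the origin `2tW₁ + aW` is close to `aW(0) > 0`, which starts the barrier argument on the
  -- positive side.
  obtain ⟨t₀, ht₀, hxt₀⟩ : ∃ t₀, 0 < t₀ ∧ 0 < x t₀ := by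
    have hW0 := hpos 0 le_rfl
    have h1 := (h 1 one_pos).cont
    have h2 := (h 1 one_pos).cont_deriv
    have hcont : ContinuousAt (fun t => 2 * t * W₁ t + a * W t) 0 :=
      Continuous.continuousAt (by fun_prop)
    have hev : ∀ᶠ t in nhdsWithin (0 : ℝ) (Set.Ioi 0), 0 < 2 * t * W₁ t + a * W t :=
      (hcont.eventually (lt_mem_nhds (by simp only [mul_zero, zero_mul, zero_add]; positivity))
        ).filter_mono nhdsWithin_le_nhds
    obtain ⟨t, ht, ht'⟩ := (hev.and self_mem_nhdsWithin).exists
    have ht' : 0 < t := ht'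
    have hW := hpos t ht'.le
    exact ⟨t, ht', by simp only [hx]; positivity⟩
  -- The sign of `x'` is that of a quantity between `m₀` and `p a²` minus `b x`. So `x` increases
  -- whenever it equals `x₁` and decreases whenever it equals `x₂`, and cannot leave `[x₁, x₂]`.
  set x₁ := min (x t₀) (m₀ / b) / 2 with hx₁
  have hx₁0 : 0 < x₁ := by
    have : 0 < min (x t₀) (m₀ / b) := lt_min hxt₀ (by positivity)
    positivity
  have hx₁b : b * x₁ < m₀ := by
    have h1 : x₁ < m₀ / b := by
      have : min (x t₀) (m₀ / b) ≤ m₀ / b := min_le_right _ _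
      linarith
    rw [lt_div_iff₀ hb0] at h1
    linarith
  set x₂ := max (x t₀) (p * a ^ 2 / b) + 1 with hx₂
  have hx₂b : p * a ^ 2 < b * x₂ := by
    have h1 : p * a ^ 2 / b < x₂ := (le_max_right _ _).trans_lt (lt_add_one _)
    rw [div_lt_iff₀ hb0] at h1
    linarith
  have hlow : ∀ t, t₀ < t → x₁ ≤ x t := by
    intro t ht
    have := nonpos_of_deriv_neg_of_eq_zero (a := t₀) (T := t + 1) (F := fun t => x₁ - x t)
      (F' := fun t => -x' t) ((continuousAt_const.sub (hxd t₀ ht₀).continuousAt))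
      (by have : min (x t₀) (m₀ / b) ≤ x t₀ := min_le_left _ _
          linarith)
      (fun s hs => (hxd s (ht₀.trans hs.1)).const_sub x₁) (fun s hs hs0 => by
        have hs' : 0 < s := ht₀.trans hs.1
        have h1 := hx' s hs'
        have h2 : x s = x₁ := by linarith
        have h4 : 0 < 2 * s * x' s := by
          rw [h1]
          refine mul_pos (hVpos s hs') ?_
          have := (hA s hs').1
          simp only [hx] at h2
          rw [h2]
          linarith
        have := (mul_pos_iff_of_pos_left (by positivity)).mp h4
        linarith) ⟨ht, by linarith⟩
    linarith
  have hupp : ∀ t, t₀ < t → x t ≤ x₂ := by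
    intro t ht
    have := nonpos_of_deriv_neg_of_eq_zero (a := t₀) (T := t + 1) (F := fun t => x t - x₂)
      (F' := x') (((hxd t₀ ht₀).continuousAt.sub continuousAt_const))
      (by have : x t₀ ≤ max (x t₀) (p * a ^ 2 / b) := le_max_left _ _
          linarith)
      (fun s hs => (hxd s (ht₀.trans hs.1)).sub_const x₂) (fun s hs hs0 => by
        have hs' : 0 < s := ht₀.trans hs.1
        have h1 := hx' s hs'
        have h2 : x s = x₂ := by linarith
        have h4 : 2 * s * x' s < 0 := by
          rw [h1]
          refine mul_neg_of_pos_of_neg (hVpos s hs') ?_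
          have := (hA s hs').2
          simp only [hx] at h2
          rw [h2]
          linarith
        by_contra h5
        push Not at h5
        nlinarith) ⟨ht, by linarith⟩
    linarith
  have hlogd : ∀ C t, 0 < t → HasDerivAt (fun t => V t - C * Real.log t)
      ((p - 1) / 2 * x t / t - C * t⁻¹) t := fun C t ht =>
    (hVd t ht).sub ((Real.hasDerivAt_log ht.ne').const_mul C)
  set c₁ := (p - 1) / 2 * x₁ with hc₁
  set c₂ := (p - 1) / 2 * x₂ with hc₂
  have hc₁0 : 0 < c₁ := mul_pos (by linarith) hx₁0
  have hmono : MonotoneOn (fun t => V t - c₁ * Real.log t) (Set.Ici t₀) := by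
    apply monotoneOn_of_hasDerivWithinAt_nonneg (convex_Ici t₀)
    · exact fun t ht => (hlogd c₁ t (ht₀.trans_le ht)).continuousAt.continuousWithinAt
    · intro t ht
      rw [interior_Ici] at ht
      exact (hlogd c₁ t (ht₀.trans ht)).hasDerivWithinAt
    · intro t ht
      rw [interior_Ici] at ht
      have ht0 : 0 < t := ht₀.trans ht
      rw [← div_eq_mul_inv, ← sub_div, hc₁]
      apply div_nonneg _ ht0.le
      have := hlow t ht
      nlinarith
  have hanti : AntitoneOn (fun t => V t - c₂ * Real.log t) (Set.Ici t₀) := by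
    apply antitoneOn_of_hasDerivWithinAt_nonpos (convex_Ici t₀)
    · exact fun t ht => (hlogd c₂ t (ht₀.trans_le ht)).continuousAt.continuousWithinAt
    · intro t ht
      rw [interior_Ici] at ht
      exact (hlogd c₂ t (ht₀.trans ht)).hasDerivWithinAt
    · intro t ht
      rw [interior_Ici] at ht
      have ht0 : 0 < t := ht₀.trans ht
      rw [← div_eq_mul_inv, ← sub_div, hc₂]
      apply div_nonpos_of_nonpos_of_nonneg _ ht0.le
      have := hupp t ht
      nlinarith
  set C₁ := V t₀ - c₁ * Real.log t₀ with hC₁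
  set C₂ := V t₀ - c₂ * Real.log t₀ with hC₂
  have hlogtop := Real.tendsto_log_atTop
  constructor
  · refine Asymptotics.IsBigO.of_bound (c₂ + 1) ?_
    filter_upwards [Filter.eventually_ge_atTop t₀,
      hlogtop.eventually_ge_atTop (max 0 C₂)] with t ht hlog
    have h1 := hanti (Set.mem_Ici.mpr le_rfl) (Set.mem_Ici.mpr ht) ht
    simp only at h1
    have h2 := (le_max_left 0 C₂).trans hlog
    have h4 := (le_max_right 0 C₂).trans hlog
    rw [Real.norm_eq_abs, abs_of_pos (hVpos t (ht₀.trans_le ht)), Real.norm_eq_abs,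
      abs_of_nonneg h2]
    linarith
  · refine Asymptotics.IsBigO.of_bound (2 / c₁) ?_
    filter_upwards [Filter.eventually_ge_atTop t₀,
      hlogtop.eventually_ge_atTop (max 0 (-C₁ * 2 / c₁))] with t ht hlog
    have h1 := hmono (Set.mem_Ici.mpr le_rfl) (Set.mem_Ici.mpr ht) ht
    simp only at h1
    have h2 := (le_max_left 0 _).trans hlog
    have h4 := (le_max_right 0 _).trans hlog
    rw [div_le_iff₀ hc₁0] at h4
    rw [Real.norm_eq_abs, Real.norm_eq_abs, abs_of_nonneg h2,
      abs_of_pos (hVpos t (ht₀.trans_le ht)), div_mul_eq_mul_div, le_div_iff₀ hc₁0]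
    linarith

end IsProfileOn

/-! ### From profile asymptotics to solutions, and the explicit families -/

/-- The asymptotics of a solution from those of its profile. -/
lemma ofProfile_isTheta {n : ℕ} (hn : 3 ≤ n) {W L : ℝ → ℝ} (hW : ∀ t, 0 < t → 0 < W t)
    (hL : ∀ᶠ t in Filter.atTop, 0 ≤ L t)
    (h : (fun t => t * W t ^ (yamabeP n - 1)) =Θ[Filter.atTop] L) :
    ofProfile n W =Θ[Bornology.cobounded (EuclideanSpace ℝ (Fin n))]
      fun x => (L (‖x‖ ^ 2) / ‖x‖ ^ 2) ^ (1 / (1 - yamabeM n)) := by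
  have htend : Filter.Tendsto (fun x : EuclideanSpace ℝ (Fin n) => ‖x‖ ^ 2)
      (Bornology.cobounded _) Filter.atTop :=
    (Filter.tendsto_pow_atTop two_ne_zero).comp tendsto_norm_cobounded_atTop
  have h1 : (fun t => W t ^ (yamabeP n - 1)) =Θ[Filter.atTop] fun t => L t / t := by
    have h2 := h.div (Asymptotics.isTheta_refl (fun t : ℝ => t) Filter.atTop)
    refine Asymptotics.IsTheta.trans (Filter.EventuallyEq.isTheta ?_) h2
    filter_upwards [Filter.eventually_gt_atTop 0] with t ht
    field_simp
  have h2 := Asymptotics.IsTheta.rpow (r := 1 / (1 - yamabeM n)) (by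
      filter_upwards [Filter.eventually_gt_atTop 0] with t ht
      exact Real.rpow_nonneg (hW t ht).le _) (by
      filter_upwards [Filter.eventually_gt_atTop 0, hL] with t ht hLt
      exact div_nonneg hLt ht.le) h1
  have h3 : (fun x : EuclideanSpace ℝ (Fin n) =>
        (W (‖x‖ ^ 2) ^ (yamabeP n - 1)) ^ (1 / (1 - yamabeM n)))
      =Θ[Bornology.cobounded _] fun x => (L (‖x‖ ^ 2) / ‖x‖ ^ 2) ^ (1 / (1 - yamabeM n)) :=
    ⟨h2.1.comp_tendsto htend, h2.2.comp_tendsto htend⟩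
  refine Asymptotics.IsTheta.trans (Filter.EventuallyEq.isTheta ?_) h3
  filter_upwards [htend.eventually_gt_atTop 0] with x hx
  unfold ofProfile
  rw [← Real.rpow_mul (hW _ hx).le, inv_one_sub_yamabeM_mul hn]

/-- Solutions whose profile is `(K / (l² + t)) ^ d`. -/
lemma isRadialSolution_rational {n : ℕ} (hn : 3 ≤ n) {β γ K d l : ℝ} (hK : 0 < K) (hl : 0 < l)
    (hode : ∀ t, 0 ≤ t → 4 * t * (d * (d + 1)) - 2 * n * d * (l ^ 2 + t)
      + yamabeC n * (-(2 * β * yamabeP n * t * d) + γ * (l ^ 2 + t))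
        * ((l ^ 2 + t) * (K / (l ^ 2 + t)) ^ (d * (yamabeP n - 1))) = 0) :
    IsRadialSolution n β γ (fun x => (K / (l ^ 2 + ‖x‖ ^ 2)) ^ (d * yamabeP n)) := by
  have hl2 : 0 < l ^ 2 := by positivity
  have hy : ∀ t, 0 ≤ t → 0 < l ^ 2 + t := fun t ht => by positivity
  have hKd : 0 < K ^ d := Real.rpow_pos_of_pos hK _
  set W : ℝ → ℝ := fun t => K ^ d * (l ^ 2 + t) ^ (-d) with hW
  set W₁ : ℝ → ℝ := fun t => K ^ d * (-d * (l ^ 2 + t) ^ (-d - 1)) with hW₁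
  have hpow : ∀ (q t : ℝ), 0 < l ^ 2 + t →
      HasDerivAt (fun t => (l ^ 2 + t) ^ q) (q * (l ^ 2 + t) ^ (q - 1)) t := by
    intro q t ht
    refine (((hasDerivAt_id t).const_add (l ^ 2)).rpow_const (p := q)
      (Or.inl ht.ne')).congr_deriv ?_
    simp
  have hWeq : ∀ t, 0 ≤ t → W t = (K / (l ^ 2 + t)) ^ d := by
    intro t ht
    simp only [hW]
    rw [Real.div_rpow hK.le (hy t ht).le, Real.rpow_neg (hy t ht).le, div_eq_mul_inv]
  have hWpos : ∀ t, 0 ≤ t → 0 < W t := fun t ht =>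
    mul_pos hKd (Real.rpow_pos_of_pos (hy t ht) _)
  have hsol : IsRadialSolution n β γ (ofProfile n W) := by
    refine isRadialSolution_ofProfile hn (W₁ := W₁) hWpos (fun t ht => ?_) (fun t ht => ?_)
      fun t ht => ?_
    · have h1 : ContDiffAt ℝ ∞ (fun t => (l ^ 2 + t) ^ (-d)) t :=
        ContDiffAt.rpow_const_of_ne (by fun_prop) (hy t ht).ne'
      exact contDiffAt_const.mul h1
    · filter_upwards [lt_mem_nhds (show -l ^ 2 < t by linarith)] with s hs
      exact (hpow (-d) s (by linarith)).const_mul _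
    · refine ⟨_, (((hpow (-d - 1) t (hy t ht)).const_mul (-d)).const_mul (K ^ d)), ?_⟩
      have h0 := hode t ht
      have h1 : W t ^ (yamabeP n - 1) = (K / (l ^ 2 + t)) ^ (d * (yamabeP n - 1)) := by
        rw [hWeq t ht, ← Real.rpow_mul (div_pos hK (hy t ht)).le]
      rw [rpow_eq_rpow_sub_one_mul (hWpos t ht) (yamabeP n), h1]
      simp only [hW, hW₁]
      have e1 : (l ^ 2 + t) ^ (-d) = (l ^ 2 + t) ^ (-d - 1 - 1) * (l ^ 2 + t) ^ 2 := by
        rw [← Real.rpow_two (l ^ 2 + t), ← Real.rpow_add (hy t ht)]; congr 1; ring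
      have e2 : (l ^ 2 + t) ^ (-d - 1) = (l ^ 2 + t) ^ (-d - 1 - 1) * (l ^ 2 + t) := by
        rw [← Real.rpow_add_one (hy t ht).ne']; congr 1; ring
      rw [e1, e2]
      -- The hypothesis is the profile ODE divided by `K^d (l² + t)^(-d-2)`.
      linear_combination (K ^ d * (l ^ 2 + t) ^ (-d - 1 - 1)) * h0
  convert hsol using 2 with x
  unfold ofProfile
  rw [hWeq _ (by positivity), ← Real.rpow_mul]
  positivity

lemma sphereSolution_zero {n : ℕ} {l : ℝ} (hl : 0 < l) :
    sphereSolution n l 0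
      = (Real.sqrt (4 * (n : ℝ) * ((n : ℝ) - 1)) / l) ^ (2 / (1 - yamabeM n)) := by
  unfold sphereSolution
  congr 1
  simp
  field_simp

/-- For `γ = nβ` the nonlocal term disappears and `W' = -(cβ/2)W^p` integrates explicitly. With `ρ =
1` this fixes `β = (n + 2) / (2(n - 2))`; the exponent `d = (n - 2)/4` has `d(p - 1) = 1`, so the
check is polynomial. -/
lemma barenblatt_isSolutionFamily {n : ℕ} (hn : 3 ≤ n) {β : ℝ}
    (hγ : yamabeGamma n β 1 = β * n) :
    IsSolutionFamily n β (yamabeGamma n β 1) (barenblatt n) := by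
  have h3 := three_le_cast hn
  have hn2 : (n : ℝ) - 2 ≠ 0 := by linarith
  have hn1 : (n : ℝ) - 1 ≠ 0 := by linarith
  have hK : 0 < ((n : ℝ) - 2) * (n - 1) := mul_pos (by linarith) (by linarith)
  have hβ : β = (n + 2) / (2 * (n - 2)) := by
    rw [yamabeGamma_eq hn] at hγ
    rw [eq_div_iff (by positivity)]
    linarith
  have hE : 1 / (1 - yamabeM n) = ((n : ℝ) - 2) / 4 * yamabeP n := by
    rw [one_sub_yamabeM hn]
    unfold yamabeP
    field_simp
  have hE0 : 0 < 1 / (1 - yamabeM n) := by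
    rw [one_sub_yamabeM hn]; positivity
  refine isSolutionFamily_of_isRadialSolution hn (fun l hl => ?_) fun a ha => ?_
  · unfold barenblatt
    rw [hE, hγ]
    refine isRadialSolution_rational hn hK hl fun t ht => ?_
    have hy : 0 < l ^ 2 + t := by positivity
    have e1 : ((n : ℝ) - 2) / 4 * (yamabeP n - 1) = 1 := by
      have := yamabeP_mul hn
      linarith
    rw [e1, Real.rpow_one, mul_div_cancel₀ _ hy.ne', hβ]
    unfold yamabeC yamabeP yamabeM
    field_simp
    ring
  · have hb : ∀ l : ℝ, 0 < l → (barenblatt n l 0 = a ↔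
        ((n : ℝ) - 2) * (n - 1) / l ^ 2 = a ^ (1 / (1 - yamabeM n))⁻¹) := by
      intro l hl
      unfold barenblatt
      rw [norm_zero, zero_pow two_ne_zero, add_zero, ← Real.rpow_left_inj (by positivity)
        (Real.rpow_nonneg ha.le (1 / (1 - yamabeM n))⁻¹) hE0.ne', ← Real.rpow_mul ha.le,
        inv_mul_cancel₀ hE0.ne', Real.rpow_one]
    have hq : 0 < a ^ (1 / (1 - yamabeM n))⁻¹ := Real.rpow_pos_of_pos ha _
    set q := a ^ (1 / (1 - yamabeM n))⁻¹
    refine ⟨√(((n : ℝ) - 2) * (n - 1) / q), ⟨Real.sqrt_pos.mpr (div_pos hK hq), ?_⟩, ?_⟩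
    · rw [hb _ (Real.sqrt_pos.mpr (div_pos hK hq)), Real.sq_sqrt (div_pos hK hq).le]
      field_simp
    · rintro l ⟨hl, hl'⟩
      rw [hb l hl] at hl'
      rw [← hl', div_div_cancel₀ hK.ne', Real.sqrt_sq hl.le]

/-- For `β = 0` this is the Yamabe equation with its standard bubbles; here `d = (n - 2)/2`, so `d(p
- 1) = 2` and only the square `4n(n - 1)` of the constant enters. -/
lemma sphereSolution_isSolutionFamily {n : ℕ} (hn : 3 ≤ n) :
    IsSolutionFamily n 0 (yamabeGamma n 0 1) (sphereSolution n) := by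
  have h3 := three_le_cast hn
  have hn2 : (n : ℝ) - 2 ≠ 0 := by linarith
  have hn1 : (n : ℝ) - 1 ≠ 0 := by linarith
  have hA2 : 0 < 4 * (n : ℝ) * ((n : ℝ) - 1) := mul_pos (by linarith) (by linarith)
  have hA : 0 < Real.sqrt (4 * (n : ℝ) * ((n : ℝ) - 1)) := Real.sqrt_pos.mpr hA2
  have hE : 2 / (1 - yamabeM n) = ((n : ℝ) - 2) / 2 * yamabeP n := by
    rw [one_sub_yamabeM hn]
    unfold yamabeP
    field_simp
    ring
  have hE0 : 0 < 2 / (1 - yamabeM n) := by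
    rw [one_sub_yamabeM hn]; positivity
  refine isSolutionFamily_of_isRadialSolution hn (fun l hl => ?_) fun a ha => ?_
  · unfold sphereSolution
    rw [hE]
    refine isRadialSolution_rational hn (mul_pos hA hl) hl fun t ht => ?_
    have hy : 0 < l ^ 2 + t := by positivity
    have e1 : ((n : ℝ) - 2) / 2 * (yamabeP n - 1) = 2 := by
      have := yamabeP_mul hn
      linarith
    rw [e1, Real.rpow_two, div_pow, mul_pow, Real.sq_sqrt hA2.le, yamabeGamma_eq hn]
    unfold yamabeC yamabeP yamabeM
    field_simp
    ring
  · have hb : ∀ l : ℝ, 0 < l → (sphereSolution n l 0 = a ↔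
        Real.sqrt (4 * (n : ℝ) * ((n : ℝ) - 1)) / l = a ^ (2 / (1 - yamabeM n))⁻¹) := by
      intro l hl
      rw [sphereSolution_zero hl, ← Real.rpow_left_inj (by positivity)
        (Real.rpow_nonneg ha.le (2 / (1 - yamabeM n))⁻¹) hE0.ne', ← Real.rpow_mul ha.le,
        inv_mul_cancel₀ hE0.ne', Real.rpow_one]
    have hq : 0 < a ^ (2 / (1 - yamabeM n))⁻¹ := Real.rpow_pos_of_pos ha _
    set q := a ^ (2 / (1 - yamabeM n))⁻¹
    refine ⟨Real.sqrt (4 * (n : ℝ) * ((n : ℝ) - 1)) / q, ⟨div_pos hA hq, ?_⟩, ?_⟩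
    · rw [hb _ (div_pos hA hq)]
      field_simp
    · rintro l ⟨hl, hl'⟩
      rw [hb l hl] at hl'
      rw [← hl', div_div_cancel₀ hA.ne']

lemma inv_norm_sq_rpow {n : ℕ} (q : ℝ) (x : EuclideanSpace ℝ (Fin n)) :
    (1 / ‖x‖ ^ 2) ^ q = ‖x‖ ^ (-(2 * q)) := by
  rw [one_div, ← Real.rpow_two, Real.inv_rpow (by positivity), ← Real.rpow_mul (norm_nonneg x),
    Real.rpow_neg (norm_nonneg x)]

lemma sphereSolution_isTheta {n : ℕ} (hn : 3 ≤ n) {l : ℝ} (hl : 0 < l) :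
    sphereSolution n l =Θ[Bornology.cobounded (EuclideanSpace ℝ (Fin n))]
      fun x => ‖x‖ ^ (-(4 / (1 - yamabeM n))) := by
  have h3 := three_le_cast hn
  have hA : 0 < Real.sqrt (4 * (n : ℝ) * ((n : ℝ) - 1)) * l :=
    mul_pos (Real.sqrt_pos.mpr (mul_pos (by linarith) (by linarith))) hl
  have e : (fun x : EuclideanSpace ℝ (Fin n) => ‖x‖ ^ (-(4 / (1 - yamabeM n))))
      = fun x => (1 / ‖x‖ ^ 2) ^ (2 / (1 - yamabeM n)) := by
    ext x
    rw [inv_norm_sq_rpow]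
    congr 1
    ring
  rw [e]
  unfold sphereSolution
  set K := Real.sqrt (4 * (n : ℝ) * ((n : ℝ) - 1)) * l
  have htend : Filter.Tendsto (fun x : EuclideanSpace ℝ (Fin n) => ‖x‖)
      (Bornology.cobounded _) Filter.atTop := tendsto_norm_cobounded_atTop
  refine Asymptotics.IsTheta.rpow (Filter.Eventually.of_forall fun x => by
    simp only [Pi.zero_apply]; positivity) (Filter.Eventually.of_forall fun x => by
    simp only [Pi.zero_apply]; positivity) ⟨?_, ?_⟩
  · refine Asymptotics.IsBigO.of_bound K ?_
    filter_upwards [htend.eventually_gt_atTop 0] with x hx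
    rw [Real.norm_of_nonneg (by positivity), Real.norm_of_nonneg (by positivity),
      mul_one_div]
    gcongr
    nlinarith
  · refine Asymptotics.IsBigO.of_bound (2 / K) ?_
    filter_upwards [htend.eventually_gt_atTop 0, htend.eventually_gt_atTop l] with x hx hxl
    rw [Real.norm_of_nonneg (by positivity), Real.norm_of_nonneg (by positivity)]
    have h1 : 2 / K * (K / (l ^ 2 + ‖x‖ ^ 2)) = 2 / (l ^ 2 + ‖x‖ ^ 2) := by field_simp
    rw [h1, div_le_div_iff₀ (by positivity) (by positivity)]
    nlinarith

/-! ### Complete families and the classification -/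

/-- A complete family of solutions parametrized by the value at the origin. -/
lemma exists_isSolutionFamily {n : ℕ} (hn : 3 ≤ n) {β γ : ℝ}
    (p : (EuclideanSpace ℝ (Fin n) → ℝ) → Prop)
    (h : ∀ l, 0 < l → ∃ u, IsRadialSolution n β γ u ∧ u 0 = l ∧ p u) :
    ∃ u, IsSolutionFamily n β γ u ∧ ∀ l, 0 < l → u l 0 = l ∧ p (u l) := by
  choose! u hu using h
  refine ⟨u, isSolutionFamily_of_isRadialSolution hn (fun l hl => (hu l hl).1) fun a ha => ?_,
    fun l hl => (hu l hl).2⟩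
  refine ⟨a, ⟨ha, (hu a ha).2.1⟩, ?_⟩
  rintro l ⟨hl, rfl⟩
  exact (hu l hl).2.1.symm

lemma IsRadialSolution.not_const {n : ℕ} {β γ : ℝ} {u : EuclideanSpace ℝ (Fin n) → ℝ}
    (hγ : γ ≠ 0) (hu : IsRadialSolution n β γ u) : ¬ ∃ c : ℝ, ∀ x, u x = c := by
  rintro ⟨c, hc⟩
  have h1 : u = fun _ => c := funext hc
  subst h1
  have h2 := hu.equation 0
  have h3 := hu.pos 0
  simp [hγ] at h2
  linarith

/-- Solutions exist for `β > 0`. -/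
lemma exists_isRadialSolution_of_pos {n : ℕ} (hn : 3 ≤ n) {β : ℝ} (ρ : ℝ) (hβ : 0 < β)
    {l : ℝ} (hl : 0 < l) : ∃ u, IsRadialSolution n β (yamabeGamma n β ρ) u ∧ u 0 = l := by
  -- The coefficient can vanish with `β > 0`, as for `ρ = -1`, `β = 1/2`; the family then consists
  -- of constants.
  by_cases h0 : yamabeGamma n β ρ = 0
  · rw [h0]
    exact ⟨fun _ => l, isRadialSolution_const n hl, rfl⟩
  · obtain ⟨W, -, -, h1, h2⟩ := exists_isRadialSolution hn hβ (yamabeGamma_eq hn β ρ) h0 hl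
    exact ⟨_, h1, h2⟩

/-- The sign of `γ` decides: `γ = 0` leaves only constants, `γ ≠ 0` excludes them. For `γ < 0` the
condition `β > 0` is forced and entails `ρ = -1`; for `γ > 0` negative `β` is impossible, and `β =
0` is the sphere case `ρ = 1`. -/
lemma exists_nonconst_iff {n : ℕ} (hn : 3 ≤ n) {ρ : ℝ} (hρ : ρ = 1 ∨ ρ = -1 ∨ ρ = 0) (β : ℝ) :
    (∃ u, IsRadialSolution n β (yamabeGamma n β ρ) u ∧ ¬ ∃ c : ℝ, ∀ x, u x = c) ↔
      (0 ≤ β ∧ 0 < yamabeGamma n β ρ) ∨ (ρ = -1 ∧ 0 < β ∧ yamabeGamma n β ρ < 0) := by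
  have h3 := three_le_cast hn
  have hγ := yamabeGamma_eq hn β ρ
  have hsign : ∀ {s : ℝ}, yamabeGamma n β ρ = s → (s < 0 → 2 * β + ρ < 0) ∧
      (0 < s → 0 < 2 * β + ρ) := by
    rintro s rfl
    rw [hγ]
    constructor
    · intro h; by_contra h'; push Not at h'
      have : 0 ≤ (2 * β + ρ) * (n + 2) / 4 := by positivity
      linarith
    · intro h; by_contra h'; push Not at h'
      nlinarith
  constructor
  · rintro ⟨u, hu, hnc⟩
    obtain ⟨W, W₁, hW, -⟩ := hu.exists_isProfileOn hn
    rcases lt_trichotomy (yamabeGamma n β ρ) 0 with hneg | hzero | hpos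
    · right
      have hβ : 0 < β := by
        by_contra hβ
        exact IsProfileOn.not_global_of_neg hn hW (not_lt.mp hβ) hneg
      have h4 := (hsign rfl).1 hneg
      refine ⟨?_, hβ, hneg⟩
      rcases hρ with rfl | rfl | rfl
      · linarith
      · rfl
      · linarith
    · exfalso
      rw [hzero] at hu
      exact hnc ⟨u 0, fun x => congrFun (hu.eq_const hn) x⟩
    · left
      refine ⟨?_, hpos⟩
      by_contra hβ
      exact IsProfileOn.not_global_of_neg_of_pos hn hW (not_le.mp hβ) hpos hγ
  · intro h
    have hne : yamabeGamma n β ρ ≠ 0 := by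
      rcases h with ⟨-, h⟩ | ⟨-, -, h⟩
      · exact h.ne'
      · exact h.ne
    suffices h' : ∃ u, IsRadialSolution n β (yamabeGamma n β ρ) u by
      obtain ⟨u, hu⟩ := h'
      exact ⟨u, hu, hu.not_const hne⟩
    have hβ0 : 0 ≤ β := by
      rcases h with ⟨h, -⟩ | ⟨-, h, -⟩
      · exact h
      · exact h.le
    rcases eq_or_lt_of_le hβ0 with hβ | hβ
    · subst hβ
      rcases h with ⟨-, h⟩ | ⟨-, h, -⟩
      · have h4 := (hsign rfl).2 h
        rcases hρ with rfl | rfl | rfl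
        · exact ⟨_, (sphereSolution_isSolutionFamily hn).solution 1 one_pos⟩
        · linarith
        · linarith
      · exact absurd h (lt_irrefl _)
    · obtain ⟨u, hu, -⟩ := exists_isRadialSolution_of_pos hn ρ hβ one_pos
      exact ⟨u, hu⟩

lemma exists_cigar_family {n : ℕ} (hn : 3 ≤ n) {β : ℝ} (hβ : 0 < β) :
    ∃ u : ℝ → EuclideanSpace ℝ (Fin n) → ℝ,
      IsSolutionFamily n β (yamabeGamma n β 1) u ∧ ∀ l, 0 < l → u l 0 = l ∧
        u l =Θ[Bornology.cobounded (EuclideanSpace ℝ (Fin n))]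
          fun x => ‖x‖ ^ (-(2 / (1 - yamabeM n))) := by
  refine exists_isSolutionFamily hn (fun u => u =Θ[Bornology.cobounded _]
    fun x => ‖x‖ ^ (-(2 / (1 - yamabeM n)))) fun l hl => ?_
  have hγ := yamabeGamma_eq hn β 1
  obtain ⟨W, W₁, hW, hu, hl0⟩ := exists_isRadialSolution hn hβ hγ
    (by rw [hγ]; positivity) hl
  refine ⟨_, hu, hl0, ?_⟩
  have h1 := ofProfile_isTheta hn (fun t ht => (hW (t + 1) (by linarith)).pos t
    ⟨ht.le, by linarith⟩) (Filter.Eventually.of_forall fun _ => zero_le_one)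
    (IsProfileOn.isTheta_one hn hW hβ one_pos hγ)
  convert h1 using 2 with x
  rw [inv_norm_sq_rpow, mul_one_div]

lemma exists_logarithmic_cigar_family {n : ℕ} (hn : 3 ≤ n) {β : ℝ} (hβ : 0 < β) :
    ∃ u : ℝ → EuclideanSpace ℝ (Fin n) → ℝ,
      IsSolutionFamily n β (yamabeGamma n β 0) u ∧ ∀ l, 0 < l → u l 0 = l ∧
        u l =Θ[Bornology.cobounded (EuclideanSpace ℝ (Fin n))]
          fun x => (Real.log ‖x‖ / ‖x‖ ^ 2) ^ (1 / (1 - yamabeM n)) := by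
  refine exists_isSolutionFamily hn (fun u => u =Θ[Bornology.cobounded _]
    fun x => (Real.log ‖x‖ / ‖x‖ ^ 2) ^ (1 / (1 - yamabeM n))) fun l hl => ?_
  have hγ := yamabeGamma_eq hn β 0
  obtain ⟨W, W₁, hW, hu, hl0⟩ := exists_isRadialSolution hn hβ hγ
    (by rw [hγ]; positivity) hl
  refine ⟨_, hu, hl0, ?_⟩
  -- The profile variable is `|x|²`, so its logarithm is twice `log |x|`, a factor invisible to the
  -- asymptotics.
  have hlog : Real.log =Θ[Filter.atTop] fun t => Real.log √t := by
    have h1 : (fun t => Real.log √t) =ᶠ[Filter.atTop] fun t => 1 / 2 * Real.log t := by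
      filter_upwards [Filter.eventually_ge_atTop 0] with t ht
      rw [Real.log_sqrt ht]; ring
    have h2 : (fun t => 1 / 2 * Real.log t) =Θ[Filter.atTop] Real.log :=
      (Asymptotics.isTheta_const_mul_left (by norm_num)).mpr (Asymptotics.isTheta_refl _ _)
    exact h2.symm.trans h1.symm.isTheta
  have h1 := ofProfile_isTheta hn (fun t ht => (hW (t + 1) (by linarith)).pos t
    ⟨ht.le, by linarith⟩) (by
      filter_upwards [Filter.eventually_ge_atTop 1] with t ht
      exact Real.log_nonneg (Real.one_le_sqrt.mpr ht))
    ((IsProfileOn.isTheta_log hn hW hβ (by rw [hγ]; ring)).trans hlog)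
  convert h1 using 2 with x
  rw [Real.sqrt_sq (norm_nonneg x)]

theorem proposition1p3 (n : ℕ) (hn : 3 ≤ n) :
    -- for which parameters there is a nontrivial (that is, nonconstant) solution
    (∀ ρ : ℝ, (ρ = 1 ∨ ρ = -1 ∨ ρ = 0) → ∀ β : ℝ,
      ((∃ u, IsRadialSolution n β (yamabeGamma n β ρ) u ∧ ¬ ∃ c : ℝ, ∀ x, u x = c) ↔
        (0 ≤ β ∧ 0 < yamabeGamma n β ρ) ∨
          (ρ = -1 ∧ 0 < β ∧ yamabeGamma n β ρ < 0))) ∧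
    -- shrinkers: cigars
    (∀ β : ℝ, 0 < β → ∃ u : ℝ → EuclideanSpace ℝ (Fin n) → ℝ,
      IsSolutionFamily n β (yamabeGamma n β 1) u ∧ ∀ l, 0 < l →
        u l 0 = l ∧
        u l =Θ[Bornology.cobounded (EuclideanSpace ℝ (Fin n))]
          fun x => ‖x‖ ^ (-(2 / (1 - yamabeM n)))) ∧
    -- shrinkers: Barenblatt solutions
    (∀ β : ℝ, 0 < β → yamabeGamma n β 1 = β * n →
      IsSolutionFamily n β (yamabeGamma n β 1) (barenblatt n)) ∧
    -- shrinkers: spheres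
    (IsSolutionFamily n 0 (yamabeGamma n 0 1) (sphereSolution n) ∧ ∀ l, 0 < l →
      sphereSolution n l =Θ[Bornology.cobounded (EuclideanSpace ℝ (Fin n))]
        fun x => ‖x‖ ^ (-(4 / (1 - yamabeM n)))) ∧
    -- expanders
    (∀ β : ℝ, 0 < β → ∃ u : ℝ → EuclideanSpace ℝ (Fin n) → ℝ,
      IsSolutionFamily n β (yamabeGamma n β (-1)) u ∧ ∀ l, 0 < l → u l 0 = l) ∧
    -- steady solitons: logarithmic cigars
    (∀ β : ℝ, 0 < β → ∃ u : ℝ → EuclideanSpace ℝ (Fin n) → ℝ,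
      IsSolutionFamily n β (yamabeGamma n β 0) u ∧ ∀ l, 0 < l →
        u l 0 = l ∧
        u l =Θ[Bornology.cobounded (EuclideanSpace ℝ (Fin n))]
          fun x => (Real.log ‖x‖ / ‖x‖ ^ 2) ^ (1 / (1 - yamabeM n))) ∧
    -- steady solitons: constants
    (∀ u, IsRadialSolution n 0 (yamabeGamma n 0 0) u ↔ ∃ c : ℝ, 0 < c ∧ ∀ x, u x = c) := by
  refine ⟨fun ρ hρ β => exists_nonconst_iff hn hρ β, fun β hβ => exists_cigar_family hn hβ,
    fun β _ hγ => barenblatt_isSolutionFamily hn hγ,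
    ⟨sphereSolution_isSolutionFamily hn, fun l hl => sphereSolution_isTheta hn hl⟩,
    fun β hβ => ?_, fun β hβ => exists_logarithmic_cigar_family hn hβ, fun u => ?_⟩
  · obtain ⟨u, hu, hu'⟩ := exists_isSolutionFamily hn (β := β) (γ := yamabeGamma n β (-1))
      (fun _ => True) fun l hl => by
        obtain ⟨u, h1, h2⟩ := exists_isRadialSolution_of_pos hn (-1) hβ hl
        exact ⟨u, h1, h2, trivial⟩
    exact ⟨u, hu, fun l hl => (hu' l hl).1⟩
  · have h0 : yamabeGamma n 0 0 = 0 := by simp [yamabeGamma]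
    rw [h0]
    constructor
    · intro hu
      exact ⟨u 0, hu.pos 0, fun x => congrFun (hu.eq_const hn) x⟩
    · rintro ⟨c, hc, hu⟩
      rw [show u = fun _ => c from funext hu]
      exact isRadialSolution_const n hc
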